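/- **Setting.** Let $X$ be a jointly measurable zero-mean Gaussian process on $[0,1]$ with continuous covariance function $K(s,t)=\mathbb E[X(s)X(t)]$, and let $\lambda_1\ge\lambda_2\ge\cdots$ and $\phi_1,\phi_2,\dots$ (orthonormal in $L^2([0,1])$) be the eigenvalues, counted with multiplicity, and eigenfunctions of the integral operator with kernel $K$ (listed until they exhaust the range of that operator). Assume: 1. there are $\beta>1$ and $C,C_1,C_2>0$ with $C_2p^{-\beta}\le\lambda_p\le C_1p^{-\beta}$ and $\lambda_p-\lambda_{p+1}\ge Cp^{-(\beta+1)}$ for all $p\ge1$; 2. $(a_p)_{p\ge1}$ is a real sequence, not identically zero, with $\sum_pa_p^2<\infty$, and there are $\alpha>0$ and a real sequence $(b_p)$ with $\sum_pb_p^2<\infty$ and $a_p\le b_pp^{-\alpha}$ for all large $p$. For $h\in L^2([0,1])$ put $\|h\|_{mod}^2=\sum_{p\ge1}\frac{\langle h,\phi_p\rangle^2}{\lambda_p}a_p^2\in[0,\infty]$, and let $F(x)=\mathbb P(\|X\|_{mod}^2\le x)$ for $x\in[0,\infty]$ (so $F(\infty)=1$). **Estimation.** Let $f_1,f_2,\dots$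 be i.i.d. copies of $X$ (the data). For each $n$ let $\hat K_n(s,t)=\frac1n\sum_{i=1}^n(f_i(s)-\bar f_n(s))(f_i(t)-\bar f_n(t))$ with $\bar f_n=\frac1n\sum_{i=1}^nf_i$, and let $\hat\lambda_{1,n}\ge\hat\lambda_{2,n}\ge\cdots\ge0$ and $\hat\phi_{1,n},\hat\phi_{2,n},\dots$ be the eigenvalues and orthonormal eigenfunctions of the operator with kernel $\hat K_n$ (chosen arbitrarily where not unique, and continued by null functions of that operator with eigenvalue $0$). Let $\delta_n>0$ be thresholds with $\delta_n\to0$ and $\delta_n\ge c\,(\sqrt n/\log n)^{-\beta/(2\beta+1)}$ for some $c>0$ and all large $n$. Let $M_n$ be the largest $m$ with $\hat\lambda_{m,n}\ge\delta_n$ (or, alternatively, the largest $m$ with $\lambda_m\ge\delta_n$; the result holds for either choice), with $M_n=0$ if there is none, let $C_n=\min(M_n,n)$, and put $$\|h\|_{\widehat{mod}}=\Big(\sum_{p=1}^{C_n}\frac{\langle h,\hat\phi_{p,n}\rangle^2}{\hat\lambda_{p,n}}a_p^2\Big)^{1/2}.$$ Conditionally on the data let, for each $n$, $g^{(n)}_1,g^{(n)}_2,\dots$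 be i.i.d. jointly measurable zero-mean Gaussian processes with covariance function $\hat K_n$; nothing is assumed about their joint law for different $n$. For a fixed $f_{obs}\in L^2([0,1])$ let $$D_{n,N}=\frac1N\sum_{j=1}^N\mathbf 1\{\|g^{(n)}_j\|_{\widehat{mod}}\ge\|f_{obs}\|_{\widehat{mod}}\},\qquad d=1-F(\|f_{obs}\|_{mod}^2).$$ **Theorem.** $D_{n,N}\to d$ as $N,n\to\infty$, in the following senses. For almost every realization of the data, under the conditional law of the Monte Carlo samples given the data: (i) almost surely, $\lim_{N\to\infty}D_{n,N}$ exists for every $n$, and $\lim_{n\to\infty}\lim_{N\to\infty}D_{n,N}=d$; (ii) for every sequence $N_0(n)$ of natural numbers with $N_0(n)/\log n\to\infty$, almost surely $\sup_{N\ge N_0(n)}|D_{n,N}-d|\to0$ as $n\to\infty$; (iii) if the samples for different $n$ are generated from common random numbers, that is, if there are random variables $Z_{j,p}$ not depending on $n$ such that for all $n,j$ almost surely $\langle g^{(n)}_j,\hat\phi_{p,n}\rangle=\hat\lambda_{p,n}^{1/2}Z_{j,p}$ for all $p\le C_n$, then almost surely $D_{n,N}\to d$ as $N\to\infty$ and $n\to\infty$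 jointly, without restriction; (iv) without any such condition, $D_{n,N}\to d$ in probability as $N\to\infty$ and $n\to\infty$ jointly, without restriction. -/

import Mathlib

open MeasureTheory ProbabilityTheory Filter Topology
open scoped ENNReal unitInterval

noncomputable section

namespace ModelDepth

/-- `L²([0,1])` with Lebesgue measure. -/
abbrev L2I : Type := Lp ℝ 2 (volume : Measure I)

/-- `X` is a zero-mean Gaussian process on `[0,1]`, jointly measurable in time and chance, whose
covariance function is `K`. -/
structure IsZeroMeanGP {Ω : Type*} [MeasurableSpace Ω] (X : I → Ω → ℝ) (K : I → I → ℝ)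
    (P : Measure Ω) : Prop where
  measurable : Measurable (fun z : I × Ω => X z.1 z.2)
  gaussian : IsGaussianProcess X P
  mean_zero : ∀ t, ∫ ω, X t ω ∂P = 0
  cov_eq : ∀ s t, ∫ ω, X s ω * X t ω ∂P = K s t

/-- `(lam p, phi p)` (`p = 0, 1, 2, …` stands for `1, 2, 3, …`) is the spectral system of the
integral operator with kernel `K`: orthonormal eigenfunctions with non-increasing non-negative
eigenvalues, which exhaust the spectrum in the sense that the operator vanishes on everything
orthogonal to all of them. -/
structure IsEigenSystem (K : I → I → ℝ) (lam : ℕ → ℝ) (phi : ℕ → L2I) : Prop where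
  orthonormal : Orthonormal ℝ phi
  antitone : Antitone lam
  nonneg : ∀ p, 0 ≤ lam p
  eigen : ∀ p, ∀ᵐ t : I, ∫ s : I, K s t * phi p s = lam p * phi p t
  exhaustive : ∀ h : L2I, (∀ p, inner ℝ h (phi p) = 0) → ∀ᵐ t : I, ∫ s : I, K s t * h s = 0

/-- The coefficient `∫₀¹ h(t) φ(t) dt`. -/
def coeff (h : I → ℝ) (φ : L2I) : ℝ := ∫ t : I, h t * φ t

/-- The squared modified norm `∑ₚ ⟨h, φₚ⟩² aₚ² / λₚ`, possibly infinite. -/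
def modSq (lam : ℕ → ℝ) (phi : ℕ → L2I) (a : ℕ → ℝ) (h : I → ℝ) : ℝ≥0∞ :=
  ∑' p, ENNReal.ofReal (coeff h (phi p) ^ 2 / lam p * a p ^ 2)

/-- The distribution function `x ↦ P(‖X‖²_mod ≤ x)`, for `x ∈ [0, ∞]`. -/
def modCDF {Ω : Type*} [MeasurableSpace Ω] (P : Measure Ω) (X : I → Ω → ℝ)
    (lam : ℕ → ℝ) (phi : ℕ → L2I) (a : ℕ → ℝ) (x : ℝ≥0∞) : ℝ :=
  P.real {ω | modSq lam phi a (fun t => X t ω) ≤ x}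

/-- The sample mean of the first `n` functions. -/
def sampleMean (f : ℕ → I → ℝ) (n : ℕ) (t : I) : ℝ := (1 / (n : ℝ)) * ∑ i ∈ Finset.range n, f i t

/-- The empirical covariance kernel of the first `n` functions. -/
def empCov (f : ℕ → I → ℝ) (n : ℕ) (s t : I) : ℝ :=
  (1 / (n : ℝ)) * ∑ i ∈ Finset.range n,
    (f i s - sampleMean f n s) * (f i t - sampleMean f n t)

/-- The largest `m ≥ 1` such that the `m`-th eigenvalue is at least `δ` (`0` if there is none). -/
def truncLevel (ev : ℕ → ℝ) (δ : ℝ) : ℕ := sSup {m : ℕ | 1 ≤ m ∧ δ ≤ ev (m - 1)}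

/-- The sample version of the modified norm, `(∑_{p ≤ C} ⟨h, φ̂ₚ⟩² aₚ² / λ̂ₚ)^{1/2}`. -/
def modHat (lamHat : ℕ → ℝ) (phiHat : ℕ → L2I) (a : ℕ → ℝ) (C : ℕ) (h : I → ℝ) : ℝ :=
  √(∑ p ∈ Finset.range C, coeff h (phiHat p) ^ 2 / lamHat p * a p ^ 2)

open Classical in
/-- The Monte Carlo depth estimate: the proportion of `g 0, …, g (N-1)` whose norm `nrm` is at
least that of `fobs`. -/
def mcDepth (nrm : (I → ℝ) → ℝ) (fobs : I → ℝ) (g : ℕ → I → ℝ) (N : ℕ) : ℝ :=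
  (1 / (N : ℝ)) * ∑ j ∈ Finset.range N, if nrm fobs ≤ nrm (g j) then 1 else 0

/-- Polynomial decay, with exponent `β`, of the eigenvalues and of their gaps. -/
def EigenDecay (lam : ℕ → ℝ) (β : ℝ) : Prop :=
  1 < β ∧ ∃ C C₁ C₂ : ℝ, 0 < C ∧ 0 < C₁ ∧ 0 < C₂ ∧ ∀ p : ℕ,
    lam p ≤ C₁ * ((p : ℝ) + 1) ^ (-β) ∧ C₂ * ((p : ℝ) + 1) ^ (-β) ≤ lam p ∧
    C * ((p : ℝ) + 1) ^ (-(β + 1)) ≤ lam p - lam (p + 1)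

/-- `aₚ ≤ bₚ p^{-α}` for large `p`, for some `α > 0` and some square summable `b`. -/
def WeightDecay (a : ℕ → ℝ) : Prop :=
  ∃ (b : ℕ → ℝ) (α : ℝ), 0 < α ∧ Summable (fun p => b p ^ 2) ∧
    ∀ᶠ p : ℕ in atTop, a p ≤ b p * ((p : ℝ) + 1) ^ (-α)

/-- Thresholds `δₙ > 0` with `δₙ → 0` and `δₙ ≥ c (√n / log n)^{-β/(2β+1)}` for large `n`. -/
def AdmissibleThreshold (δ : ℕ → ℝ) (β : ℝ) : Prop :=
  (∀ n, 0 < δ n) ∧ Tendsto δ atTop (𝓝 0) ∧ ∃ c : ℝ, 0 < c ∧ ∀ᶠ n : ℕ in atTop,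
    c * (√(n : ℝ) / Real.log n) ^ (-(β / (2 * β + 1))) ≤ δ n

end ModelDepth

end

/-! Given the data, the scores of a Monte Carlo function along `phiHat n p` are independent centred
Gaussians with variances `lamHat n p` (Karhunen–Loève). Division by `lamHat n p` standardizes them,
so the truncated squared norm has the law of `∑_{p < C n} z_p² a_p²` with i.i.d. standard normal
`z_p`, whatever the estimated spectrum is. The data therefore enter only through the level `C n` and
the observed value `x n`, the estimated squared norm of `fobs`. If `C n → ∞` and `x n → r`, the
success probability tends to `P(∑ z_p² a_p² > r) = d`, since the limit law has no atoms; if `fobs`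
has infinite model norm, then `x n → ∞` and the limit is `0 = d`.

Convergence of `x n` is the statistical part. A dyadic maximal inequality gives `n ^ θ ‖K̂ₙ - K‖² →
0` almost surely in L² for `0 ≤ θ < 1` (`ae_tendsto_empCov`), hence the same rate for the operators.
Weyl's inequality controls the eigenvalues, and a gap argument gives `1 - ⟨φ_p, φ̂_p⟩² = O(p ^
(2β+2) ‖T̂ₙ - T‖²)`. Below the level `p ^ β = O(1/δₙ)` and `1/λ_p = O(1/δₙ)`, so the error in the
`p`-th term, relative to `a_p²`, is `O(‖T̂ₙ - T‖² δₙ ^ (-(3β+2)/β))`. This tends to `0` uniformly in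
`p` once `θ = (3β+2)/(4β+2)`. The terms are then dominated by four times the true term plus `a_p²`
(`eventually_term_le`).

For the Monte Carlo part, the success events for fixed `n` are independent with a common probability
tending to `d`. The strong law gives the iterated limit. Hoeffding's bound does not depend on `n`:
with Borel–Cantelli it gives the uniform statement for sample sizes beyond `log n`, and directly
convergence in probability. For common random numbers the success events are squeezed between events
independent of `n`, to which the strong law applies.

Integration of a path is not an operation on the product σ-algebra of `I → ℝ`. Gaussianity and
independence of the scores are therefore derived from the fact that they lie in the closed linear
span of the process in L². -/

set_option linter.unusedSectionVars false

/-! ### Perturbation of eigenvalues and eigenvectors. -/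

section Spectral

variable {H : Type*} [NormedAddCommGroup H] [InnerProductSpace ℝ H] [CompleteSpace H]

/-- The square of the distance to the coordinate projection, and Bessel's identity. -/
theorem Orthonormal.exists_projection {phi : ℕ → H} (hphi : Orthonormal ℝ phi) (h : H) :
    ∃ s : H, HasSum (fun p => inner ℝ (phi p) h • phi p) s ∧
      (∀ p, inner ℝ (phi p) (h - s) = 0) ∧ inner ℝ s (h - s) = 0 ∧
      HasSum (fun p => inner ℝ (phi p) h ^ 2) (‖s‖ ^ 2) := by
  have hsm : Summable (fun p => inner ℝ (phi p) h • phi p) := by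
    have := (hphi.orthogonalFamily.summable_iff_norm_sq_summable
      (fun p => inner ℝ (phi p) h)).2 (by simpa using hphi.inner_products_summable (x := h))
    simpa using this
  obtain ⟨s, hs⟩ := hsm
  have hin : ∀ q, inner ℝ (phi q) s = inner ℝ (phi q) h := by
    intro q
    have h1 := hs.mapL (innerSL ℝ (phi q))
    have h2 : HasSum (fun p => (innerSL ℝ (phi q)) (inner ℝ (phi p) h • phi p))
        (inner ℝ (phi q) h) := by
      have h3 := hasSum_single (f := fun p => (innerSL ℝ (phi q)) (inner ℝ (phi p) h • phi p)) q
        (by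
          intro p hp
          simp [hphi.2 hp.symm])
      simpa [inner_smul_right, real_inner_self_eq_norm_sq, hphi.1 q] using h3
    exact h1.unique h2
  have hperp : ∀ p, inner ℝ (phi p) (h - s) = 0 := by
    intro p; rw [inner_sub_right, hin, sub_self]
  refine ⟨s, hs, hperp, ?_, ?_⟩
  · have h1 := hs.mapL (innerSL ℝ (h - s))
    have h2 : HasSum (fun p => (innerSL ℝ (h - s)) (inner ℝ (phi p) h • phi p)) 0 := by
      convert hasSum_zero using 2 with p
      rw [innerSL_apply_apply, inner_smul_right, real_inner_comm (phi p) (h - s), hperp, mul_zero]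
    rw [real_inner_comm]; exact h1.unique h2
  · have h1 : HasSum (fun p => inner ℝ s (inner ℝ (phi p) h • phi p)) (inner ℝ s s) :=
      hs.mapL (innerSL ℝ s)
    rw [real_inner_self_eq_norm_sq] at h1
    refine h1.congr_fun fun p => ?_
    rw [inner_smul_right, real_inner_comm (phi p) s, hin, sq]

/-- A spectral system of a bounded operator: orthonormal eigenvectors with non-increasing
non-negative eigenvalues, such that the operator vanishes on their orthogonal complement. -/
structure SpectralSystem (T : H →L[ℝ] H) (lam : ℕ → ℝ) (phi : ℕ → H) : Prop where
  orthonormal : Orthonormal ℝ phi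
  antitone : Antitone lam
  nonneg : ∀ p, 0 ≤ lam p
  eigen : ∀ p, T (phi p) = lam p • phi p
  exhaustive : ∀ h, (∀ p, inner ℝ h (phi p) = 0) → T h = 0

namespace SpectralSystem

variable {T T' : H →L[ℝ] H} {lam lam' : ℕ → ℝ} {phi phi' : ℕ → H}

/-- The part of `h` orthogonal to all `phi p` is killed by `exhaustive`. Self-adjointness of `T` is
not assumed; it is a consequence of this expansion. -/
theorem hasSum_apply (hT : SpectralSystem T lam phi) (h : H) :
    HasSum (fun p => (lam p * inner ℝ (phi p) h) • phi p) (T h) := by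
  obtain ⟨s, hs, hperp, -, -⟩ := hT.orthonormal.exists_projection h
  have h1 : T h = T s := by
    have := hT.exhaustive (h - s) (fun p => by rw [real_inner_comm]; exact hperp p)
    rw [map_sub, sub_eq_zero] at this; exact this
  rw [h1]
  convert hs.mapL T using 2 with p
  rw [map_smul, hT.eigen, smul_smul, mul_comm]

theorem inner_phi_apply (hT : SpectralSystem T lam phi) (h : H) (q : ℕ) :
    inner ℝ (phi q) (T h) = lam q * inner ℝ (phi q) h := by
  have h1 := (hT.hasSum_apply h).mapL (innerSL ℝ (phi q))
  have h3 := hasSum_single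
    (f := fun p => (innerSL ℝ (phi q)) ((lam p * inner ℝ (phi p) h) • phi p)) q
    (by intro p hp; simp [hT.orthonormal.2 hp.symm])
  simpa [inner_smul_right, real_inner_self_eq_norm_sq, hT.orthonormal.1 q] using h1.unique h3

theorem hasSum_inner_apply_self (hT : SpectralSystem T lam phi) (h : H) :
    HasSum (fun p => lam p * inner ℝ (phi p) h ^ 2) (inner ℝ h (T h)) := by
  have h1 : HasSum (fun p => inner ℝ h ((lam p * inner ℝ (phi p) h) • phi p))
      (inner ℝ h (T h)) := (hT.hasSum_apply h).mapL (innerSL ℝ h)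
  refine h1.congr_fun fun p => ?_
  rw [inner_smul_right, real_inner_comm]; ring

/-- With `le_inner_apply_self` this forms the two halves of the min-max principle; Weyl's inequality
compares both on one vector. -/
theorem inner_apply_self_le (hT : SpectralSystem T lam phi) {h : H} {p : ℕ}
    (hp : ∀ q < p, inner ℝ (phi q) h = 0) : inner ℝ h (T h) ≤ lam p * ‖h‖ ^ 2 := by
  have hb := hT.orthonormal.inner_products_summable (x := h)
  have h1 := hT.hasSum_inner_apply_self h
  have hb' : Summable (fun q => lam p * inner ℝ (phi q) h ^ 2) := by
    simpa using hb.mul_left (lam p)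
  calc inner ℝ h (T h) = ∑' q, lam q * inner ℝ (phi q) h ^ 2 := h1.tsum_eq.symm
    _ ≤ ∑' q, lam p * inner ℝ (phi q) h ^ 2 := by
        refine h1.summable.tsum_le_tsum (fun q => ?_) hb'
        rcases lt_or_ge q p with hq | hq
        · simp [hp q hq]
        · exact mul_le_mul_of_nonneg_right (hT.antitone hq) (sq_nonneg _)
    _ = lam p * ∑' q, ‖inner ℝ (phi q) h‖ ^ 2 := by rw [tsum_mul_left]; simp
    _ ≤ lam p * ‖h‖ ^ 2 :=
        mul_le_mul_of_nonneg_left (hT.orthonormal.tsum_inner_products_le h) (hT.nonneg p)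

theorem le_inner_apply_self (hT : SpectralSystem T lam phi) {p : ℕ} (c : Fin (p + 1) → ℝ) :
    lam p * ‖∑ i, c i • phi i‖ ^ 2 ≤
      inner ℝ (∑ i, c i • phi i) (T (∑ i : Fin (p + 1), c i • phi i)) := by
  have ho : Orthonormal ℝ (fun i : Fin (p + 1) => phi i) :=
    hT.orthonormal.comp _ Fin.val_injective
  have h1 : T (∑ i : Fin (p + 1), c i • phi i) = ∑ i, (c i * lam i) • phi i := by
    simp [map_sum, hT.eigen, smul_smul]
  rw [h1, ho.inner_sum, ← real_inner_self_eq_norm_sq, ho.inner_sum, Finset.mul_sum]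
  refine Finset.sum_le_sum fun i _ => ?_
  have : lam p ≤ lam i := hT.antitone (Nat.lt_succ_iff.1 i.2)
  simp only [conj_trivial]
  nlinarith [mul_self_nonneg (c i), mul_le_mul_of_nonneg_right this (mul_self_nonneg (c i))]

/-- Weyl's perturbation inequality. -/
theorem eigenvalue_le (hT : SpectralSystem T lam phi) (hT' : SpectralSystem T' lam' phi')
    (p : ℕ) : lam' p ≤ lam p + ‖T' - T‖ := by
  -- `p` linear conditions on `p + 1` coefficients leave a nonzero combination of the perturbed
  -- eigenvectors that is orthogonal to the first `p` unperturbed ones.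
  let A : (Fin (p + 1) → ℝ) →ₗ[ℝ] (Fin p → ℝ) :=
    { toFun := fun c q => inner ℝ (phi q) (∑ i, c i • phi' i)
      map_add' := by
        intro c d; ext q; simp [add_smul, Finset.sum_add_distrib, inner_add_right]
      map_smul' := by
        intro r c; ext q
        simp only [Pi.smul_apply, smul_eq_mul, RingHom.id_apply, mul_smul, ← Finset.smul_sum,
          inner_smul_right] }
  have hker : A.ker ≠ ⊥ := LinearMap.ker_ne_bot_of_finrank_lt (by simp)
  obtain ⟨c, hc, hc0⟩ := Submodule.exists_mem_ne_zero_of_ne_bot hker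
  set h : H := ∑ i, c i • phi' i with hh
  have horth : ∀ q < p, inner ℝ (phi q) h = 0 := fun q hq =>
    congrFun (LinearMap.mem_ker.1 hc) ⟨q, hq⟩
  have hne : 0 < ‖h‖ ^ 2 := by
    have ho : LinearIndependent ℝ (fun i : Fin (p + 1) => phi' i) :=
      (hT'.orthonormal.comp _ Fin.val_injective).linearIndependent
    have : h ≠ 0 := fun h0 => hc0 (funext (Fintype.linearIndependent_iff.1 ho c h0))
    positivity
  have h1 := hT'.le_inner_apply_self c
  have h2 := hT.inner_apply_self_le horth
  have h3 : inner ℝ h ((T' - T) h) ≤ ‖T' - T‖ * ‖h‖ ^ 2 := by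
    calc inner ℝ h ((T' - T) h) ≤ ‖h‖ * ‖(T' - T) h‖ := real_inner_le_norm _ _
      _ ≤ ‖h‖ * (‖T' - T‖ * ‖h‖) := by gcongr; exact (T' - T).le_opNorm h
      _ = _ := by ring
  rw [_root_.sub_apply, inner_sub_right] at h3
  have h4 : lam' p * ‖h‖ ^ 2 ≤ (lam p + ‖T' - T‖) * ‖h‖ ^ 2 := by linarith
  exact le_of_mul_le_mul_right h4 hne

theorem abs_eigenvalue_sub_le (hT : SpectralSystem T lam phi)
    (hT' : SpectralSystem T' lam' phi') (p : ℕ) : |lam' p - lam p| ≤ ‖T' - T‖ := by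
  have h1 := hT.eigenvalue_le hT' p
  have h2 := hT'.eigenvalue_le hT p
  rw [norm_sub_rev] at h2
  rw [abs_le]; constructor <;> linarith

/-- Along `phi q` the residual has coefficient `(lam q - lam p) ⟨phi q, h⟩`. On the complement of
all `phi q`, where `T` vanishes, it is `-lam p` times the component of `h`; this is why `g ≤ lam p`
is needed besides the gap. -/
theorem gap_le_residual (hT : SpectralSystem T lam phi) {p : ℕ} {g : ℝ} (hg0 : 0 ≤ g)
    (hgp : g ≤ lam p) (hg : ∀ q, q ≠ p → g ≤ |lam q - lam p|) (h : H) :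
    g ^ 2 * (‖h‖ ^ 2 - inner ℝ (phi p) h ^ 2) ≤ ‖T h - lam p • h‖ ^ 2 := by
  obtain ⟨s, hs, hperp, hss, hsq⟩ := hT.orthonormal.exists_projection h
  set u := T h - lam p • h with hu
  obtain ⟨v, hv, hvperp, hvv, hvsq⟩ := hT.orthonormal.exists_projection u
  have hTs := (hT.hasSum_apply h).sub (hs.const_smul (lam p))
  have hv' : v = T h - lam p • s := by
    refine hv.unique ?_
    convert hTs using 2 with q
    rw [hu, inner_sub_right, hT.inner_phi_apply, inner_smul_right, sub_smul, smul_smul]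
  have huv : u - v = -(lam p • (h - s)) := by
    rw [hv', hu, smul_sub]; abel
  have hn : ∀ x y : H, inner ℝ y (x - y) = 0 → ‖x‖ ^ 2 = ‖y‖ ^ 2 + ‖x - y‖ ^ 2 := by
    intro x y hxy
    have := norm_add_sq_real y (x - y)
    rw [add_sub_cancel, hxy] at this; linarith
  rw [hn h s hss, hn u v hvv, huv, norm_neg, norm_smul, mul_pow]
  have hco : ∀ q, inner ℝ (phi q) u = (lam q - lam p) * inner ℝ (phi q) h := by
    intro q; rw [hu, inner_sub_right, hT.inner_phi_apply, inner_smul_right]; ring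
  have hmain : g ^ 2 * (‖s‖ ^ 2 - inner ℝ (phi p) h ^ 2) ≤ ‖v‖ ^ 2 := by
    have e1 : HasSum (fun q => g ^ 2 * (inner ℝ (phi q) h ^ 2
        - (if q = p then inner ℝ (phi p) h ^ 2 else 0)))
        (g ^ 2 * (‖s‖ ^ 2 - inner ℝ (phi p) h ^ 2)) :=
      (hsq.sub (hasSum_ite_eq p _)).mul_left _
    refine hasSum_le (fun q => ?_) e1 hvsq
    rw [hco]
    split_ifs with hqp
    · subst hqp; simp
    · rw [sub_zero, mul_pow]
      refine mul_le_mul_of_nonneg_right ?_ (sq_nonneg _)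
      rw [← sq_abs (lam q - lam p)]
      exact pow_le_pow_left₀ hg0 (hg q hqp) 2
  have h2 : g ^ 2 * ‖h - s‖ ^ 2 ≤ ‖lam p‖ ^ 2 * ‖h - s‖ ^ 2 := by
    refine mul_le_mul_of_nonneg_right ?_ (sq_nonneg _)
    rw [Real.norm_eq_abs, sq_abs]; exact pow_le_pow_left₀ hg0 hgp 2
  nlinarith

/-- `phi' p` is an approximate eigenvector of `T`: its residual is a sum of two terms of norm at
most `‖T' - T‖`, one for the eigenvalue and one for the operator. The squared inner product makes
the estimate blind to the sign of eigenvectors. -/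
theorem gap_le_perturbation (hT : SpectralSystem T lam phi)
    (hT' : SpectralSystem T' lam' phi') {p : ℕ} {g : ℝ} (hg0 : 0 ≤ g)
    (hgp : g ≤ lam p) (hg : ∀ q, q ≠ p → g ≤ |lam q - lam p|) :
    g ^ 2 * (1 - inner ℝ (phi p) (phi' p) ^ 2) ≤ (2 * ‖T' - T‖) ^ 2 := by
  have h1 := hT.gap_le_residual hg0 hgp hg (phi' p)
  rw [hT'.orthonormal.1 p, one_pow] at h1
  refine h1.trans (pow_le_pow_left₀ (norm_nonneg _) ?_ 2)
  have h2 : T (phi' p) - lam p • phi' p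
      = (lam' p - lam p) • phi' p - (T' - T) (phi' p) := by
    rw [_root_.sub_apply, hT'.eigen, sub_smul]; abel
  rw [h2]
  refine (norm_sub_le _ _).trans ?_
  rw [norm_smul, hT'.orthonormal.1 p, mul_one, two_mul]
  refine add_le_add (hT.abs_eigenvalue_sub_le hT' p) ?_
  simpa [hT'.orthonormal.1 p] using (T' - T).le_opNorm (phi' p)

end SpectralSystem

/-- Comparison of the coordinates of `f` along two unit vectors. -/
theorem abs_abs_inner_sub_le {u v f : H} (hu : ‖u‖ = 1) (hv : ‖v‖ = 1) {e : ℝ} (he : 0 ≤ e)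
    (h : 1 - inner ℝ u v ^ 2 ≤ e ^ 2) :
    |inner ℝ f v - inner ℝ u v * inner ℝ f u| ≤ ‖f‖ * e ∧ |inner ℝ u v| ≤ 1 := by
  have h1 : |inner ℝ u v| ≤ 1 := by simpa [hu, hv] using abs_real_inner_le_norm u v
  refine ⟨?_, h1⟩
  have h2 : inner ℝ f v - inner ℝ u v * inner ℝ f u = inner ℝ f (v - inner ℝ u v • u) := by
    rw [inner_sub_right, inner_smul_right]
  have h3 : ‖v - inner ℝ u v • u‖ ^ 2 ≤ e ^ 2 := by
    rw [norm_sub_sq_real, inner_smul_right, norm_smul, hu, hv, real_inner_comm u v,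
      Real.norm_eq_abs, mul_one, sq_abs]
    nlinarith [real_inner_comm u v]
  rw [h2]
  exact (abs_real_inner_le_norm _ _).trans
    (mul_le_mul_of_nonneg_left ((pow_le_pow_iff_left₀ (norm_nonneg _) he two_ne_zero).1 h3)
      (norm_nonneg _))

end Spectral

/-! ### L² limits of Gaussian variables. -/

section GaussianClosure

variable {Ω : Type*} [MeasurableSpace Ω] {P : Measure Ω} [IsProbabilityMeasure P]

/-- Since `|exp(ix) - 1| ≤ |x|` and the L¹ norm is at most the L² norm, the characteristic function
at `u` is Lipschitz in the variable with constant `|u|`. -/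
theorem continuous_integral_cexp_Lp (u : ℝ) :
    Continuous (fun V : Lp ℝ 2 P => ∫ ω, Complex.exp (u * V ω * Complex.I) ∂P) := by
  have hint : ∀ V : Lp ℝ 2 P, Integrable (fun ω => Complex.exp (u * V ω * Complex.I)) P := by
    intro V
    refine Integrable.of_bound (C := 1) ?_ (ae_of_all _ fun ω => ?_)
    · have := (Lp.stronglyMeasurable V).measurable
      fun_prop
    · rw [← Complex.ofReal_mul, Complex.norm_exp_ofReal_mul_I]
  refine (LipschitzWith.of_dist_le_mul (K := ⟨|u|, abs_nonneg u⟩) fun V W => ?_).continuous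
  rw [dist_eq_norm, ← integral_sub (hint V) (hint W)]
  have hsub : MemLp (fun ω => (V - W : Lp ℝ 2 P) ω) 2 P := Lp.memLp _
  have h1 : Integrable (fun ω => ‖(V - W : Lp ℝ 2 P) ω‖) P :=
    (hsub.integrable (by norm_num)).norm
  calc ‖∫ ω, (Complex.exp (u * V ω * Complex.I) - Complex.exp (u * W ω * Complex.I)) ∂P‖
      ≤ ∫ ω, |u| * ‖(V - W : Lp ℝ 2 P) ω‖ ∂P := by
        refine norm_integral_le_of_norm_le (h1.const_mul _) ?_
        filter_upwards [Lp.coeFn_sub V W] with ω hω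
        rw [hω]
        have e : Complex.exp (u * V ω * Complex.I) - Complex.exp (u * W ω * Complex.I)
          = Complex.exp (((u * W ω : ℝ) : ℂ) * Complex.I) *
            (Complex.exp (Complex.I * ((u * (V ω - W ω) : ℝ) : ℂ)) - 1) := by
          rw [mul_sub, mul_one, ← Complex.exp_add]; push_cast; congr 2; ring
        rw [e, norm_mul, Complex.norm_exp_ofReal_mul_I, one_mul]
        refine (Real.norm_exp_I_mul_ofReal_sub_one_le).trans ?_
        rw [norm_mul, Pi.sub_apply, Real.norm_eq_abs u]
    _ = |u| * ∫ ω, ‖(V - W : Lp ℝ 2 P) ω‖ ∂P := integral_const_mul _ _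
    _ ≤ |u| * dist V W := by
        refine mul_le_mul_of_nonneg_left ?_ (abs_nonneg u)
        rw [dist_eq_norm, Lp.norm_def, integral_norm_eq_lintegral_enorm hsub.1,
          ← eLpNorm_one_eq_lintegral_enorm]
        refine ENNReal.toReal_mono (Lp.eLpNorm_ne_top _) ?_
        exact eLpNorm_le_eLpNorm_of_exponent_le (by norm_num) hsub.1

theorem norm_sq_toLp_eq_variance {V : Ω → ℝ} (hV : MemLp V 2 P) (h0 : ∫ ω, V ω ∂P = 0) :
    ‖hV.toLp V‖ ^ 2 = Var[V; P] := by
  rw [variance_of_integral_eq_zero hV.1.aemeasurable h0, ← real_inner_self_eq_norm_sq,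
    L2.inner_def]
  refine integral_congr_ae ?_
  filter_upwards [hV.coeFn_toLp] with ω hω
  simp [hω, sq]

/-- The law of an `L²`-limit of linear combinations of a centred Gaussian process. -/
theorem map_eq_gaussianReal_of_mem_closure {T : Type*} {X : T → Ω → ℝ}
    (hX : IsGaussianProcess X P) (h0 : ∀ t, ∫ ω, X t ω ∂P = 0)
    {V : Lp ℝ 2 P} (hV : V ∈ (Submodule.span ℝ (Set.range fun t =>
      (hX.hasGaussianLaw_eval t).memLp_two.toLp (X t))).topologicalClosure) :
    P.map V = gaussianReal 0 (‖V‖ ^ 2).toNNReal := by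
  set S := Submodule.span ℝ (Set.range fun t =>
      (hX.hasGaussianLaw_eval t).memLp_two.toLp (X t)) with hS
  have hchar : ∀ V ∈ S, ∀ u : ℝ, ∫ ω, Complex.exp (u * V ω * Complex.I) ∂P
      = Complex.exp (-(‖V‖ ^ 2 * u ^ 2 / 2 : ℝ)) := by
    intro V hV u
    obtain ⟨c, rfl⟩ := (Finsupp.mem_span_range_iff_exists_finsupp).1 hV
    set W : Ω → ℝ := fun ω => ∑ t ∈ c.support, c t * X t ω with hW
    have hWg : HasGaussianLaw W P := (hX.smul c).hasGaussianLaw_fun_sum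
    have hW0 : ∫ ω, W ω ∂P = 0 := by
      rw [hW, integral_finsetSum _ fun t _ =>
        ((hX.hasGaussianLaw_eval t).integrable).const_mul _]
      simp [integral_const_mul, h0]
    have heq : (c.sum fun i a => a • (hX.hasGaussianLaw_eval i).memLp_two.toLp (X i))
        = hWg.memLp_two.toLp W := by
      refine Lp.ext ?_
      refine EventuallyEq.trans ?_ hWg.memLp_two.coeFn_toLp.symm
      rw [Finsupp.sum]
      refine (Lp.coeFn_finsetSum _ _).trans ?_
      have h1 : ∀ᵐ ω ∂P, ∀ t ∈ c.support,
          (c t • (hX.hasGaussianLaw_eval t).memLp_two.toLp (X t) : Lp ℝ 2 P) ω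
            = c t * X t ω := by
        refine (ae_ball_iff c.support.countable_toSet).2 fun t _ => ?_
        filter_upwards [Lp.coeFn_smul (c t) ((hX.hasGaussianLaw_eval t).memLp_two.toLp (X t)),
          (hX.hasGaussianLaw_eval t).memLp_two.coeFn_toLp] with ω h1 h2
        rw [h1, Pi.smul_apply, h2, smul_eq_mul]
      filter_upwards [h1] with ω hω
      rw [Finset.sum_apply, hW]
      exact Finset.sum_congr rfl hω
    rw [heq, norm_sq_toLp_eq_variance _ hW0]
    have h3 := hWg.charFun_map_eq u
    rw [charFun_apply_real, integral_map hWg.aemeasurable (by fun_prop)] at h3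
    have h4 : ∫ ω, Complex.exp (u * (hWg.memLp_two.toLp W : Lp ℝ 2 P) ω * Complex.I) ∂P
        = ∫ ω, Complex.exp (u * W ω * Complex.I) ∂P := by
      refine integral_congr_ae ?_
      filter_upwards [hWg.memLp_two.coeFn_toLp] with ω hω
      rw [hω]
    rw [h4, h3]
    have h5 : (fun ω => inner ℝ u (W ω)) = fun ω => u * W ω := by
      ext ω; simp [mul_comm]
    rw [h5, integral_const_mul, hW0, variance_const_mul]
    congr 1; push_cast; ring
  have hcl : ∀ u : ℝ, ∫ ω, Complex.exp (u * V ω * Complex.I) ∂P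
      = Complex.exp (-(‖V‖ ^ 2 * u ^ 2 / 2 : ℝ)) := by
    intro u
    -- Both sides are continuous on L², so the Gaussian formula passes from the span to its closure.
    have hclosed : IsClosed {V : Lp ℝ 2 P | ∫ ω, Complex.exp (u * V ω * Complex.I) ∂P
      = Complex.exp (-(‖V‖ ^ 2 * u ^ 2 / 2 : ℝ))} :=
      isClosed_eq (continuous_integral_cexp_Lp u) (by fun_prop)
    have : closure (S : Set (Lp ℝ 2 P)) ⊆ {V : Lp ℝ 2 P | ∫ ω, Complex.exp (u * V ω * Complex.I) ∂P
      = Complex.exp (-(‖V‖ ^ 2 * u ^ 2 / 2 : ℝ))} :=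
      closure_minimal (fun V hV => hchar V hV u) hclosed
    exact this hV
  have hm : AEMeasurable V P := (Lp.aestronglyMeasurable V).aemeasurable
  have : IsProbabilityMeasure (P.map V) := Measure.isProbabilityMeasure_map hm
  refine Measure.ext_of_charFun (funext fun u => ?_)
  rw [charFun_gaussianReal, charFun_apply_real, integral_map hm (by fun_prop), hcl]
  congr 1
  rw [Real.coe_toNNReal _ (sq_nonneg _)]
  push_cast; ring

end GaussianClosure

/-! ### Scores of a Gaussian process. -/

namespace ModelDepth

theorem coeff_eq_inner {h : I → ℝ} (hh : MemLp h 2 volume) (φ : L2I) :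
    coeff h φ = inner ℝ (hh.toLp h) φ := by
  rw [L2.inner_def]
  refine integral_congr_ae ?_
  filter_upwards [hh.coeFn_toLp] with t ht
  simp [ht, mul_comm]

theorem norm_toLp_sq {α : Type*} [MeasurableSpace α] {μ : Measure α} {h : α → ℝ}
    (hh : MemLp h 2 μ) : ‖hh.toLp h‖ ^ 2 = ∫ t, h t ^ 2 ∂μ := by
  rw [← real_inner_self_eq_norm_sq, L2.inner_def]
  refine integral_congr_ae ?_
  filter_upwards [hh.coeFn_toLp] with t ht
  simp [ht, sq]

section GaussianProcess

variable {Ω : Type*} [MeasurableSpace Ω] {P : Measure Ω} [IsProbabilityMeasure P]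
  {X : I → Ω → ℝ} {K : I → I → ℝ}

namespace IsZeroMeanGP

theorem measurable_apply (hX : IsZeroMeanGP X K P) (t : I) : Measurable (X t) :=
  hX.measurable.comp measurable_prodMk_left

theorem memLp_apply (hX : IsZeroMeanGP X K P) (t : I) : MemLp (X t) 2 P :=
  (hX.gaussian.hasGaussianLaw_eval t).memLp_two

theorem kernel_symm (hX : IsZeroMeanGP X K P) (s t : I) : K s t = K t s := by
  rw [← hX.cov_eq, ← hX.cov_eq]; simp only [mul_comm]

theorem integrable_sq_uncurry (hX : IsZeroMeanGP X K P) (hK : Integrable (fun t => K t t) volume) :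
    Integrable (fun z : I × Ω => X z.1 z.2 ^ 2) (volume.prod P) := by
  refine (integrable_prod_iff (hX.measurable.pow_const 2).aestronglyMeasurable).2 ⟨?_, ?_⟩
  · exact ae_of_all _ fun t => (hX.memLp_apply t).integrable_sq
  · refine hK.congr (ae_of_all _ fun t => ?_)
    simp only [← hX.cov_eq t t, norm_pow, Real.norm_eq_abs, sq_abs]
    simp only [sq]

theorem memLp_uncurry (hX : IsZeroMeanGP X K P) (hK : Integrable (fun t => K t t) volume) :
    MemLp (fun z : I × Ω => X z.1 z.2) 2 (volume.prod P) :=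
  (memLp_two_iff_integrable_sq hX.measurable.aestronglyMeasurable).2 (hX.integrable_sq_uncurry hK)

theorem measurable_path (hX : IsZeroMeanGP X K P) (ω : Ω) : Measurable (fun t => X t ω) :=
  hX.measurable.comp measurable_prodMk_right

theorem ae_memLp_path (hX : IsZeroMeanGP X K P) (hK : Integrable (fun t => K t t) volume) :
    ∀ᵐ ω ∂P, MemLp (fun t => X t ω) 2 volume := by
  have h := (integrable_prod_iff' (hX.measurable.pow_const 2).aestronglyMeasurable).1
    (hX.integrable_sq_uncurry hK)
  filter_upwards [h.1] with ω hω
  exact (memLp_two_iff_integrable_sq (hX.measurable_path ω).aestronglyMeasurable).2 hω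

theorem measurable_coeff (hX : IsZeroMeanGP X K P) (φ : L2I) :
    Measurable (fun ω => coeff (fun t => X t ω) φ) := by
  have h : StronglyMeasurable (fun z : Ω × I => X z.2 z.1 * φ z.2) :=
    ((hX.measurable.comp measurable_swap).mul
      ((Lp.stronglyMeasurable φ).measurable.comp measurable_snd)).stronglyMeasurable
  exact h.integral_prod_right.measurable

theorem memLp_coeff (hX : IsZeroMeanGP X K P) (hK : Integrable (fun t => K t t) volume)
    (φ : L2I) : MemLp (fun ω => coeff (fun t => X t ω) φ) 2 P := by
  refine (memLp_two_iff_integrable_sq (hX.measurable_coeff φ).aestronglyMeasurable).2 ?_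
  have h : Integrable (fun ω => ∫ t, X t ω ^ 2) P := (hX.integrable_sq_uncurry hK).integral_prod_right
  refine (h.mul_const (‖φ‖ ^ 2)).mono' ((hX.measurable_coeff φ).pow_const 2).aestronglyMeasurable ?_
  filter_upwards [hX.ae_memLp_path hK] with ω hω
  rw [coeff_eq_inner hω, ← norm_toLp_sq hω, norm_pow, ← mul_pow]
  exact pow_le_pow_left₀ (norm_nonneg _) (norm_inner_le_norm _ _) 2

/-- Fubini with `Y` left free: constants yield the mean of a score, values of the process and other
scores its covariances, and variables orthogonal to the process its place in the closed span. -/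
theorem integral_mul_coeff (hX : IsZeroMeanGP X K P) (hK : Integrable (fun t => K t t) volume)
    (φ : L2I) {Y : Ω → ℝ} (hY : MemLp Y 2 P) :
    ∫ ω, Y ω * coeff (fun t => X t ω) φ ∂P = ∫ t, φ t * ∫ ω, Y ω * X t ω ∂P := by
  have hφ : Integrable (fun t => φ t ^ 2) volume := (Lp.memLp φ).integrable_sq
  have hprod : MemLp (fun z : I × Ω => φ z.1 * Y z.2) 2 (volume.prod P) := by
    refine (memLp_two_iff_integrable_sq ?_).2 ?_
    · exact (Lp.aestronglyMeasurable φ).comp_fst.mul hY.1.comp_snd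
    · simp only [mul_pow]
      exact hφ.mul_prod hY.integrable_sq
  have hint : Integrable (fun z : I × Ω => X z.1 z.2 * (φ z.1 * Y z.2)) (volume.prod P) :=
    (hX.memLp_uncurry hK).integrable_mul hprod
  have hsw := integral_integral_swap (f := fun t ω => X t ω * (φ t * Y ω)) hint
  calc ∫ ω, Y ω * coeff (fun t => X t ω) φ ∂P
      = ∫ ω, (∫ t, X t ω * (φ t * Y ω)) ∂P := by
        refine integral_congr_ae (ae_of_all _ fun ω => ?_)
        simp only [coeff]
        rw [← integral_const_mul]
        exact integral_congr_ae (ae_of_all _ fun t => by ring)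
    _ = ∫ t, ∫ ω, X t ω * (φ t * Y ω) ∂P := hsw.symm
    _ = _ := by
        refine integral_congr_ae (ae_of_all _ fun t => ?_)
        simp only
        rw [← integral_const_mul]
        exact integral_congr_ae (ae_of_all _ fun ω => by ring)

/-- The closed span is the double orthogonal complement, and by Fubini a variable orthogonal to
every `X t` is orthogonal to the score. No path regularity and no Riemann sums are involved. -/
theorem coeff_mem_closure (hX : IsZeroMeanGP X K P) (hK : Integrable (fun t => K t t) volume)
    (φ : L2I) : (hX.memLp_coeff hK φ).toLp _ ∈ (Submodule.span ℝ (Set.range fun t =>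
      (hX.gaussian.hasGaussianLaw_eval t).memLp_two.toLp (X t))).topologicalClosure := by
  rw [← Submodule.orthogonal_orthogonal_eq_closure, Submodule.mem_orthogonal]
  intro Y hY
  have h0 : ∀ t, ∫ ω, Y ω * X t ω ∂P = 0 := by
    intro t
    have h1 := (Submodule.mem_orthogonal _ _).1 hY _ (Submodule.subset_span ⟨t, rfl⟩)
    rw [L2.inner_def] at h1
    rw [← h1]
    refine integral_congr_ae ?_
    filter_upwards [(hX.gaussian.hasGaussianLaw_eval t).memLp_two.coeFn_toLp] with ω hω
    simp [hω]
  rw [L2.inner_def]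
  have h2 := hX.integral_mul_coeff hK φ (Lp.memLp Y)
  simp only [h0, mul_zero, integral_zero] at h2
  rw [← h2]
  refine integral_congr_ae ?_
  filter_upwards [(hX.memLp_coeff hK φ).coeFn_toLp] with ω hω
  simp [hω, mul_comm]

/-- Variables that agree almost surely with one measurable for the σ-algebra generated by the path
form a closed subspace of L² containing all `X t`, hence the score; a variable measurable for that
σ-algebra factors through the path. -/
theorem exists_measurable_coeff (hX : IsZeroMeanGP X K P)
    (hK : Integrable (fun t => K t t) volume) (φ : L2I) :
    ∃ F : (I → ℝ) → ℝ, Measurable F ∧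
      (fun ω => coeff (fun t => X t ω) φ) =ᵐ[P] fun ω => F (fun t => X t ω) := by
  have hpath : Measurable (fun ω t => X t ω) := measurable_pi_iff.2 hX.measurable_apply
  have hle := hpath.comap_le
  have hS : (Submodule.span ℝ (Set.range fun t =>
      (hX.gaussian.hasGaussianLaw_eval t).memLp_two.toLp (X t))).topologicalClosure
      ≤ lpMeas ℝ ℝ (MeasurableSpace.comap (fun ω t => X t ω) MeasurableSpace.pi) 2 P := by
    refine Submodule.topologicalClosure_minimal _ ?_ (isClosed_aestronglyMeasurable hle)
    refine Submodule.span_le.2 ?_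
    rintro _ ⟨t, rfl⟩
    refine mem_lpMeas_iff_aestronglyMeasurable.2 ⟨X t, ?_, MemLp.coeFn_toLp _⟩
    have : Measurable[MeasurableSpace.comap (fun ω t => X t ω) MeasurableSpace.pi] (X t) := Measurable.comp (g := fun x : I → ℝ => x t) (measurable_pi_apply t)
        (comap_measurable fun ω t => X t ω)
    exact this.stronglyMeasurable
  have hmeas := mem_lpMeas_iff_aestronglyMeasurable.1 (hS (hX.coeff_mem_closure hK φ))
  obtain ⟨V, hV, hVeq⟩ := hmeas
  obtain ⟨F, hF, rfl⟩ := hV.measurable.exists_eq_measurable_comp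
  exact ⟨F, hF, (hX.memLp_coeff hK φ).coeFn_toLp.symm.trans hVeq⟩

theorem integral_coeff (hX : IsZeroMeanGP X K P) (hK : Integrable (fun t => K t t) volume)
    (φ : L2I) : ∫ ω, coeff (fun t => X t ω) φ ∂P = 0 := by
  have h := hX.integral_mul_coeff hK φ (memLp_const (1 : ℝ))
  simpa [hX.mean_zero] using h

theorem map_coeff_eq (hX : IsZeroMeanGP X K P) (hK : Integrable (fun t => K t t) volume)
    (φ : L2I) : P.map (fun ω => coeff (fun t => X t ω) φ)
      = gaussianReal 0 (Var[fun ω => coeff (fun t => X t ω) φ; P]).toNNReal := by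
  rw [← norm_sq_toLp_eq_variance (hX.memLp_coeff hK φ) (hX.integral_coeff hK φ),
    ← map_eq_gaussianReal_of_mem_closure hX.gaussian hX.mean_zero (hX.coeff_mem_closure hK φ)]
  exact Measure.map_congr (hX.memLp_coeff hK φ).coeFn_toLp.symm

theorem coeff_linear (hX : IsZeroMeanGP X K P) (hK : Integrable (fun t => K t t) volume)
    {ι : Type*} (s : Finset ι) (c : ι → ℝ) (φ : ι → L2I) :
    (fun ω => ∑ i ∈ s, c i * coeff (fun t => X t ω) (φ i))
      =ᵐ[P] fun ω => coeff (fun t => X t ω) (∑ i ∈ s, c i • φ i) := by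
  filter_upwards [hX.ae_memLp_path hK] with ω hω
  simp only [coeff_eq_inner hω, inner_sum, inner_smul_right]

/-- Cramér–Wold: a linear form in the scores is almost surely the score along a combination of the
`φ i`, so the one-dimensional case suffices. -/
theorem hasGaussianLaw_coeff (hX : IsZeroMeanGP X K P)
    (hK : Integrable (fun t => K t t) volume) {ι : Type*} [Fintype ι] (φ : ι → L2I) :
    HasGaussianLaw (fun ω i => coeff (fun t => X t ω) (φ i)) P := by
  have hm : Measurable (fun ω i => coeff (fun t => X t ω) (φ i)) :=
    measurable_pi_iff.2 fun i => hX.measurable_coeff (φ i)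
  refine ⟨isGaussian_of_isGaussian_map fun L => ?_⟩
  rw [Measure.map_map L.continuous.measurable hm]
  classical
  have h1 : (L ∘ fun ω i => coeff (fun t => X t ω) (φ i))
      = fun ω => ∑ i, L (Pi.single i 1) * coeff (fun t => X t ω) (φ i) := by
    ext ω
    rw [Function.comp_apply]
    conv_lhs => rw [← Finset.univ_sum_single (fun i => coeff (fun t => X t ω) (φ i)), map_sum]
    refine Finset.sum_congr rfl fun i _ => ?_
    have : Pi.single i (coeff (fun t => X t ω) (φ i))
        = coeff (fun t => X t ω) (φ i) • (Pi.single i 1 : ι → ℝ) := by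
      rw [← Pi.single_smul]; simp
    rw [this, map_smul, smul_eq_mul, mul_comm]
  rw [h1, Measure.map_congr (hX.coeff_linear hK _ _ φ), hX.map_coeff_eq hK]
  infer_instance

variable {lam : ℕ → ℝ} {phi : ℕ → L2I}

/-- Fubini twice: correlating `X t` with the score along `phi p` applies the covariance operator to
`phi p`, and orthonormality finishes. -/
theorem integral_coeff_mul_coeff (hX : IsZeroMeanGP X K P)
    (hK : Integrable (fun t => K t t) volume) (hphi : IsEigenSystem K lam phi) (p q : ℕ) :
    ∫ ω, coeff (fun t => X t ω) (phi p) * coeff (fun t => X t ω) (phi q) ∂P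
      = if p = q then lam p else 0 := by
  rw [hX.integral_mul_coeff hK (phi q) (hX.memLp_coeff hK (phi p))]
  have h1 : ∀ᵐ t : I, phi q t * ∫ ω, coeff (fun t => X t ω) (phi p) * X t ω ∂P
      = lam p * (phi q t * phi p t) := by
    filter_upwards [hphi.eigen p] with t ht
    have h2 := hX.integral_mul_coeff hK (phi p) (hX.memLp_apply t)
    simp only [hX.cov_eq] at h2
    simp only [mul_comm (coeff _ _)]
    rw [h2]
    have h3 : ∫ s, phi p s * K t s = lam p * phi p t := by
      rw [← ht]; congr 1; ext s; rw [hX.kernel_symm t s, mul_comm]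
    rw [h3]; ring
  rw [integral_congr_ae h1, integral_const_mul]
  have h4 : ∫ t, phi q t * phi p t = inner ℝ (phi p) (phi q) := by
    rw [L2.inner_def]; simp
  rw [h4, orthonormal_iff_ite.1 hphi.orthonormal]
  split_ifs <;> simp

/-- The principal component scores are independent centred Gaussians. -/
theorem hasLaw_scores (hX : IsZeroMeanGP X K P)
    (hK : Integrable (fun t => K t t) volume) (hphi : IsEigenSystem K lam phi) :
    HasLaw (fun ω p => coeff (fun t => X t ω) (phi p))
      (Measure.infinitePi fun p => gaussianReal 0 (lam p).toNNReal) P := by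
  have hlaw : ∀ p, HasLaw (fun ω => coeff (fun t => X t ω) (phi p))
      (gaussianReal 0 (lam p).toNNReal) P := by
    intro p
    refine ⟨(hX.measurable_coeff _).aemeasurable, ?_⟩
    rw [hX.map_coeff_eq hK, variance_of_integral_eq_zero (hX.measurable_coeff _).aemeasurable
      (hX.integral_coeff hK _)]
    have := hX.integral_coeff_mul_coeff hK hphi p p
    simp only [if_true, ← sq] at this
    rw [this]
  -- Finitely many scores are jointly Gaussian, so vanishing covariances give independence.
  refine iIndepFun.hasLaw_infinitePi hlaw (iIndepFun_iff_finset.2 fun s => ?_)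
    (measurable_pi_iff.2 fun p => hX.measurable_coeff _).aemeasurable
  refine HasGaussianLaw.iIndepFun_of_covariance_eq_zero
    (X := fun (p : s) ω => coeff (fun t => X t ω) (phi p))
    (hX.hasGaussianLaw_coeff hK fun p : s => phi p) fun i j hij => ?_
  rw [covariance_eq_sub (hX.memLp_coeff hK _) (hX.memLp_coeff hK _), hX.integral_coeff hK,
    zero_mul, sub_zero]
  have h := hX.integral_coeff_mul_coeff hK hphi i j
  rw [if_neg fun h => hij (Subtype.ext h)] at h
  exact h

end IsZeroMeanGP

/-- Independence is given for the product σ-algebra on paths, so every score is first replaced by an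
almost surely equal measurable function of the path. -/
theorem iIndepFun_scores {g : ℕ → I → Ω → ℝ} (hg : ∀ j, IsZeroMeanGP (g j) K P)
    (hi : iIndepFun (fun j ω t => g j t ω) P)
    (hK : Integrable (fun t => K t t) volume) (phi : ℕ → L2I) :
    iIndepFun (fun j ω p => coeff (fun t => g j t ω) (phi p)) P := by
  choose F hF hFeq using fun j p => (hg j).exists_measurable_coeff hK (phi p)
  have h1 : iIndepFun (fun j ω p => F j p (fun t => g j t ω)) P :=
    hi.comp (fun j x p => F j p x) fun j => measurable_pi_iff.2 fun p => hF j p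
  refine h1.congr fun j => ?_
  filter_upwards [ae_all_iff.2 fun p => hFeq j p] with ω hω
  exact funext fun p => (hω p).symm

end GaussianProcess

end ModelDepth

/-! ### A dyadic maximal inequality and a rate in the strong law. -/

section Chaining

variable {α : Type*} [MeasurableSpace α]

/-- Largest squared increment of `S` over the `2 ^ m` steps that follow `j`. -/
noncomputable def maxSqIncrement (S : ℕ → α → ℝ) (m j : ℕ) (x : α) : ℝ≥0∞ :=
  ⨆ k ∈ Finset.range (2 ^ m), ENNReal.ofReal ((S (j + k) x - S j x) ^ 2)

theorem measurable_maxSqIncrement {S : ℕ → α → ℝ} (hS : ∀ n, Measurable (S n)) (m j : ℕ) :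
    Measurable (maxSqIncrement S m j) :=
  Measurable.iSup fun k => Measurable.iSup_Prop _
    (((hS (j + k)).sub (hS j)).pow_const 2).ennreal_ofReal

theorem ofReal_sq_le_maxSqIncrement (S : ℕ → α → ℝ) {m k : ℕ} (hk : k < 2 ^ m) (j : ℕ) (x : α) :
    ENNReal.ofReal ((S (j + k) x - S j x) ^ 2) ≤ maxSqIncrement S m j x :=
  le_iSup₂_of_le (f := fun k (_ : k ∈ Finset.range (2 ^ m)) =>
    ENNReal.ofReal ((S (j + k) x - S j x) ^ 2)) k (Finset.mem_range.2 hk) le_rfl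

/-- Bisection: an increment past the midpoint is `u + v` with `v` the increment over the first half,
and `(u + v)² ≤ (1 + ε) u² + (1 + 1/ε) v²`. The maximum over the two halves is bounded by their sum.
-/
theorem maxSqIncrement_succ_le (S : ℕ → α → ℝ) {ε : ℝ} (hε : 0 < ε) (m j : ℕ) (x : α) :
    maxSqIncrement S (m + 1) j x ≤
      ENNReal.ofReal (1 + ε) * (maxSqIncrement S m j x + maxSqIncrement S m (j + 2 ^ m) x) +
      ENNReal.ofReal (1 + 1 / ε) * ENNReal.ofReal ((S (j + 2 ^ m) x - S j x) ^ 2) := by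
  refine iSup₂_le fun k hk => ?_
  have hk' : k < 2 ^ (m + 1) := Finset.mem_range.1 hk
  rcases lt_or_ge k (2 ^ m) with h | h
  · refine (ofReal_sq_le_maxSqIncrement S h j x).trans (le_add_right ?_)
    calc maxSqIncrement S m j x = 1 * maxSqIncrement S m j x := (one_mul _).symm
      _ ≤ ENNReal.ofReal (1 + ε) *
          (maxSqIncrement S m j x + maxSqIncrement S m (j + 2 ^ m) x) := by
        gcongr
        · rw [← ENNReal.ofReal_one]; exact ENNReal.ofReal_le_ofReal (by linarith)
        · exact le_self_add
  · obtain ⟨l, rfl⟩ := Nat.exists_eq_add_of_le h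
    have hl : l < 2 ^ m := by rw [pow_succ] at hk'; omega
    have h1 := ofReal_sq_le_maxSqIncrement S hl (j + 2 ^ m) x
    rw [add_assoc] at h1
    set u := S (j + (2 ^ m + l)) x - S (j + 2 ^ m) x
    set v := S (j + 2 ^ m) x - S j x
    have e : S (j + (2 ^ m + l)) x - S j x = u + v := by ring
    have h2 : (u + v) ^ 2 ≤ (1 + ε) * u ^ 2 + (1 + 1 / ε) * v ^ 2 := by
      have h3 : 0 ≤ (ε * u - v) ^ 2 / ε := by positivity
      have h4 : (ε * u - v) ^ 2 / ε = ε * u ^ 2 - 2 * u * v + 1 / ε * v ^ 2 := by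
        field_simp
        ring
      nlinarith
    rw [e]
    calc ENNReal.ofReal ((u + v) ^ 2)
        ≤ ENNReal.ofReal ((1 + ε) * u ^ 2 + (1 + 1 / ε) * v ^ 2) := ENNReal.ofReal_le_ofReal h2
      _ = ENNReal.ofReal (1 + ε) * ENNReal.ofReal (u ^ 2)
          + ENNReal.ofReal (1 + 1 / ε) * ENNReal.ofReal (v ^ 2) := by
        rw [ENNReal.ofReal_add (by positivity) (by positivity),
          ENNReal.ofReal_mul (by positivity), ENNReal.ofReal_mul (by positivity)]
      _ ≤ _ := by
        gcongr
        exact h1.trans le_add_self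

/-- A maximal inequality for processes whose squared increments are bounded by their length. -/
theorem lintegral_maxSqIncrement_le {μ : Measure α} {S : ℕ → α → ℝ} (hS : ∀ n, Measurable (S n))
    {C : ℝ} (hC : 0 ≤ C)
    (hinc : ∀ j k, ∫⁻ x, ENNReal.ofReal ((S (j + k) x - S j x) ^ 2) ∂μ ≤ ENNReal.ofReal (C * k))
    {ε : ℝ} (hε : 0 < ε) (m j : ℕ) :
    ∫⁻ x, maxSqIncrement S m j x ∂μ ≤
      ENNReal.ofReal ((1 + 1 / ε) * C / (2 * ε) * ((2 * (1 + ε)) ^ m - 2 ^ m)) := by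
  induction m generalizing j with
  | zero =>
    simp [maxSqIncrement]
  | succ m ih =>
    -- The constant for which `B * ((2 (1 + ε)) ^ m - 2 ^ m)` solves the recursion `M (m+1) = 2 (1 +
    -- ε) M m + (1 + 1/ε) C 2 ^ m` with `M 0 = 0`.
    set B := (1 + 1 / ε) * C / (2 * ε) with hB
    have hB0 : 0 ≤ B := by positivity
    have hr : (2 : ℝ) ^ m ≤ (2 * (1 + ε)) ^ m := pow_le_pow_left₀ (by norm_num) (by linarith) m
    have hm := measurable_maxSqIncrement hS
    calc ∫⁻ x, maxSqIncrement S (m + 1) j x ∂μ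
        ≤ ∫⁻ x, (ENNReal.ofReal (1 + ε) *
            (maxSqIncrement S m j x + maxSqIncrement S m (j + 2 ^ m) x) +
          ENNReal.ofReal (1 + 1 / ε) * ENNReal.ofReal ((S (j + 2 ^ m) x - S j x) ^ 2)) ∂μ :=
          lintegral_mono fun x => maxSqIncrement_succ_le S hε m j x
      _ = ENNReal.ofReal (1 + ε) * (∫⁻ x, maxSqIncrement S m j x ∂μ +
            ∫⁻ x, maxSqIncrement S m (j + 2 ^ m) x ∂μ) +
          ENNReal.ofReal (1 + 1 / ε) *
            ∫⁻ x, ENNReal.ofReal ((S (j + 2 ^ m) x - S j x) ^ 2) ∂μ := by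
          have hadd : Measurable fun x =>
              maxSqIncrement S m j x + maxSqIncrement S m (j + 2 ^ m) x := (hm m j).add (hm m _)
          have hsq : Measurable fun x => (S (j + 2 ^ m) x - S j x) ^ 2 :=
            ((hS _).sub (hS j)).pow_const 2
          rw [lintegral_add_left (hadd.const_mul _), lintegral_const_mul _ hadd,
            lintegral_add_left (hm m j),
            lintegral_const_mul _ hsq.ennreal_ofReal]
      _ ≤ ENNReal.ofReal (1 + ε) * (ENNReal.ofReal (B * ((2 * (1 + ε)) ^ m - 2 ^ m)) +
            ENNReal.ofReal (B * ((2 * (1 + ε)) ^ m - 2 ^ m))) +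
          ENNReal.ofReal (1 + 1 / ε) * ENNReal.ofReal (C * (2 ^ m : ℕ)) := by
          gcongr
          · exact ih j
          · exact ih _
          · exact hinc j _
      _ = ENNReal.ofReal (B * ((2 * (1 + ε)) ^ (m + 1) - 2 ^ (m + 1))) := by
          have h0 : 0 ≤ B * ((2 * (1 + ε)) ^ m - 2 ^ m) := mul_nonneg hB0 (by linarith)
          rw [← ENNReal.ofReal_add h0 h0, ← ENNReal.ofReal_mul (by positivity),
            ← ENNReal.ofReal_mul (by positivity), ← ENNReal.ofReal_add (by positivity)
              (by positivity)]
          congr 1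
          have hBe : (1 + 1 / ε) * C = B * (2 * ε) := by rw [hB]; field_simp
          rw [← mul_assoc, hBe]
          push_cast
          ring

theorem exists_summable_bound {μ : Measure α} {S : ℕ → α → ℝ} (hS : ∀ n, Measurable (S n))
    {C : ℝ} (hC : 0 ≤ C)
    (hinc : ∀ j k, ∫⁻ x, ENNReal.ofReal ((S (j + k) x - S j x) ^ 2) ∂μ ≤ ENNReal.ofReal (C * k))
    {s : ℝ} (hs : 1 / 2 < s) :
    ∃ G : ℕ → α → ℝ≥0∞, (∀ m, Measurable (G m)) ∧ ∑' m, ∫⁻ x, G m x ∂μ ≠ ∞ ∧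
      ∀ n : ℕ, 1 ≤ n → ∀ x, ENNReal.ofReal ((n : ℝ) ^ (-(2 * s))) *
        ENNReal.ofReal ((S n x - S 0 x) ^ 2) ≤ G (Nat.log 2 n + 1) x := by
  set ρ : ℝ := 2 ^ (2 * s) with hρ
  have hρ2 : 2 < ρ := by
    have := Real.rpow_lt_rpow_of_exponent_lt (x := 2) (by norm_num) (by linarith : (1:ℝ) < 2 * s)
    rwa [Real.rpow_one] at this
  have hρ0 : 0 < ρ := by linarith
  -- The maxima grow like `(2 (1 + ε)) ^ m` and the normalization decays like `ρ ^ (-m)`; since `ρ >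
  -- 2`, a small `ε` makes the ratio geometric.
  obtain ⟨ε, hε, hεr⟩ : ∃ ε : ℝ, 0 < ε ∧ 2 * (1 + ε) < ρ :=
    ⟨(ρ - 2) / 4, by linarith, by linarith⟩
  set B := (1 + 1 / ε) * C / (2 * ε) with hB
  have hB0 : 0 ≤ B := by positivity
  -- The extra factor `ρ` pays for the shift `m = Nat.log 2 n + 1`: for `2 ^ l ≤ n` one has `n ^
  -- (-2s) ≤ ρ ^ (-l) = ρ / ρ ^ (l+1)`.
  refine ⟨fun m x => ENNReal.ofReal (ρ / ρ ^ m) * maxSqIncrement S m 0 x,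
    fun m => (measurable_maxSqIncrement hS m 0).const_mul _, ?_, ?_⟩
  · have hle : ∀ m, ∫⁻ x, ENNReal.ofReal (ρ / ρ ^ m) * maxSqIncrement S m 0 x ∂μ
        ≤ ENNReal.ofReal (ρ * B * (2 * (1 + ε) / ρ) ^ m) := by
      intro m
      rw [lintegral_const_mul _ (measurable_maxSqIncrement hS m 0)]
      refine (mul_le_mul_right (lintegral_maxSqIncrement_le hS hC hinc hε m 0) _).trans ?_
      rw [← ENNReal.ofReal_mul (by positivity)]
      refine ENNReal.ofReal_le_ofReal ?_
      rw [div_pow, ← hB]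
      calc ρ / ρ ^ m * (B * ((2 * (1 + ε)) ^ m - 2 ^ m))
          ≤ ρ / ρ ^ m * (B * ((2 * (1 + ε)) ^ m)) := by
            gcongr; linarith [pow_pos (two_pos (α := ℝ)) m]
        _ = _ := by ring
    have hsum : Summable (fun m : ℕ => ρ * B * (2 * (1 + ε) / ρ) ^ m) :=
      (summable_geometric_of_lt_one (by positivity) ((div_lt_one hρ0).2 hεr)).mul_left _
    refine ne_top_of_le_ne_top ?_ (ENNReal.tsum_le_tsum hle)
    rw [← ENNReal.ofReal_tsum_of_nonneg (fun m => by positivity) hsum]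
    exact ENNReal.ofReal_ne_top
  · intro n hn x
    have h1 : n < 2 ^ (Nat.log 2 n + 1) := Nat.lt_pow_succ_log_self (by norm_num) n
    have h2 := ofReal_sq_le_maxSqIncrement S h1 0 x
    rw [zero_add] at h2
    refine mul_le_mul' (ENNReal.ofReal_le_ofReal ?_) h2
    have h3 : 2 ^ (Nat.log 2 n) ≤ n := Nat.pow_log_le_self 2 (by omega)
    set l := Nat.log 2 n
    have h4 : ρ / ρ ^ (l + 1) = ((2 : ℝ) ^ l) ^ (-(2 * s)) := by
      rw [pow_succ, div_mul_cancel_right₀ hρ0.ne', Real.rpow_neg (by positivity), hρ,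
        ← Real.rpow_natCast, ← Real.rpow_natCast, ← Real.rpow_mul (by norm_num),
        ← Real.rpow_mul (by norm_num), mul_comm]
    rw [h4]
    exact Real.rpow_le_rpow_of_nonpos (by positivity) (by exact_mod_cast h3) (by linarith)

/-- An almost sure rate in the strong law of large numbers for square integrable random fields. -/
theorem ae_tendsto_rpow_mul_lintegral_sq_sum {Z : Type*} [MeasurableSpace Z] {Ω : Type*}
    [MeasurableSpace Ω] {P : Measure Ω} [IsProbabilityMeasure P] {ρ : Measure Z}
    [IsProbabilityMeasure ρ] {Y : ℕ → Z → Ω → ℝ}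
    (hY : ∀ i, Measurable (fun x : Z × Ω => Y i x.1 x.2))
    (hind : ∀ z, Pairwise fun i j => IndepFun (Y i z) (Y j z) P)
    (h2 : ∀ i z, MemLp (Y i z) 2 P) (h0 : ∀ i z, ∫ ω, Y i z ω ∂P = 0)
    {C : ℝ} (hC : ∀ i z, ∫ ω, Y i z ω ^ 2 ∂P ≤ C) {s : ℝ} (hs : 1 / 2 < s) :
    ∀ᵐ ω ∂P, Tendsto (fun n : ℕ => ENNReal.ofReal ((n : ℝ) ^ (-(2 * s))) *
      ∫⁻ z, ENNReal.ofReal ((∑ i ∈ Finset.range n, Y i z ω) ^ 2) ∂ρ) atTop (𝓝 0) := by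
  set S : ℕ → Z × Ω → ℝ := fun n x => ∑ i ∈ Finset.range n, Y i x.1 x.2 with hSdef
  have hS : ∀ n, Measurable (S n) := fun n => Finset.measurable_sum _ fun i _ => hY i
  have hC0 : 0 ≤ C := by
    obtain ⟨z⟩ : Nonempty Z := ρ.nonempty_of_neZero
    exact (integral_nonneg fun ω => sq_nonneg _).trans (hC 0 z)
  -- The maximal inequality is used on the product space, so that only variances of sums at fixed
  -- `z` are needed, and pairwise independence suffices for these.
  have hinc : ∀ j k, ∫⁻ x, ENNReal.ofReal ((S (j + k) x - S j x) ^ 2) ∂(ρ.prod P)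
      ≤ ENNReal.ofReal (C * k) := by
    intro j k
    have hsq : Measurable fun x => (S (j + k) x - S j x) ^ 2 := ((hS _).sub (hS j)).pow_const 2
    rw [lintegral_prod _ hsq.ennreal_ofReal.aemeasurable]
    have hz : ∀ z, ∫⁻ ω, ENNReal.ofReal ((S (j + k) (z, ω) - S j (z, ω)) ^ 2) ∂P
        ≤ ENNReal.ofReal (C * k) := by
      intro z
      have hT : ∀ ω, S (j + k) (z, ω) - S j (z, ω) = (∑ i ∈ Finset.Ico j (j + k), Y i z) ω := by
        intro ω
        rw [hSdef, Finset.sum_apply, Finset.sum_Ico_eq_sub _ (by omega)]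
      have hm : MemLp (∑ i ∈ Finset.Ico j (j + k), Y i z) 2 P := memLp_finsetSum' _ fun i _ => h2 i z
      have hmean : ∫ ω, (∑ i ∈ Finset.Ico j (j + k), Y i z) ω ∂P = 0 := by
        simp only [Finset.sum_apply]
        rw [integral_finsetSum _ fun i _ => (h2 i z).integrable (by norm_num)]
        simp [h0]
      simp only [hT]
      rw [← ofReal_integral_eq_lintegral_ofReal hm.integrable_sq (ae_of_all _ fun ω => sq_nonneg _)]
      refine ENNReal.ofReal_le_ofReal ?_
      rw [← variance_of_integral_eq_zero hm.1.aemeasurable hmean,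
        IndepFun.variance_sum (fun i _ => h2 i z) fun i _ j _ hij => hind z hij]
      calc ∑ i ∈ Finset.Ico j (j + k), Var[Y i z; P] ≤ ∑ i ∈ Finset.Ico j (j + k), C := by
            refine Finset.sum_le_sum fun i _ => ?_
            rw [variance_of_integral_eq_zero (h2 i z).1.aemeasurable (h0 i z)]
            exact hC i z
        _ = C * k := by simp [mul_comm]
    calc ∫⁻ z, ∫⁻ ω, ENNReal.ofReal ((S (j + k) (z, ω) - S j (z, ω)) ^ 2) ∂P ∂ρ
        ≤ ∫⁻ _, ENNReal.ofReal (C * k) ∂ρ := lintegral_mono hz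
      _ = ENNReal.ofReal (C * k) := by simp
  obtain ⟨G, hG, hGsum, hGle⟩ := exists_summable_bound hS hC0 hinc hs
  have hGint : ∀ m, Measurable fun ω => ∫⁻ z, G m (z, ω) ∂ρ := fun m => (hG m).lintegral_prod_left'
  -- A nonnegative series with finite expectation converges almost surely, so its terms tend to
  -- zero.
  have hfin : ∫⁻ ω, ∑' m, ∫⁻ z, G m (z, ω) ∂ρ ∂P ≠ ∞ := by
    rw [lintegral_tsum fun m => (hGint m).aemeasurable]
    convert hGsum using 3 with m
    rw [lintegral_prod_symm' _ (hG m)]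
  filter_upwards [ae_lt_top (Measurable.tsum hGint) hfin] with ω hω
  have ht : Tendsto (fun n : ℕ => ∫⁻ z, G (Nat.log 2 n + 1) (z, ω) ∂ρ) atTop (𝓝 0) := by
    have h1 := ENNReal.tendsto_atTop_zero_of_tsum_ne_top hω.ne
    have hlog : Tendsto (Nat.log 2) atTop atTop :=
      tendsto_atTop_atTop_of_monotone (fun _ _ h => Nat.log_mono_right h)
        fun b => ⟨2 ^ b, (Nat.log_pow (by norm_num) b).ge⟩
    exact h1.comp ((tendsto_add_atTop_nat 1).comp hlog)
  refine tendsto_of_tendsto_of_tendsto_of_le_of_le' tendsto_const_nhds ht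
    (Eventually.of_forall fun _ => bot_le) ?_
  filter_upwards [eventually_ge_atTop 1] with n hn
  have hmeas : Measurable fun z => ENNReal.ofReal ((∑ i ∈ Finset.range n, Y i z ω) ^ 2) :=
    (((hS n).comp measurable_prodMk_right).pow_const 2).ennreal_ofReal
  rw [← lintegral_const_mul _ hmeas]
  refine lintegral_mono fun z => ?_
  have := hGle n hn (z, ω)
  simpa [hSdef] using this

end Chaining

/-! ### Almost sure rate of the empirical covariance. -/

namespace ModelDepth

section Sample

variable {Ω : Type*} [MeasurableSpace Ω] {P : Measure Ω} [IsProbabilityMeasure P]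
  {X : I → Ω → ℝ} {K : I → I → ℝ}

/-- `X t` is distributed as `√(K t t)` times a standard Gaussian. Fourth moments bound the variances
of the products `X s X t`. -/
theorem IsZeroMeanGP.integral_pow_four (hX : IsZeroMeanGP X K P) (t : I) :
    Integrable (fun ω => X t ω ^ 4) P ∧
      ∫ ω, X t ω ^ 4 ∂P = K t t ^ 2 * ∫ x, x ^ 4 ∂(gaussianReal 0 1) := by
  have hg := hX.gaussian.hasGaussianLaw_eval t
  have hK0 : 0 ≤ K t t := by
    rw [← hX.cov_eq]; exact integral_nonneg fun ω => mul_self_nonneg _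
  have hvar : Var[X t; P] = K t t := by
    rw [variance_of_integral_eq_zero hg.aemeasurable (hX.mean_zero t), ← hX.cov_eq]
    simp only [sq]
  have hlaw : P.map (X t) = (gaussianReal 0 1).map (√(K t t) * ·) := by
    rw [hg.map_eq_gaussianReal, hX.mean_zero, hvar, gaussianReal_map_const_mul, mul_zero, mul_one]
    congr 1
    ext
    simp [Real.sq_sqrt hK0, Real.coe_toNNReal _ hK0]
  have h4 : MemLp (X t) 4 P := hg.memLp (by norm_num)
  refine ⟨?_, ?_⟩
  · have := h4.integrable_norm_pow (by norm_num)
    refine this.congr (ae_of_all _ fun ω => ?_)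
    simp only [Real.norm_eq_abs]
    exact (Even.pow_abs (by decide) _)
  · have h1 := integral_map (μ := P) hg.aemeasurable (f := fun x : ℝ => x ^ 4) (by fun_prop)
    rw [← h1, hlaw, integral_map (by fun_prop) (by fun_prop)]
    simp only [mul_pow]
    rw [integral_const_mul]
    congr 1
    rw [show (4 : ℕ) = 2 * 2 from rfl, pow_mul, Real.sq_sqrt hK0]

theorem IsZeroMeanGP.memLp_mul (hX : IsZeroMeanGP X K P) (s t : I) :
    MemLp (fun ω => X s ω * X t ω) 2 P ∧ ∫ ω, (X s ω * X t ω) ^ 2 ∂P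
      ≤ (K s s ^ 2 + K t t ^ 2) / 2 * ∫ x, x ^ 4 ∂(gaussianReal 0 1) := by
  have hm : Measurable (fun ω => X s ω * X t ω) := (hX.measurable_apply s).mul (hX.measurable_apply t)
  have hb : Integrable (fun ω => (X s ω ^ 4 + X t ω ^ 4) / 2) P :=
    ((hX.integral_pow_four s).1.add (hX.integral_pow_four t).1).div_const 2
  have hle : ∀ ω, (X s ω * X t ω) ^ 2 ≤ (X s ω ^ 4 + X t ω ^ 4) / 2 := by
    intro ω; nlinarith [sq_nonneg (X s ω ^ 2 - X t ω ^ 2)]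
  have hi : Integrable (fun ω => (X s ω * X t ω) ^ 2) P := by
    refine hb.mono' (hm.pow_const 2).aestronglyMeasurable (ae_of_all _ fun ω => ?_)
    rw [Real.norm_eq_abs, abs_of_nonneg (sq_nonneg _)]
    exact hle ω
  refine ⟨(memLp_two_iff_integrable_sq hm.aestronglyMeasurable).2 hi, ?_⟩
  refine (integral_mono hi hb hle).trans_eq ?_
  rw [integral_div, integral_add (hX.integral_pow_four s).1 (hX.integral_pow_four t).1,
    (hX.integral_pow_four s).2, (hX.integral_pow_four t).2]
  ring

theorem empCov_eq (f : ℕ → I → ℝ) {n : ℕ} (hn : n ≠ 0) (s t : I) :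
    empCov f n s t = (1 / (n : ℝ)) * ∑ i ∈ Finset.range n, f i s * f i t
      - sampleMean f n s * sampleMean f n t := by
  have hn' : (n : ℝ) ≠ 0 := Nat.cast_ne_zero.2 hn
  have h1 : ∀ t, ∑ i ∈ Finset.range n, f i t = n * sampleMean f n t := by
    intro t; rw [sampleMean]; field_simp
  have h2 : ∑ i ∈ Finset.range n, (f i s - sampleMean f n s) * (f i t - sampleMean f n t)
      = ∑ i ∈ Finset.range n, f i s * f i t - n * (sampleMean f n s * sampleMean f n t) := by
    simp only [sub_mul, mul_sub, Finset.sum_sub_distrib, ← Finset.sum_mul, ← Finset.mul_sum, h1,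
      Finset.sum_const, Finset.card_range, nsmul_eq_mul]
    ring
  rw [empCov, h2]
  field_simp

variable {f : ℕ → I → Ω → ℝ}

theorem ae_tendsto_sampleMean (hK : Continuous (fun z : I × I => K z.1 z.2))
    (hf : ∀ i, IsZeroMeanGP (f i) K P) (hfi : iIndepFun (fun i ω t => f i t ω) P)
    {s : ℝ} (hs : 1 / 2 < s) :
    ∀ᵐ ω ∂P, Tendsto (fun n : ℕ => ENNReal.ofReal ((n : ℝ) ^ (-(2 * s))) *
      ∫⁻ t : I, ENNReal.ofReal ((∑ i ∈ Finset.range n, f i t ω) ^ 2)) atTop (𝓝 0) := by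
  obtain ⟨B, hB⟩ := isCompact_univ.exists_bound_of_continuousOn
    (f := fun t : I => K t t) (hK.comp (continuous_id.prodMk continuous_id)).continuousOn
  refine ae_tendsto_rpow_mul_lintegral_sq_sum (Y := f) (C := B)
    (fun i => (hf i).measurable) (fun t i j hij => ?_) (fun i t => (hf i).memLp_apply t)
    (fun i t => (hf i).mean_zero t) (fun i t => ?_) hs
  · exact (hfi.indepFun hij).comp (measurable_pi_apply t) (measurable_pi_apply t)
  · simp only [sq]
    rw [(hf i).cov_eq]
    exact (le_abs_self _).trans (hB t trivial)

theorem ae_tendsto_sampleProduct (hK : Continuous (fun z : I × I => K z.1 z.2))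
    (hf : ∀ i, IsZeroMeanGP (f i) K P) (hfi : iIndepFun (fun i ω t => f i t ω) P)
    {s : ℝ} (hs : 1 / 2 < s) :
    ∀ᵐ ω ∂P, Tendsto (fun n : ℕ => ENNReal.ofReal ((n : ℝ) ^ (-(2 * s))) *
      ∫⁻ z : I × I, ENNReal.ofReal ((∑ i ∈ Finset.range n,
        (f i z.1 ω * f i z.2 ω - K z.1 z.2)) ^ 2)) atTop (𝓝 0) := by
  obtain ⟨B, hB⟩ := isCompact_univ.exists_bound_of_continuousOn
    (f := fun t : I => K t t) (hK.comp (continuous_id.prodMk continuous_id)).continuousOn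
  have hint : ∀ i s t, Integrable (fun ω => f i s ω * f i t ω) P := fun i s t =>
    ((hf i).memLp_mul s t).1.integrable (by norm_num)
  refine ae_tendsto_rpow_mul_lintegral_sq_sum
    (Y := fun i (z : I × I) ω => f i z.1 ω * f i z.2 ω - K z.1 z.2)
    (C := B ^ 2 * ∫ x, x ^ 4 ∂(gaussianReal 0 1)) (fun i => ?_) (fun z i j hij => ?_)
    (fun i z => ((hf i).memLp_mul z.1 z.2).1.sub (memLp_const _)) (fun i z => ?_)
    (fun i z => ?_) hs
  · have h1 : Measurable fun x : (I × I) × Ω => f i x.1.1 x.2 :=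
      (hf i).measurable.comp ((measurable_fst.comp measurable_fst).prodMk measurable_snd)
    have h2 : Measurable fun x : (I × I) × Ω => f i x.1.2 x.2 :=
      (hf i).measurable.comp ((measurable_snd.comp measurable_fst).prodMk measurable_snd)
    exact (h1.mul h2).sub (hK.measurable.comp measurable_fst)
  · have hm : Measurable fun x : I → ℝ => x z.1 * x z.2 - K z.1 z.2 := by fun_prop
    exact (hfi.indepFun hij).comp hm hm
  · rw [integral_sub (hint i _ _) (integrable_const _), (hf i).cov_eq]; simp
  · have hv : ∫ ω, (f i z.1 ω * f i z.2 ω - K z.1 z.2) ^ 2 ∂P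
        = Var[fun ω => f i z.1 ω * f i z.2 ω; P] := by
      rw [variance_eq_integral (hint i _ _).1.aemeasurable, (hf i).cov_eq]
    rw [hv]
    refine (variance_le_expectation_sq (hint i _ _).1).trans ?_
    refine ((hf i).memLp_mul z.1 z.2).2.trans ?_
    refine mul_le_mul_of_nonneg_right ?_ (integral_nonneg fun x => by positivity)
    have h : ∀ t, K t t ^ 2 ≤ B ^ 2 := fun t => sq_le_sq' (by
      have := (abs_le.1 (hB t trivial)).1; linarith) ((le_abs_self _).trans (hB t trivial))
    linarith [h z.1, h z.2]

/-- The almost sure rate of the empirical covariance function in `L²`. -/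
theorem ae_tendsto_empCov (hK : Continuous (fun z : I × I => K z.1 z.2))
    (hf : ∀ i, IsZeroMeanGP (f i) K P) (hfi : iIndepFun (fun i ω t => f i t ω) P)
    {θ : ℝ} (hθ0 : 0 ≤ θ) (hθ : θ < 1) :
    ∀ᵐ ω ∂P, Tendsto (fun n : ℕ => ENNReal.ofReal ((n : ℝ) ^ θ) *
      ∫⁻ z : I × I, ENNReal.ofReal ((empCov (fun i t => f i t ω) n z.1 z.2 - K z.1 z.2) ^ 2))
        atTop (𝓝 0) := by
  -- With `s = 1 - θ/2`, `n ^ (-2s) = n ^ θ * n⁻²`, where `n⁻²` comes from squaring an average.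
  have hs : 1 / 2 < 1 - θ / 2 := by linarith
  filter_upwards [ae_tendsto_sampleMean hK hf hfi hs, ae_tendsto_sampleProduct hK hf hfi hs]
    with ω h1 h2
  set A : ℕ → ℝ≥0∞ := fun n => ∫⁻ t : I, ENNReal.ofReal ((∑ i ∈ Finset.range n, f i t ω) ^ 2)
    with hA
  set E : ℕ → ℝ≥0∞ := fun n => ∫⁻ z : I × I, ENNReal.ofReal ((∑ i ∈ Finset.range n,
        (f i z.1 ω * f i z.2 ω - K z.1 z.2)) ^ 2) with hE
  have hlim : Tendsto (fun n : ℕ => 2 * (ENNReal.ofReal ((n : ℝ) ^ (-(2 * (1 - θ / 2)))) * E n) +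
      2 * ((ENNReal.ofReal ((n : ℝ) ^ (-(2 * (1 - θ / 2)))) * A n) *
        (ENNReal.ofReal ((n : ℝ) ^ (-(2 * (1 - θ / 2)))) * A n))) atTop (𝓝 0) := by
    have h3 := (ENNReal.Tendsto.const_mul (a := 2) h2 (Or.inr (by simp))).add
      (ENNReal.Tendsto.const_mul (a := 2)
        (ENNReal.Tendsto.mul h1 (Or.inr (by simp)) h1 (Or.inr (by simp))) (Or.inr (by simp)))
    rwa [mul_zero, mul_zero, mul_zero, add_zero] at h3
  refine tendsto_of_tendsto_of_tendsto_of_le_of_le' tendsto_const_nhds hlim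
    (Eventually.of_forall fun _ => bot_le) ?_
  filter_upwards [eventually_ge_atTop 1] with n hn
  have hn0 : (0 : ℝ) < n := by exact_mod_cast hn
  have hn1 : (1 : ℝ) ≤ n := by exact_mod_cast hn
  have hmf : ∀ i, Measurable fun t => f i t ω := fun i => (hf i).measurable_path ω
  have hmS : Measurable fun t => ∑ i ∈ Finset.range n, f i t ω :=
    Finset.measurable_sum _ fun i _ => hmf i
  have hmA : Measurable fun t => ENNReal.ofReal ((∑ i ∈ Finset.range n, f i t ω) ^ 2) :=
    (hmS.pow_const 2).ennreal_ofReal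
  have hmE : Measurable fun z : I × I => ENNReal.ofReal ((∑ i ∈ Finset.range n,
        (f i z.1 ω * f i z.2 ω - K z.1 z.2)) ^ 2) := by
    refine Measurable.ennreal_ofReal (Measurable.pow_const (Finset.measurable_sum _ fun i _ => ?_) 2)
    exact (((hmf i).comp measurable_fst).mul ((hmf i).comp measurable_snd)).sub hK.measurable
  have hAA : A n * A n = ∫⁻ z : I × I, ENNReal.ofReal ((∑ i ∈ Finset.range n, f i z.1 ω) ^ 2) *
      ENNReal.ofReal ((∑ i ∈ Finset.range n, f i z.2 ω) ^ 2) := by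
    rw [Measure.volume_eq_prod, lintegral_prod_mul hmA.aemeasurable hmA.aemeasurable]
  set r : ℝ := (n : ℝ) ^ (-(2 * (1 - θ / 2))) with hr
  have hr0 : 0 ≤ r := by positivity
  have hr1 : (n : ℝ) ^ θ * (1 / n) ^ 2 = r := by
    rw [hr, one_div, ← Real.rpow_natCast, ← Real.rpow_neg_one, ← Real.rpow_mul hn0.le,
      ← Real.rpow_add hn0]
    congr 1; push_cast; ring
  -- The product of the two sample means brings `n⁻⁴` after squaring. As `n ^ θ ≥ 1`, one factor `r`
  -- is available for each copy of `A n`.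
  have hr2 : (n : ℝ) ^ θ * (1 / n) ^ 4 ≤ r * r := by
    have : (n : ℝ) ^ θ * (1 / n) ^ 4 ≤ ((n : ℝ) ^ θ * (1 / n) ^ 2) * ((n : ℝ) ^ θ * (1 / n) ^ 2) := by
      have h5 : 1 ≤ (n : ℝ) ^ θ := Real.one_le_rpow hn1 hθ0
      have h6 : 0 ≤ (n : ℝ) ^ θ * (1 / (n : ℝ)) ^ 4 := by positivity
      nlinarith [mul_le_mul_of_nonneg_right h5 h6]
    rwa [hr1] at this
  have hpt : ∀ z : I × I, ENNReal.ofReal ((n : ℝ) ^ θ) *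
      ENNReal.ofReal ((empCov (fun i t => f i t ω) n z.1 z.2 - K z.1 z.2) ^ 2)
      ≤ 2 * (ENNReal.ofReal r * ENNReal.ofReal ((∑ i ∈ Finset.range n,
        (f i z.1 ω * f i z.2 ω - K z.1 z.2)) ^ 2)) +
        2 * (ENNReal.ofReal r * ENNReal.ofReal r *
          (ENNReal.ofReal ((∑ i ∈ Finset.range n, f i z.1 ω) ^ 2) *
            ENNReal.ofReal ((∑ i ∈ Finset.range n, f i z.2 ω) ^ 2))) := by
    intro z
    have e2 : (2 : ℝ≥0∞) = ENNReal.ofReal 2 := by simp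
    rw [e2, ← ENNReal.ofReal_mul (by positivity), ← ENNReal.ofReal_mul (by positivity),
      ← ENNReal.ofReal_mul (by positivity), ← ENNReal.ofReal_mul (by positivity),
      ← ENNReal.ofReal_mul (by positivity), ← ENNReal.ofReal_mul (by positivity),
      ← ENNReal.ofReal_mul (by positivity), ← ENNReal.ofReal_add (by positivity) (by positivity)]
    refine ENNReal.ofReal_le_ofReal ?_
    rw [empCov_eq _ (by omega)]
    set x := ∑ i ∈ Finset.range n, (f i z.1 ω * f i z.2 ω - K z.1 z.2) with hx
    have hx' : (1 / (n : ℝ)) * ∑ i ∈ Finset.range n, f i z.1 ω * f i z.2 ω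
        = (1 / n) * x + K z.1 z.2 := by
      rw [hx, Finset.sum_sub_distrib]
      simp only [Finset.sum_const, Finset.card_range, nsmul_eq_mul]
      field_simp
      ring
    rw [hx', sampleMean, sampleMean]
    set u := ∑ i ∈ Finset.range n, f i z.1 ω
    set v := ∑ i ∈ Finset.range n, f i z.2 ω
    have h7 : ((1 / (n : ℝ)) * x + K z.1 z.2 - 1 / n * u * (1 / n * v) - K z.1 z.2) ^ 2
        ≤ 2 * ((1 / (n : ℝ)) ^ 2 * x ^ 2) + 2 * ((1 / (n : ℝ)) ^ 4 * (u ^ 2 * v ^ 2)) := by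
      nlinarith [sq_nonneg ((1 / (n : ℝ)) * x + 1 / n * u * (1 / n * v))]
    have h8 : (n : ℝ) ^ θ * (1 / n) ^ 4 * (u ^ 2 * v ^ 2) ≤ r * r * (u ^ 2 * v ^ 2) :=
      mul_le_mul_of_nonneg_right hr2 (by positivity)
    have h9 : (n : ℝ) ^ θ * (1 / n) ^ 2 * x ^ 2 = r * x ^ 2 := by rw [hr1]
    have h10 := mul_le_mul_of_nonneg_left h7 (by positivity : 0 ≤ (n : ℝ) ^ θ)
    nlinarith
  have hmemp : Measurable fun z : I × I =>
      ENNReal.ofReal ((empCov (fun i t => f i t ω) n z.1 z.2 - K z.1 z.2) ^ 2) := by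
    refine Measurable.ennreal_ofReal (Measurable.pow_const (Measurable.sub ?_ hK.measurable) 2)
    simp only [empCov, sampleMean]
    refine Measurable.const_mul (Finset.measurable_sum _ fun i _ => Measurable.mul ?_ ?_) _
    · exact ((hmf i).sub (hmS.const_mul _)).comp measurable_fst
    · exact ((hmf i).sub (hmS.const_mul _)).comp measurable_snd
  have hmA2 : Measurable fun z : I × I => ENNReal.ofReal ((∑ i ∈ Finset.range n, f i z.1 ω) ^ 2) *
      ENNReal.ofReal ((∑ i ∈ Finset.range n, f i z.2 ω) ^ 2) :=
    (hmA.comp measurable_fst).mul (hmA.comp measurable_snd)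
  rw [← lintegral_const_mul _ hmemp]
  refine (lintegral_mono hpt).trans_eq ?_
  rw [lintegral_add_left ((hmE.const_mul _).const_mul _), lintegral_const_mul _ (hmE.const_mul _),
    lintegral_const_mul _ hmE, lintegral_const_mul _ (hmA2.const_mul _),
    lintegral_const_mul _ hmA2, ← hAA]
  ring

end Sample

end ModelDepth

/-! ### Integral operators of square integrable kernels. -/

namespace ModelDepth

section KernelOperator

theorem memLp_mul_fst_snd {u v : I → ℝ} (hu : MemLp u 2 volume) (hv : MemLp v 2 volume) :
    MemLp (fun z : I × I => u z.1 * v z.2) 2 (volume : Measure (I × I)) := by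
  rw [Measure.volume_eq_prod]
  refine (memLp_two_iff_integrable_sq ?_).2 ?_
  · exact hu.1.comp_fst.mul hv.1.comp_snd
  · simp only [mul_pow]
    exact hu.integrable_sq.mul_prod hv.integrable_sq

theorem memLp_tensor (h h' : L2I) :
    MemLp (fun z : I × I => h z.1 * h' z.2) 2 (volume : Measure (I × I)) :=
  memLp_mul_fst_snd (Lp.memLp h) (Lp.memLp h')

/-- The tensor product of two square integrable functions. -/
noncomputable def tensor (h h' : L2I) : Lp ℝ 2 (volume : Measure (I × I)) :=
  (memLp_tensor h h').toLp _

theorem coeFn_tensor (h h' : L2I) : tensor h h' =ᵐ[volume] fun z => h z.1 * h' z.2 :=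
  (memLp_tensor h h').coeFn_toLp

theorem ae_fst {p : I → Prop} (h : ∀ᵐ t, p t) : ∀ᵐ z : I × I, p z.1 := by
  rw [Measure.volume_eq_prod]; exact Measure.quasiMeasurePreserving_fst.ae h

theorem ae_snd {p : I → Prop} (h : ∀ᵐ t, p t) : ∀ᵐ z : I × I, p z.2 := by
  rw [Measure.volume_eq_prod]; exact Measure.quasiMeasurePreserving_snd.ae h

theorem tensor_add_left (h g h' : L2I) : tensor (h + g) h' = tensor h h' + tensor g h' := by
  refine Lp.ext ?_
  filter_upwards [coeFn_tensor (h + g) h', coeFn_tensor h h', coeFn_tensor g h',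
    Lp.coeFn_add (tensor h h') (tensor g h'), ae_fst (Lp.coeFn_add h g)] with z h1 h2 h3 h4 h5
  rw [h1, h4, Pi.add_apply, h2, h3, h5, Pi.add_apply, add_mul]

theorem tensor_add_right (h g g' : L2I) : tensor h (g + g') = tensor h g + tensor h g' := by
  refine Lp.ext ?_
  filter_upwards [coeFn_tensor h (g + g'), coeFn_tensor h g, coeFn_tensor h g',
    Lp.coeFn_add (tensor h g) (tensor h g'), ae_snd (Lp.coeFn_add g g')] with z h1 h2 h3 h4 h5
  rw [h1, h4, Pi.add_apply, h2, h3, h5, Pi.add_apply, mul_add]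

theorem tensor_smul_left (c : ℝ) (h h' : L2I) : tensor (c • h) h' = c • tensor h h' := by
  refine Lp.ext ?_
  filter_upwards [coeFn_tensor (c • h) h', coeFn_tensor h h',
    Lp.coeFn_smul c (tensor h h'), ae_fst (Lp.coeFn_smul c h)] with z h1 h2 h4 h5
  rw [h1, h4, Pi.smul_apply, h2, h5, Pi.smul_apply, smul_eq_mul, smul_eq_mul, mul_assoc]

theorem tensor_smul_right (c : ℝ) (h h' : L2I) : tensor h (c • h') = c • tensor h h' := by
  refine Lp.ext ?_
  filter_upwards [coeFn_tensor h (c • h'), coeFn_tensor h h',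
    Lp.coeFn_smul c (tensor h h'), ae_snd (Lp.coeFn_smul c h')] with z h1 h2 h4 h5
  rw [h1, h4, Pi.smul_apply, h2, h5, Pi.smul_apply, smul_eq_mul, smul_eq_mul]; ring

theorem norm_tensor (h h' : L2I) : ‖tensor h h'‖ = ‖h‖ * ‖h'‖ := by
  have hn : ∀ h : L2I, ‖h‖ ^ 2 = ∫ t, h t ^ 2 := by
    intro h
    have := norm_toLp_sq (Lp.memLp h)
    rwa [Lp.toLp_coeFn] at this
  rw [← pow_left_inj₀ (norm_nonneg _) (by positivity) two_ne_zero, mul_pow, hn, hn, tensor,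
    norm_toLp_sq]
  simp only [mul_pow]
  rw [Measure.volume_eq_prod, integral_prod_mul (fun t => h t ^ 2) (fun t => h' t ^ 2)]

/-- The bilinear form of a square integrable kernel. -/
noncomputable def kernelForm (k : Lp ℝ 2 (volume : Measure (I × I))) :
    L2I →L[ℝ] L2I →L[ℝ] ℝ :=
  LinearMap.mkContinuous₂ (LinearMap.mk₂ ℝ (fun h h' => inner ℝ k (tensor h h'))
    (fun h g h' => by rw [tensor_add_left, inner_add_right])
    (fun c h h' => by rw [tensor_smul_left, inner_smul_right, smul_eq_mul])
    (fun h g g' => by rw [tensor_add_right, inner_add_right])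
    (fun c h h' => by rw [tensor_smul_right, inner_smul_right, smul_eq_mul])) ‖k‖
    (fun h h' => by
      rw [LinearMap.mk₂_apply, mul_assoc, ← norm_tensor]; exact norm_inner_le_norm _ _)

/-- The integral operator of a square integrable kernel. -/
noncomputable def kernelOp (k : Lp ℝ 2 (volume : Measure (I × I))) : L2I →L[ℝ] L2I :=
  LinearMap.mkContinuous
    { toFun := fun h => (InnerProductSpace.toDual ℝ L2I).symm (kernelForm k h)
      map_add' := fun h g => by simp only [map_add]
      map_smul' := fun c h => by simp only [map_smul]; simp } ‖kernelForm k‖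
    (fun h => by
      change ‖(InnerProductSpace.toDual ℝ L2I).symm (kernelForm k h)‖ ≤ _
      rw [LinearIsometryEquiv.norm_map]; exact (kernelForm k).le_opNorm h)

theorem inner_kernelOp (k : Lp ℝ 2 (volume : Measure (I × I))) (h h' : L2I) :
    inner ℝ (kernelOp k h) h' = inner ℝ k (tensor h h') :=
  InnerProductSpace.toDual_symm_apply

/-- The image `v` of `h` is paired with itself and Cauchy–Schwarz applied to `tensor h v`: the
operator norm is at most the Hilbert–Schmidt norm. -/
theorem norm_kernelOp_sub_le (k k' : Lp ℝ 2 (volume : Measure (I × I))) :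
    ‖kernelOp k - kernelOp k'‖ ≤ ‖k - k'‖ := by
  refine ContinuousLinearMap.opNorm_le_bound _ (norm_nonneg _) fun h => ?_
  set v := (kernelOp k - kernelOp k') h with hv
  have h1 : ‖v‖ * ‖v‖ ≤ (‖k - k'‖ * ‖h‖) * ‖v‖ := by
    have hw : ∀ w, inner ℝ v w = inner ℝ (k - k') (tensor h w) := fun w => by
      rw [hv, _root_.sub_apply, inner_sub_left, inner_kernelOp, inner_kernelOp, inner_sub_left]
    have := hw v
    rw [← real_inner_self_eq_norm_mul_norm, this, mul_assoc, ← norm_tensor]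
    exact real_inner_le_norm _ _
  rcases eq_or_lt_of_le (norm_nonneg v) with h0 | h0
  · rw [← h0]; positivity
  · exact le_of_mul_le_mul_right h1 h0

theorem inner_kernelOp_eq_integral {κ : I → I → ℝ}
    (hκ : MemLp (fun z : I × I => κ z.1 z.2) 2 (volume : Measure (I × I))) (h h' : L2I) :
    inner ℝ (kernelOp (hκ.toLp _) h) h' = ∫ t, (∫ s, κ s t * h s) * h' t := by
  rw [inner_kernelOp, L2.inner_def]
  have h1 : ∫ z : I × I, inner ℝ (hκ.toLp _ z) (tensor h h' z)
      = ∫ z : I × I, κ z.1 z.2 * (h z.1 * h' z.2) := by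
    refine integral_congr_ae ?_
    filter_upwards [hκ.coeFn_toLp, coeFn_tensor h h'] with z h1 h2
    rw [h1, h2]; simp [mul_comm]
  have hint : Integrable (fun z : I × I => κ z.1 z.2 * (h z.1 * h' z.2)) (volume.prod volume) := by
    rw [← Measure.volume_eq_prod]; exact hκ.integrable_mul (memLp_tensor h h')
  rw [h1, Measure.volume_eq_prod, integral_prod_symm _ hint]
  refine integral_congr_ae (ae_of_all _ fun t => ?_)
  simp only
  rw [← integral_mul_const]
  exact integral_congr_ae (ae_of_all _ fun s => by ring)

theorem IsEigenSystem.spectralSystem {κ : I → I → ℝ} {lam : ℕ → ℝ} {phi : ℕ → L2I}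
    (hphi : IsEigenSystem κ lam phi)
    (hκ : MemLp (fun z : I × I => κ z.1 z.2) 2 (volume : Measure (I × I))) :
    SpectralSystem (kernelOp (hκ.toLp _)) lam phi where
  orthonormal := hphi.orthonormal
  antitone := hphi.antitone
  nonneg := hphi.nonneg
  eigen p := by
    refine ext_inner_right ℝ fun h' => ?_
    rw [inner_kernelOp_eq_integral, inner_smul_left, L2.inner_def, conj_trivial,
      ← integral_const_mul]
    refine integral_congr_ae ?_
    filter_upwards [hphi.eigen p] with t ht
    rw [ht]; simp; ring
  exhaustive h hh := by
    refine ext_inner_right ℝ fun h' => ?_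
    rw [inner_kernelOp_eq_integral, inner_zero_left]
    refine integral_eq_zero_of_ae ?_
    filter_upwards [hphi.exhaustive h hh] with t ht
    simp [ht]

end KernelOperator

end ModelDepth

/-! ### Truncation levels and convergence of the observed norm. -/

namespace ModelDepth

section Truncation

/-- The hypothesis compares neighbours; monotonicity extends it to all `q`, the gap at `q < p` being
at least the bound at `p`. Since `lam (p + 1) ≥ 0`, the gap also bounds `lam p` from below, as
`gap_le_residual` requires. -/
theorem EigenDecay.exists_gap {lam : ℕ → ℝ} {β : ℝ} (hlam : EigenDecay lam β)
    (hanti : Antitone lam) (hnn : ∀ p, 0 ≤ lam p) :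
    ∃ C₀ C₁ : ℝ, 0 < C₀ ∧ 0 < C₁ ∧ ∀ p : ℕ, 0 < lam p ∧ lam p ≤ C₁ * ((p : ℝ) + 1) ^ (-β) ∧
      C₀ * ((p : ℝ) + 1) ^ (-(β + 1)) ≤ lam p ∧
      ∀ q, q ≠ p → C₀ * ((p : ℝ) + 1) ^ (-(β + 1)) ≤ |lam q - lam p| := by
  obtain ⟨hβ, C, C₁, C₂, hC, hC₁, hC₂, h⟩ := hlam
  refine ⟨C, C₁, hC, hC₁, fun p => ⟨lt_of_lt_of_le (by positivity) (h p).2.1, (h p).1,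
    (h p).2.2.trans (by linarith [hnn (p + 1)]), fun q hq => ?_⟩⟩
  rcases lt_or_gt_of_ne hq with hqp | hqp
  · have h1 := (h q).2.2
    have h2 : lam p ≤ lam (q + 1) := hanti hqp
    have h3 : ((p : ℝ) + 1) ^ (-(β + 1)) ≤ ((q : ℝ) + 1) ^ (-(β + 1)) :=
      Real.rpow_le_rpow_of_nonpos (by positivity)
        (by have : (q : ℝ) ≤ p := by exact_mod_cast hqp.le
            linarith) (by linarith)
    have h4 := mul_le_mul_of_nonneg_left h3 hC.le
    exact le_trans (by linarith) (le_abs_self _)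
  · have h1 := (h p).2.2
    have h2 : lam q ≤ lam (p + 1) := hanti hqp
    rw [abs_sub_comm]
    exact le_trans (by linarith) (le_abs_self _)

/-- `sSup` in `ℕ` is `0` for empty and for unbounded sets; an index below the level excludes both
defaults. -/
theorem le_of_lt_truncLevel {ev : ℕ → ℝ} (hev : Antitone ev) {δ : ℝ} {p : ℕ}
    (hp : p < truncLevel ev δ) : δ ≤ ev p := by
  have hne : {m : ℕ | 1 ≤ m ∧ δ ≤ ev (m - 1)}.Nonempty := by
    by_contra h
    rw [Set.not_nonempty_iff_eq_empty] at h
    simp [truncLevel, h] at hp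
  have hbdd : BddAbove {m : ℕ | 1 ≤ m ∧ δ ≤ ev (m - 1)} := by
    by_contra h
    rw [truncLevel, Nat.sSup_of_not_bddAbove h] at hp
    omega
  have h1 := (Nat.sSup_mem hne hbdd).2
  exact h1.trans (hev (by unfold truncLevel at hp; omega))

/-- The eigenvalue below `δ` keeps the defining set bounded; otherwise the level would be the
default `0`. -/
theorem lt_truncLevel {ev : ℕ → ℝ} {δ : ℝ} {p q : ℕ} (hev : Antitone ev)
    (hq : ev q < δ) (hp : δ ≤ ev p) : p < truncLevel ev δ := by
  have hbdd : BddAbove {m : ℕ | 1 ≤ m ∧ δ ≤ ev (m - 1)} := by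
    refine ⟨q, fun m hm => ?_⟩
    by_contra h
    have : ev (m - 1) ≤ ev q := hev (by omega)
    linarith [hm.2]
  exact Nat.lt_of_succ_le (le_csSup hbdd ⟨by omega, by simpa using hp⟩)

variable {H : Type*} [NormedAddCommGroup H] [InnerProductSpace ℝ H] [CompleteSpace H]
  {T : H →L[ℝ] H} {Tn : ℕ → H →L[ℝ] H} {lam : ℕ → ℝ} {lamn : ℕ → ℕ → ℝ} {phi : ℕ → H}
  {phin : ℕ → ℕ → H} {β : ℝ} {δ : ℕ → ℝ} {M C : ℕ → ℕ}

/-- `δₙ⁻¹` grows at most like a power of `n`. -/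
theorem AdmissibleThreshold.exists_inv_le (hδ : AdmissibleThreshold δ β) (hβ : 1 < β) :
    ∃ c : ℝ, 0 < c ∧ ∀ᶠ n : ℕ in atTop, (δ n)⁻¹ ≤ c * (n : ℝ) ^ (β / (4 * β + 2)) := by
  obtain ⟨hpos, -, c, hc, h⟩ := hδ
  refine ⟨c⁻¹, inv_pos.2 hc, ?_⟩
  -- Once `log n ≥ 1` the logarithm can be dropped, and `(√n) ^ (β/(2β+1)) = n ^ (β/(4β+2))`.
  have hlog : ∀ᶠ n : ℕ in atTop, 1 ≤ Real.log n :=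
    (Real.tendsto_log_atTop.comp tendsto_natCast_atTop_atTop).eventually_ge_atTop 1
  filter_upwards [h, hlog, eventually_ge_atTop 1] with n h1 h2 h3
  have hn : (0 : ℝ) < n := by exact_mod_cast h3
  have hq : 0 < √(n : ℝ) / Real.log n := by positivity
  have hγ : 0 ≤ β / (2 * β + 1) := by positivity
  rw [Real.rpow_neg hq.le] at h1
  have h4 : (√(n : ℝ) / Real.log n) ^ (β / (2 * β + 1)) ≤ (n : ℝ) ^ (β / (4 * β + 2)) := by
    calc (√(n : ℝ) / Real.log n) ^ (β / (2 * β + 1)) ≤ (√(n : ℝ)) ^ (β / (2 * β + 1)) :=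
          Real.rpow_le_rpow hq.le (div_le_self (Real.sqrt_nonneg _) h2) hγ
      _ = (n : ℝ) ^ (β / (4 * β + 2)) := by
          rw [Real.sqrt_eq_rpow, ← Real.rpow_mul hn.le]
          congr 1
          field_simp
          ring
  have hx : 0 < (√(n : ℝ) / Real.log n) ^ (β / (2 * β + 1)) := by positivity
  calc (δ n)⁻¹ ≤ (c * ((√(n : ℝ) / Real.log n) ^ (β / (2 * β + 1)))⁻¹)⁻¹ :=
        inv_anti₀ (by positivity) h1
    _ = c⁻¹ * (√(n : ℝ) / Real.log n) ^ (β / (2 * β + 1)) := by rw [mul_inv, inv_inv]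
    _ ≤ _ := by gcongr

/-- A perturbation of order `n ^ (-(3β+2)/(8β+4))` is negligible against the powers of the threshold
that occur in the tail of the truncated norm. -/
theorem tendsto_sq_mul_inv_rpow (hδ : AdmissibleThreshold δ β) (hβ : 1 < β) {e : ℕ → ℝ}
    (he : Tendsto (fun n : ℕ => (n : ℝ) ^ ((3 * β + 2) / (4 * β + 2)) * e n ^ 2) atTop (𝓝 0))
    {r : ℝ} (hr0 : 0 ≤ r) (hr : r ≤ (3 * β + 2) / β) :
    Tendsto (fun n => e n ^ 2 * (δ n)⁻¹ ^ r) atTop (𝓝 0) := by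
  obtain ⟨c, hc, h⟩ := hδ.exists_inv_le hβ
  have h0 := he.const_mul (c ^ r)
  rw [mul_zero] at h0
  refine tendsto_of_tendsto_of_tendsto_of_le_of_le' tendsto_const_nhds h0
    (Eventually.of_forall fun n => ?_) ?_
  · have := (hδ.1 n).le
    positivity
  · filter_upwards [h, eventually_ge_atTop 1] with n h1 h2
    have hn : (1 : ℝ) ≤ n := by exact_mod_cast h2
    have hpos := hδ.1 n
    -- The bound on `r` says exactly that `β r / (4β+2) ≤ (3β+2)/(4β+2)`.
    have h3 : (δ n)⁻¹ ^ r ≤ c ^ r * (n : ℝ) ^ ((3 * β + 2) / (4 * β + 2)) := by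
      calc (δ n)⁻¹ ^ r ≤ (c * (n : ℝ) ^ (β / (4 * β + 2))) ^ r :=
            Real.rpow_le_rpow (by positivity) h1 hr0
        _ = c ^ r * (n : ℝ) ^ (β / (4 * β + 2) * r) := by
            rw [Real.mul_rpow hc.le (by positivity), ← Real.rpow_mul (by positivity)]
        _ ≤ c ^ r * (n : ℝ) ^ ((3 * β + 2) / (4 * β + 2)) := by
            gcongr
            rw [div_mul_eq_mul_div]
            gcongr
            rw [le_div_iff₀ (by linarith)] at hr
            linarith
    calc e n ^ 2 * (δ n)⁻¹ ^ r ≤ e n ^ 2 * (c ^ r * (n : ℝ) ^ ((3 * β + 2) / (4 * β + 2))) := by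
          gcongr
      _ = _ := by ring

/-- The data of the perturbation argument: spectral systems of operators that converge fast
enough, and the truncation levels that the thresholds define. -/
structure PerturbationSetting (T : H →L[ℝ] H) (Tn : ℕ → H →L[ℝ] H) (lam : ℕ → ℝ)
    (lamn : ℕ → ℕ → ℝ) (phi : ℕ → H) (phin : ℕ → ℕ → H) (β : ℝ) (δ : ℕ → ℝ) (C : ℕ → ℕ) :
    Prop where
  spectral : SpectralSystem T lam phi
  spectraln : ∀ n, SpectralSystem (Tn n) (lamn n) (phin n)
  decay : EigenDecay lam β
  threshold : AdmissibleThreshold δ β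
  rate : Tendsto (fun n : ℕ => (n : ℝ) ^ ((3 * β + 2) / (4 * β + 2)) * ‖Tn n - T‖ ^ 2) atTop (𝓝 0)
  level : (∀ n, C n = min (truncLevel (lamn n) (δ n)) n) ∨
    (∀ n, C n = min (truncLevel lam (δ n)) n)

namespace PerturbationSetting

variable (S : PerturbationSetting T Tn lam lamn phi phin β δ C)
include S

theorem one_lt : 1 < β := S.decay.1

theorem tendsto_norm_sub : Tendsto (fun n => ‖Tn n - T‖) atTop (𝓝 0) := by
  have h := tendsto_sq_mul_inv_rpow S.threshold S.one_lt S.rate le_rfl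
    (by have := S.one_lt; positivity)
  simp only [Real.rpow_zero, mul_one] at h
  have := h.sqrt
  simpa using this

/-- The case `r = 2` of `tendsto_sq_mul_inv_rpow`. It makes true and estimated eigenvalues
interchangeable at the threshold, so that both choices of the level can be treated alike. -/
theorem eventually_norm_sub_le : ∀ᶠ n in atTop, ‖Tn n - T‖ ≤ δ n / 2 := by
  have hβ := S.one_lt
  have h := tendsto_sq_mul_inv_rpow S.threshold hβ S.rate (r := 2) (by norm_num)
    (by rw [le_div_iff₀ (by linarith)]; linarith)
  have h4 : ∀ᶠ n in atTop, ‖Tn n - T‖ ^ 2 * (δ n)⁻¹ ^ (2 : ℝ) < 1 / 4 :=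
    h.eventually_lt_const (by norm_num)
  filter_upwards [h4] with n hn
  have hd := S.threshold.1 n
  rw [Real.rpow_two, inv_pow, ← div_eq_mul_inv, div_lt_iff₀ (by positivity)] at hn
  refine abs_le_of_sq_le_sq' ?_ (by positivity) |>.2
  linarith [hn, show (δ n / 2) ^ 2 = 1 / 4 * δ n ^ 2 by ring]

theorem abs_sub_le (n p : ℕ) : |lamn n p - lam p| ≤ ‖Tn n - T‖ :=
  S.spectral.abs_eigenvalue_sub_le (S.spectraln n) p

theorem tendsto_eigenvalue (p : ℕ) : Tendsto (fun n => lamn n p) atTop (𝓝 (lam p)) := by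
  rw [tendsto_iff_dist_tendsto_zero]
  exact squeeze_zero (fun _ => dist_nonneg) (fun n => S.abs_sub_le n p) S.tendsto_norm_sub

theorem pos (p : ℕ) : 0 < lam p := by
  obtain ⟨_, _, _, _, h⟩ := S.decay.exists_gap S.spectral.antitone S.spectral.nonneg
  exact (h p).1

theorem eventually_bounds : ∀ᶠ n in atTop, ∀ p < C n,
    0 < lamn n p ∧ lam p ≤ 2 * lamn n p ∧ δ n / 2 ≤ lam p := by
  filter_upwards [S.eventually_norm_sub_le] with n hn p hp
  have hd := S.threshold.1 n
  have h1 := abs_le.1 ((S.abs_sub_le n p).trans hn)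
  rcases S.level with h | h
  · have h2 := le_of_lt_truncLevel (S.spectraln n).antitone
      (lt_of_lt_of_le hp ((h n).trans_le (min_le_left _ _)))
    refine ⟨by linarith, by linarith, by linarith⟩
  · have h2 := le_of_lt_truncLevel S.spectral.antitone
      (lt_of_lt_of_le hp ((h n).trans_le (min_le_left _ _)))
    refine ⟨by linarith, by linarith, by linarith⟩

theorem tendsto_eigenvalue_zero : Tendsto lam atTop (𝓝 0) := by
  obtain ⟨_, C₁, _, _, h⟩ := S.decay.exists_gap S.spectral.antitone S.spectral.nonneg
  refine squeeze_zero S.spectral.nonneg (fun p => (h p).2.1) ?_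
  have h1 : Tendsto (fun p : ℕ => ((p : ℝ) + 1) ^ (-β)) atTop (𝓝 0) :=
    (tendsto_rpow_neg_atTop (by linarith [S.one_lt])).comp
      (tendsto_atTop_add_const_right _ _ tendsto_natCast_atTop_atTop)
  simpa using h1.const_mul C₁

theorem tendsto_level : Tendsto C atTop atTop := by
  refine tendsto_atTop.2 fun m => ?_
  have h1 : ∀ᶠ n in atTop, δ n < lam m / 2 :=
    S.threshold.2.1.eventually_lt_const (half_pos (S.pos m))
  filter_upwards [h1, S.eventually_norm_sub_le, eventually_ge_atTop m] with n hn hT hm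
  have hd := S.threshold.1 n
  -- With `lam q < δ n / 2`, the true and the estimated `q`-th eigenvalue both lie below `δ n`, as
  -- `lt_truncLevel` needs.
  obtain ⟨q, hq⟩ := (S.tendsto_eigenvalue_zero.eventually_lt_const (half_pos hd)).exists
  have hp := abs_le.1 ((S.abs_sub_le n m).trans hT)
  have hq' := abs_le.1 ((S.abs_sub_le n q).trans hT)
  rcases S.level with h | h
  · rw [h n]
    exact le_min (lt_truncLevel (q := q) (S.spectraln n).antitone (by linarith)
      (by linarith)).le hm
  · rw [h n]
    exact le_min (lt_truncLevel (q := q) S.spectral.antitone (by linarith) (by linarith)).le hm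

/-- The spectral gap at `p` is at least of order `p ^ (-(β+1))`, and its inverse is the price of
identifying the `p`-th eigenvector. -/
theorem exists_coordinate_bound : ∃ c : ℝ, 0 < c ∧ ∀ n p,
    1 - inner ℝ (phi p) (phin n p) ^ 2
      ≤ (c * ((p : ℝ) + 1) ^ (β + 1) * ‖Tn n - T‖) ^ 2 := by
  obtain ⟨C₀, C₁, h0, -, h⟩ := S.decay.exists_gap S.spectral.antitone S.spectral.nonneg
  refine ⟨2 / C₀, by positivity, fun n p => ?_⟩
  have hp : (0 : ℝ) < (p : ℝ) + 1 := by positivity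
  have hg0 : 0 < C₀ * ((p : ℝ) + 1) ^ (-(β + 1)) := by positivity
  have h1 := S.spectral.gap_le_perturbation (S.spectraln n) hg0.le (h p).2.2.1 (h p).2.2.2
  have h2 : 2 / C₀ * ((p : ℝ) + 1) ^ (β + 1) * ‖Tn n - T‖
      = 2 * ‖Tn n - T‖ / (C₀ * ((p : ℝ) + 1) ^ (-(β + 1))) := by
    rw [Real.rpow_neg hp.le]
    field_simp
  rw [h2, div_pow, le_div_iff₀ (by positivity), mul_comm]
  exact h1

/-- Only squares can converge, as the sign of `phin n p` is arbitrary: `⟨f, phin n p⟩` is close to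
`⟨phi p, phin n p⟩ ⟨f, phi p⟩`, whose first factor has square tending to `1`. -/
theorem tendsto_inner_sq (f : H) (p : ℕ) :
    Tendsto (fun n => inner ℝ f (phin n p) ^ 2) atTop (𝓝 (inner ℝ f (phi p) ^ 2)) := by
  obtain ⟨c, hc, h⟩ := S.exists_coordinate_bound
  set E : ℕ → ℝ := fun n => c * ((p : ℝ) + 1) ^ (β + 1) * ‖Tn n - T‖ with hE
  have hE0 : ∀ n, 0 ≤ E n := fun n => by positivity
  have hEt : Tendsto E atTop (𝓝 0) := by simpa using S.tendsto_norm_sub.const_mul _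
  have hcmp := fun n => abs_abs_inner_sub_le (f := f) (S.spectral.orthonormal.1 p)
    ((S.spectraln n).orthonormal.1 p) (hE0 n) (h n p)
  have h1 : Tendsto (fun n => inner ℝ (phi p) (phin n p) ^ 2) atTop (𝓝 1) := by
    refine tendsto_of_tendsto_of_tendsto_of_le_of_le (g := fun n => 1 - E n ^ 2) (h := fun _ => 1)
      ?_ tendsto_const_nhds (fun n => by simp only; linarith [h n p]) (fun n => ?_)
    · simpa using (hEt.pow 2).const_sub 1
    · exact (sq_le_one_iff_abs_le_one _).2 (hcmp n).2
  have h2 : Tendsto (fun n => inner ℝ f (phin n p) - inner ℝ (phi p) (phin n p) * inner ℝ f (phi p))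
      atTop (𝓝 0) := by
    refine squeeze_zero_norm (fun n => (hcmp n).1) ?_
    simpa using hEt.const_mul ‖f‖
  set u : ℕ → ℝ := fun n =>
    inner ℝ f (phin n p) - inner ℝ (phi p) (phin n p) * inner ℝ f (phi p) with hu
  have h3 : Tendsto (fun n => u n * (2 * (inner ℝ (phi p) (phin n p) * inner ℝ f (phi p))))
      atTop (𝓝 0) := by
    refine squeeze_zero_norm (a := fun n => |u n| * (2 * |inner ℝ f (phi p)|)) (fun n => ?_) ?_
    · rw [Real.norm_eq_abs, abs_mul, abs_mul, abs_mul, abs_two]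
      have := mul_le_mul_of_nonneg_right (hcmp n).2 (abs_nonneg (inner ℝ f (phi p)))
      rw [one_mul] at this
      gcongr
    · simpa using h2.abs.mul_const (2 * |inner ℝ f (phi p)|)
  have h4 := ((h2.pow 2).add h3).add (h1.mul_const (inner ℝ f (phi p) ^ 2))
  rw [zero_pow two_ne_zero, add_zero, zero_add, one_mul] at h4
  refine h4.congr fun n => ?_
  simp only [hu]; ring

/-- The terms of the truncated norm are eventually dominated by a summable sequence. -/
theorem eventually_term_le (f : H) (a : ℕ → ℝ) : ∀ᶠ n in atTop, ∀ p < C n,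
    inner ℝ f (phin n p) ^ 2 / lamn n p * a p ^ 2
      ≤ 4 * (inner ℝ f (phi p) ^ 2 / lam p * a p ^ 2) + a p ^ 2 := by
  have hβ := S.one_lt
  obtain ⟨C₀, C₁, -, hC₁, hdec⟩ := S.decay.exists_gap S.spectral.antitone S.spectral.nonneg
  obtain ⟨c, hc, h⟩ := S.exists_coordinate_bound
  -- Below the level `p ^ β = O(1/δ n)`, so the factor `p ^ (2β+2)` costs `δ n ^ (-r)`; division by
  -- `lam p ≥ δ n / 2` costs one more power. `r + 1 = (3β+2)/β` is the largest exponent that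
  -- `tendsto_sq_mul_inv_rpow` allows.
  set r : ℝ := (2 * β + 2) / β with hr
  have hr0 : 0 ≤ r := by positivity
  have hlim := tendsto_sq_mul_inv_rpow S.threshold hβ S.rate (r := r + 1) (by positivity)
    (by rw [hr]; apply le_of_eq; field_simp; ring)
  have hlim' := hlim.const_mul (8 * ‖f‖ ^ 2 * c ^ 2 * (2 * C₁) ^ r)
  rw [mul_zero] at hlim'
  filter_upwards [S.eventually_bounds, hlim'.eventually_le_const zero_lt_one] with n hb hn p hp
  obtain ⟨hpos, h2, hδp⟩ := hb p hp
  have hd := S.threshold.1 n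
  have hlp := S.pos p
  have hp1 : (0 : ℝ) < (p : ℝ) + 1 := by positivity
  set e := ‖Tn n - T‖
  set E := c * ((p : ℝ) + 1) ^ (β + 1) * e with hE
  have hE0 : 0 ≤ E := by positivity
  obtain ⟨hc1, hc2⟩ := abs_abs_inner_sub_le (f := f) (S.spectral.orthonormal.1 p)
    ((S.spectraln n).orthonormal.1 p) hE0 (h n p)
  set x := inner ℝ f (phi p)
  set y := inner ℝ f (phin n p)
  set ip := inner ℝ (phi p) (phin n p)
  have hy : y ^ 2 ≤ 2 * x ^ 2 + 2 * (‖f‖ ^ 2 * E ^ 2) := by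
    have e1 : (y - ip * x) ^ 2 ≤ (‖f‖ * E) ^ 2 := sq_le_sq' (abs_le.1 hc1).1 (abs_le.1 hc1).2
    have e2 : (ip * x) ^ 2 ≤ x ^ 2 := by
      rw [mul_pow]
      exact mul_le_of_le_one_left (sq_nonneg _) ((sq_le_one_iff_abs_le_one _).2 hc2)
    nlinarith [sq_nonneg (y - ip * x - ip * x)]
  have hpow : ((p : ℝ) + 1) ^ (2 * (β + 1)) ≤ (2 * C₁) ^ r * (δ n)⁻¹ ^ r := by
    have e1 : ((p : ℝ) + 1) ^ β ≤ 2 * C₁ * (δ n)⁻¹ := by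
      have e2 := hδp.trans (hdec p).2.1
      rw [Real.rpow_neg hp1.le, ← div_eq_mul_inv, le_div_iff₀ (by positivity)] at e2
      rw [← div_eq_mul_inv, le_div_iff₀ hd]
      linarith
    calc ((p : ℝ) + 1) ^ (2 * (β + 1)) = (((p : ℝ) + 1) ^ β) ^ r := by
          rw [← Real.rpow_mul hp1.le]; congr 1; rw [hr]; field_simp
      _ ≤ (2 * C₁ * (δ n)⁻¹) ^ r := Real.rpow_le_rpow (by positivity) e1 hr0
      _ = _ := Real.mul_rpow (by positivity) (by positivity)
  have hE2 : E ^ 2 = c ^ 2 * ((p : ℝ) + 1) ^ (2 * (β + 1)) * e ^ 2 := by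
    rw [hE, mul_pow, mul_pow, ← Real.rpow_natCast (((p : ℝ) + 1) ^ (β + 1)), ← Real.rpow_mul hp1.le]
    congr 3; push_cast; ring
  have htail : 4 * (‖f‖ ^ 2 * E ^ 2) / lam p ≤ 1 := by
    calc 4 * (‖f‖ ^ 2 * E ^ 2) / lam p ≤ 4 * (‖f‖ ^ 2 * E ^ 2) / (δ n / 2) := by gcongr
      _ = 8 * ‖f‖ ^ 2 * c ^ 2 * ((p : ℝ) + 1) ^ (2 * (β + 1)) * e ^ 2 * (δ n)⁻¹ := by
          rw [hE2]; field_simp; ring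
      _ ≤ 8 * ‖f‖ ^ 2 * c ^ 2 * ((2 * C₁) ^ r * (δ n)⁻¹ ^ r) * e ^ 2 * (δ n)⁻¹ := by gcongr
      _ = 8 * ‖f‖ ^ 2 * c ^ 2 * (2 * C₁) ^ r * (e ^ 2 * (δ n)⁻¹ ^ (r + 1)) := by
          rw [Real.rpow_add_one (inv_pos.2 hd).ne']; ring
      _ ≤ 1 := hn
  have hfin : y ^ 2 / lamn n p ≤ 4 * (x ^ 2 / lam p) + 1 := by
    calc y ^ 2 / lamn n p ≤ y ^ 2 / (lam p / 2) := by
          refine div_le_div_of_nonneg_left (sq_nonneg _) (by positivity) (by linarith)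
      _ ≤ (2 * x ^ 2 + 2 * (‖f‖ ^ 2 * E ^ 2)) / (lam p / 2) := by gcongr
      _ = 4 * (x ^ 2 / lam p) + 4 * (‖f‖ ^ 2 * E ^ 2) / lam p := by field_simp; ring
      _ ≤ _ := by linarith
  calc y ^ 2 / lamn n p * a p ^ 2 ≤ (4 * (x ^ 2 / lam p) + 1) * a p ^ 2 := by gcongr
    _ = _ := by ring

theorem tendsto_term (f : H) (a : ℕ → ℝ) (p : ℕ) :
    Tendsto (fun n => inner ℝ f (phin n p) ^ 2 / lamn n p * a p ^ 2) atTop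
      (𝓝 (inner ℝ f (phi p) ^ 2 / lam p * a p ^ 2)) :=
  ((S.tendsto_inner_sq f p).div (S.tendsto_eigenvalue p) (S.pos p).ne').mul_const _

theorem tendsto_sum_of_summable (f : H) {a : ℕ → ℝ} (ha : Summable fun p => a p ^ 2)
    (hs : Summable fun p => inner ℝ f (phi p) ^ 2 / lam p * a p ^ 2) :
    Tendsto (fun n => ∑ p ∈ Finset.range (C n), inner ℝ f (phin n p) ^ 2 / lamn n p * a p ^ 2)
      atTop (𝓝 (∑' p, inner ℝ f (phi p) ^ 2 / lam p * a p ^ 2)) := by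
  have h1 : ∀ n, ∑ p ∈ Finset.range (C n), inner ℝ f (phin n p) ^ 2 / lamn n p * a p ^ 2
      = ∑' p, if p < C n then inner ℝ f (phin n p) ^ 2 / lamn n p * a p ^ 2 else 0 := by
    intro n
    rw [tsum_eq_sum (s := Finset.range (C n)) fun p hp => if_neg (by simpa using hp)]
    exact Finset.sum_congr rfl fun p hp => (if_pos (Finset.mem_range.1 hp)).symm
  simp only [h1]
  refine tendsto_tsum_of_dominated_convergence
    (bound := fun p => 4 * (inner ℝ f (phi p) ^ 2 / lam p * a p ^ 2) + a p ^ 2)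
    ((hs.mul_left 4).add ha) (fun p => ?_) ?_
  · refine (S.tendsto_term f a p).congr' ?_
    filter_upwards [S.tendsto_level.eventually_gt_atTop p] with n hn
    rw [if_pos hn]
  · filter_upwards [S.eventually_term_le f a, S.eventually_bounds] with n hn hb p
    have hlp := S.pos p
    split_ifs with hp
    · have := (hb p hp).1
      rw [Real.norm_eq_abs, abs_of_nonneg (by positivity)]
      exact hn p hp
    · rw [norm_zero]; positivity

/-- No domination is available, but the terms are nonnegative: termwise convergence of one long
finite partial sum is enough. -/
theorem tendsto_sum_of_not_summable (f : H) {a : ℕ → ℝ}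
    (hs : ¬ Summable fun p => inner ℝ f (phi p) ^ 2 / lam p * a p ^ 2) :
    Tendsto (fun n => ∑ p ∈ Finset.range (C n), inner ℝ f (phin n p) ^ 2 / lamn n p * a p ^ 2)
      atTop atTop := by
  have hnn : ∀ p, 0 ≤ inner ℝ f (phi p) ^ 2 / lam p * a p ^ 2 := fun p => by
    have := S.pos p
    positivity
  have h1 := (not_summable_iff_tendsto_nat_atTop_of_nonneg hnn).1 hs
  refine tendsto_atTop.2 fun R => ?_
  obtain ⟨m, hm⟩ := (h1.eventually_gt_atTop R).exists
  have h2 : Tendsto (fun n => ∑ p ∈ Finset.range m, inner ℝ f (phin n p) ^ 2 / lamn n p * a p ^ 2)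
      atTop (𝓝 (∑ p ∈ Finset.range m, inner ℝ f (phi p) ^ 2 / lam p * a p ^ 2)) :=
    tendsto_finsetSum _ fun p _ => S.tendsto_term f a p
  filter_upwards [h2.eventually_const_lt hm, S.tendsto_level.eventually_ge_atTop m,
    S.eventually_bounds] with n h3 h4 hb
  refine h3.le.trans (Finset.sum_le_sum_of_subset_of_nonneg (Finset.range_mono h4) ?_)
  intro p hp _
  have := (hb p (Finset.mem_range.1 hp)).1
  positivity

end PerturbationSetting

end Truncation

end ModelDepth

/-! ### The weighted chi-square series. -/

namespace ModelDepth

section WeightedChiSquare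

/-- The law of a sequence of independent standard Gaussians. -/
noncomputable def gaussSeq : Measure (ℕ → ℝ) := Measure.infinitePi fun _ => gaussianReal 0 1

instance : IsProbabilityMeasure gaussSeq := by unfold gaussSeq; infer_instance

/-- Resampling one coordinate of an independent sequence preserves its law; this is the device for
conditioning on all the others. -/
theorem measurePreserving_update (p : ℕ) :
    (gaussSeq.prod (gaussianReal 0 1)).map (fun x : (ℕ → ℝ) × ℝ => Function.update x.1 p x.2)
      = gaussSeq := by
  refine Measure.eq_infinitePi _ fun s t ht => ?_
  have hm : Measurable (fun x : (ℕ → ℝ) × ℝ => Function.update x.1 p x.2) := by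
    refine measurable_pi_iff.2 fun i => ?_
    by_cases hi : i = p
    · subst hi; simpa using measurable_snd
    · simp only [Function.update_of_ne hi]; fun_prop
  rw [Measure.map_apply hm (.pi s.countable_toSet fun _ _ => ht _)]
  have hpre : (fun x : (ℕ → ℝ) × ℝ => Function.update x.1 p x.2) ⁻¹' ((s : Set ℕ).pi t)
      = ((s.erase p : Finset ℕ) : Set ℕ).pi t ×ˢ (if p ∈ s then t p else Set.univ) := by
    ext ⟨z, y⟩
    simp only [Set.mem_preimage, Set.mem_pi, Set.mem_prod, Finset.mem_coe, Finset.mem_erase]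
    constructor
    · intro h
      refine ⟨fun i hi => by simpa [Function.update_of_ne hi.1] using h i hi.2, ?_⟩
      split_ifs with hp
      · simpa using h p hp
      · trivial
    · rintro ⟨h1, h2⟩ i hi
      by_cases hip : i = p
      · subst hip; simpa [hi] using h2
      · simpa [Function.update_of_ne hip] using h1 i ⟨hip, hi⟩
  rw [hpre, Measure.prod_prod, gaussSeq, Measure.infinitePi_pi _ fun i _ => ht i]
  split_ifs with hp
  · rw [mul_comm, Finset.mul_prod_erase s (fun i => (gaussianReal 0 1) (t i)) hp]
  · rw [measure_univ, mul_one, Finset.erase_eq_of_notMem hp]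

variable (a : ℕ → ℝ)

/-- The partial sums of the weighted chi-square series. -/
noncomputable def chiPart (m : ℕ) (z : ℕ → ℝ) : ℝ := ∑ p ∈ Finset.range m, z p ^ 2 * a p ^ 2

/-- The weighted chi-square series. -/
noncomputable def chiSeries (z : ℕ → ℝ) : ℝ := ∑' p, z p ^ 2 * a p ^ 2

theorem measurable_chiPart (m : ℕ) : Measurable (chiPart a m) := by
  unfold chiPart; fun_prop

theorem measurable_chiSeries : Measurable (chiSeries a) := by
  unfold chiSeries
  exact Measurable.tsum fun p => by fun_prop

variable {a}

theorem chiPart_mono (z : ℕ → ℝ) : Monotone fun m => chiPart a m z := fun m n h =>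
  Finset.sum_le_sum_of_subset_of_nonneg (Finset.range_mono h) fun p _ _ => by positivity

/-- The series has finite expectation `∑ a p ^ 2`. -/
theorem ae_summable_chi (ha : Summable fun p => a p ^ 2) :
    ∀ᵐ z ∂gaussSeq, Summable fun p => z p ^ 2 * a p ^ 2 := by
  have hm : ∀ p, Measurable fun z : ℕ → ℝ => ENNReal.ofReal (z p ^ 2 * a p ^ 2) :=
    fun p => by fun_prop
  have hint : ∀ p, ∫⁻ z : ℕ → ℝ, ENNReal.ofReal (z p ^ 2 * a p ^ 2) ∂gaussSeq
      = ENNReal.ofReal (a p ^ 2) := by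
    intro p
    have hmap : gaussSeq.map (fun z => z p) = gaussianReal 0 1 :=
      Measure.infinitePi_map_eval (μ := fun _ : ℕ => gaussianReal 0 1) p
    have h1 : ∫⁻ z : ℕ → ℝ, ENNReal.ofReal (z p ^ 2 * a p ^ 2) ∂gaussSeq
        = ∫⁻ x, ENNReal.ofReal (x ^ 2 * a p ^ 2) ∂(gaussianReal 0 1) := by
      rw [← hmap, lintegral_map (by fun_prop) (measurable_pi_apply p)]
    have h2 : ∫ x, x ^ 2 ∂(gaussianReal 0 1) = 1 := by
      have h3 := variance_of_integral_eq_zero (μ := gaussianReal 0 1) (X := fun x => x)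
        (by fun_prop) integral_id_gaussianReal
      rw [variance_fun_id_gaussianReal] at h3
      simpa using h3.symm
    have h4 : Integrable (fun x : ℝ => x ^ 2) (gaussianReal 0 1) := by
      have := (memLp_id_gaussianReal (μ := 0) (v := 1) 2).integrable_sq
      simpa using this
    rw [h1, ← ofReal_integral_eq_lintegral_ofReal (h4.mul_const _)
      (ae_of_all _ fun x => by positivity), integral_mul_const, h2, one_mul]
  have hfin : ∫⁻ z : ℕ → ℝ, ∑' p, ENNReal.ofReal (z p ^ 2 * a p ^ 2) ∂gaussSeq ≠ ∞ := by
    rw [lintegral_tsum fun p => (hm p).aemeasurable]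
    simp only [hint]
    rw [← ENNReal.ofReal_tsum_of_nonneg (fun p => sq_nonneg _) ha]
    exact ENNReal.ofReal_ne_top
  filter_upwards [ae_lt_top (Measurable.tsum hm) hfin] with z hz
  have := ENNReal.summable_toReal hz.ne
  refine this.congr fun p => ?_
  rw [ENNReal.toReal_ofReal (by positivity)]

theorem tendsto_chiPart {z : ℕ → ℝ} (hz : Summable fun p => z p ^ 2 * a p ^ 2) :
    Tendsto (fun m => chiPart a m z) atTop (𝓝 (chiSeries a z)) :=
  hz.hasSum.tendsto_sum_nat

theorem chiPart_le_chiSeries {z : ℕ → ℝ} (hz : Summable fun p => z p ^ 2 * a p ^ 2) (m : ℕ) :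
    chiPart a m z ≤ chiSeries a z :=
  hz.sum_le_tsum _ fun p _ => by positivity

/-- The weighted chi-square law has no atoms. -/
theorem gaussSeq_chiSeries_eq (ha : Summable fun p => a p ^ 2) (ha0 : ∃ p, a p ≠ 0) (x : ℝ) :
    gaussSeq {z | chiSeries a z = x} = 0 := by
  obtain ⟨p, hp⟩ := ha0
  have hS : MeasurableSet {z | chiSeries a z = x} :=
    measurable_chiSeries a (measurableSet_singleton x)
  have hm : Measurable (fun x : (ℕ → ℝ) × ℝ => Function.update x.1 p x.2) := by
    refine measurable_pi_iff.2 fun i => ?_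
    by_cases hi : i = p
    · subst hi; simpa using measurable_snd
    · simp only [Function.update_of_ne hi]; fun_prop
  -- With all coordinates but the `p`-th fixed, the series is `y² a_p² + c` and equals `x` for at
  -- most two `y`, a null set for the Gaussian.
  rw [← measurePreserving_update p, Measure.map_apply hm hS, Measure.measure_prod_null (hm hS)]
  filter_upwards [ae_summable_chi ha] with z hz
  have hval : ∀ y, chiSeries a (Function.update z p y)
      = y ^ 2 * a p ^ 2 + ∑' q, if q = p then 0 else z q ^ 2 * a q ^ 2 := by
    intro y
    have hup : (fun q => Function.update z p y q ^ 2 * a q ^ 2)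
        = Function.update (fun q => z q ^ 2 * a q ^ 2) p (y ^ 2 * a p ^ 2) := by
      ext q
      by_cases hq : q = p
      · subst hq; simp
      · simp [Function.update_of_ne hq]
    have hsum : Summable (fun q => Function.update z p y q ^ 2 * a q ^ 2) := by
      rw [hup]; exact hz.update p _
    rw [chiSeries, hsum.tsum_eq_add_tsum_ite p]
    congr 1
    · simp
    · refine tsum_congr fun q => ?_
      split_ifs with hq
      · rfl
      · rw [Function.update_of_ne hq]
  set c := ∑' q, if q = p then 0 else z q ^ 2 * a q ^ 2
  have hnull : NullSingletonClass (gaussianReal 0 1) := nullSingletonClass_gaussianReal one_ne_zero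
  have hsub : Prod.mk z ⁻¹' ((fun x : (ℕ → ℝ) × ℝ => Function.update x.1 p x.2) ⁻¹'
      {z | chiSeries a z = x}) ⊆ {√((x - c) / a p ^ 2), -√((x - c) / a p ^ 2)} := by
    intro y hy
    have h1 : y ^ 2 * a p ^ 2 + c = x := by rw [← hval]; exact hy
    have h2 : y ^ 2 = (x - c) / a p ^ 2 := by
      rw [eq_div_iff (pow_ne_zero 2 hp)]; linarith
    have h3 : |y| = √((x - c) / a p ^ 2) := by rw [← h2, Real.sqrt_sq_eq_abs]
    rcases abs_choice y with h | h
    · left; rw [← h3, h]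
    · right; simp only [Set.mem_singleton_iff]; rw [← h3, h, neg_neg]
  exact measure_mono_null hsub (Set.Finite.measure_zero (by simp) _)

/-- The indicators converge off the event that the series equals `r`, which is null by the absence
of atoms; this also lets `≤` turn into `<` in the limit. -/
theorem tendsto_measure_chiPart_ge (ha : Summable fun p => a p ^ 2) (ha0 : ∃ p, a p ≠ 0)
    {C : ℕ → ℕ} (hC : Tendsto C atTop atTop) {x : ℕ → ℝ} {r : ℝ}
    (hx : Tendsto x atTop (𝓝 r)) :
    Tendsto (fun n => gaussSeq {z | x n ≤ chiPart a (C n) z}) atTop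
      (𝓝 (gaussSeq {z | r < chiSeries a z})) := by
  refine tendsto_measure_of_ae_tendsto_indicator_of_isFiniteMeasure atTop
    (measurableSet_lt measurable_const (measurable_chiSeries a))
    (fun n => measurableSet_le measurable_const (measurable_chiPart a _)) ?_
  have hne : ∀ᵐ z ∂gaussSeq, chiSeries a z ≠ r := by
    rw [ae_iff]; simpa using gaussSeq_chiSeries_eq ha ha0 r
  filter_upwards [ae_summable_chi ha, hne] with z hz hzr
  have ht := (tendsto_chiPart hz).comp hC
  rcases lt_or_gt_of_ne hzr with h | h
  · filter_upwards [ht.eventually_lt hx h] with n hn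
    exact ⟨fun h1 => absurd hn (not_lt.2 h1), fun h1 => absurd h1 (not_lt.2 h.le)⟩
  · filter_upwards [hx.eventually_lt ht h] with n hn
    exact ⟨fun _ => h, fun _ => hn.le⟩

theorem tendsto_measure_chiPart_ge_atTop (ha : Summable fun p => a p ^ 2)
    (C : ℕ → ℕ) {x : ℕ → ℝ} (hx : Tendsto x atTop atTop) :
    Tendsto (fun n => gaussSeq {z | x n ≤ chiPart a (C n) z}) atTop (𝓝 0) := by
  rw [← measure_empty (μ := gaussSeq)]
  refine tendsto_measure_of_ae_tendsto_indicator_of_isFiniteMeasure atTop MeasurableSet.empty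
    (fun n => measurableSet_le measurable_const (measurable_chiPart a _)) ?_
  filter_upwards [ae_summable_chi ha] with z hz
  filter_upwards [hx.eventually_gt_atTop (chiSeries a z)] with n hn
  simp only [Set.mem_empty_iff_false, iff_false]
  refine fun h => not_lt.2 h ?_
  exact (chiPart_le_chiSeries hz _).trans_lt hn

end WeightedChiSquare

end ModelDepth

/-! ### Relative frequencies of independent events. -/

section Frequencies

variable {Ω : Type*} [MeasurableSpace Ω] {μ : Measure Ω} [IsProbabilityMeasure μ]

/-- The relative frequency of the first `N` events. -/
noncomputable def frequency (E : ℕ → Set Ω) (N : ℕ) (ω : Ω) : ℝ :=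
  (1 / (N : ℝ)) * ∑ j ∈ Finset.range N, (E j).indicator (fun _ => (1 : ℝ)) ω

theorem frequency_mono {E F : ℕ → Set Ω} {ω : Ω} (h : ∀ j, ω ∈ E j → ω ∈ F j) (N : ℕ) :
    frequency E N ω ≤ frequency F N ω := by
  unfold frequency
  refine mul_le_mul_of_nonneg_left (Finset.sum_le_sum fun j _ => ?_) (by positivity)
  by_cases hj : ω ∈ E j
  · rw [Set.indicator_of_mem hj, Set.indicator_of_mem (h j hj)]
  · rw [Set.indicator_of_notMem hj]
    exact Set.indicator_nonneg (fun _ _ => zero_le_one) _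

theorem frequency_nonneg (E : ℕ → Set Ω) (N : ℕ) (ω : Ω) : 0 ≤ frequency E N ω :=
  mul_nonneg (by positivity) (Finset.sum_nonneg fun j _ =>
    Set.indicator_nonneg (fun _ _ => zero_le_one) _)

theorem identDistrib_indicator {A B : Set Ω} (hA : MeasurableSet A) (hB : MeasurableSet B)
    (h : μ A = μ B) : IdentDistrib (A.indicator fun _ => (1 : ℝ)) (B.indicator fun _ => (1 : ℝ))
      μ μ := by
  refine ⟨(measurable_const.indicator hA).aemeasurable,
    (measurable_const.indicator hB).aemeasurable, ?_⟩
  have hc : μ Aᶜ = μ Bᶜ := by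
    rw [measure_compl hA (measure_ne_top _ _), measure_compl hB (measure_ne_top _ _), h]
  ext s hs
  rw [Measure.map_apply (measurable_const.indicator hA) hs,
    Measure.map_apply (measurable_const.indicator hB) hs]
  classical
  rw [Set.indicator_const_preimage_eq_union, Set.indicator_const_preimage_eq_union]
  split_ifs <;> simp [h, hc]

theorem indepFun_indicator_of_indepSet {A B : Set Ω} (h : IndepSet A B μ) :
    IndepFun (A.indicator fun _ => (1 : ℝ)) (B.indicator fun _ => (1 : ℝ)) μ := by
  have hle : ∀ A : Set Ω, MeasurableSpace.comap (A.indicator fun _ => (1 : ℝ)) inferInstance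
      ≤ MeasurableSpace.generateFrom {A} := fun A =>
    Measurable.comap_le (Measurable.indicator (m := MeasurableSpace.generateFrom {A})
      measurable_const (MeasurableSpace.measurableSet_generateFrom rfl))
  rw [IndepFun_iff_Indep]
  exact indep_of_indep_of_le_left (indep_of_indep_of_le_right h (hle B)) (hle A)

/-- The strong law for pairwise independent events of equal probability. -/
theorem ae_tendsto_frequency {E : ℕ → Set Ω} (hE : ∀ j, MeasurableSet (E j))
    (hind : Pairwise fun i j => IndepSet (E i) (E j) μ) {p : ℝ} (hp : ∀ j, μ.real (E j) = p) :
    ∀ᵐ ω ∂μ, Tendsto (fun N => frequency E N ω) atTop (𝓝 p) := by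
  have h := strong_law_ae_real (μ := μ) (fun j => (E j).indicator fun _ => (1 : ℝ))
    ((integrable_const _).indicator (hE 0))
    (fun i j hij => indepFun_indicator_of_indepSet (hind hij))
    (fun j => identDistrib_indicator (hE j) (hE 0)
      ((measureReal_eq_measureReal_iff).1 ((hp j).trans (hp 0).symm)))
  rw [integral_indicator_const _ (hE 0), smul_eq_mul, mul_one, hp 0] at h
  filter_upwards [h] with ω hω
  refine hω.congr fun N => ?_
  rw [frequency, div_eq_inv_mul, one_div]

/-- Hoeffding's inequality for the relative frequency. -/
theorem measureReal_le_abs_frequency_sub {E : ℕ → Set Ω} (hE : ∀ j, MeasurableSet (E j))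
    (hind : iIndepFun (fun j => (E j).indicator fun _ => (1 : ℝ)) μ) {p : ℝ}
    (hp : ∀ j, μ.real (E j) = p) {ε : ℝ} (hε : 0 < ε) (N : ℕ) :
    μ.real {ω | ε ≤ |frequency E N ω - p|} ≤ 2 * Real.exp (-(2 * ε ^ 2)) ^ N := by
  rcases Nat.eq_zero_or_pos N with rfl | hN
  · rw [pow_zero]; exact measureReal_le_one.trans (by norm_num)
  have hN0 : (0 : ℝ) < N := by exact_mod_cast hN
  have hsub : ∀ j, HasSubgaussianMGF (fun ω => (E j).indicator (fun _ => (1 : ℝ)) ω - p)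
      ((‖(1 : ℝ) - 0‖₊ / 2) ^ 2) μ := by
    intro j
    have h := hasSubgaussianMGF_of_mem_Icc (μ := μ) (a := 0) (b := 1)
      (X := (E j).indicator fun _ => (1 : ℝ)) (measurable_const.indicator (hE j)).aemeasurable
      (ae_of_all _ fun ω => ⟨Set.indicator_nonneg (fun _ _ => zero_le_one) _,
        Set.indicator_le_self' (fun _ _ => zero_le_one) ω⟩)
    rwa [integral_indicator_const _ (hE j), smul_eq_mul, mul_one, hp j] at h
  have hc : (((‖(1 : ℝ) - 0‖₊ / 2) ^ 2 : NNReal) : ℝ) = 1 / 4 := by simp; norm_num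
  have hexp : Real.exp (-(N * ε) ^ 2 / (2 * N * (1 / 4))) = Real.exp (-(2 * ε ^ 2)) ^ N := by
    rw [← Real.exp_nat_mul]; congr 1; field_simp; ring
  have hi1 : iIndepFun (fun j ω => (E j).indicator (fun _ => (1 : ℝ)) ω - p) μ :=
    hind.comp (fun _ x => x - p) fun _ => by fun_prop
  have hi2 : iIndepFun (fun j ω => -((E j).indicator (fun _ => (1 : ℝ)) ω - p)) μ :=
    hi1.comp (fun _ x => -x) fun _ => by fun_prop
  have h1 := HasSubgaussianMGF.measure_sum_range_ge_le_of_iIndepFun hi1 (n := N)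
    (fun j _ => hsub j) (ε := N * ε) (by positivity)
  have h2 := HasSubgaussianMGF.measure_sum_range_ge_le_of_iIndepFun hi2 (n := N)
    (fun j _ => (hsub j).neg) (ε := N * ε) (by positivity)
  rw [hc, hexp] at h1 h2
  have hcov : {ω | ε ≤ |frequency E N ω - p|} ⊆
      {ω | N * ε ≤ ∑ j ∈ Finset.range N, ((E j).indicator (fun _ => (1 : ℝ)) ω - p)} ∪
      {ω | N * ε ≤ ∑ j ∈ Finset.range N, -((E j).indicator (fun _ => (1 : ℝ)) ω - p)} := by
    intro ω hω
    have e : ∑ j ∈ Finset.range N, ((E j).indicator (fun _ => (1 : ℝ)) ω - p)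
        = N * (frequency E N ω - p) := by
      rw [frequency, Finset.sum_sub_distrib]; simp; field_simp
    simp only [Set.mem_union, Set.mem_ofPred_eq, Finset.sum_neg_distrib, e]
    rcases le_abs.1 (show ε ≤ |frequency E N ω - p| from hω) with h | h
    · left; exact mul_le_mul_of_nonneg_left h hN0.le
    · right; rw [← mul_neg]; exact mul_le_mul_of_nonneg_left h hN0.le
  refine (measureReal_mono hcov).trans ((measureReal_union_le _ _).trans ?_)
  linarith

variable {E : ℕ → ℕ → Set Ω} {p : ℕ → ℝ} {d : ℝ}

theorem ae_exists_tendsto_frequency (hE : ∀ n j, MeasurableSet (E n j))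
    (hind : ∀ n, Pairwise fun i j => IndepSet (E n i) (E n j) μ)
    (hp : ∀ n j, μ.real (E n j) = p n) (hpd : Tendsto p atTop (𝓝 d)) :
    ∀ᵐ ω ∂μ, ∃ L : ℕ → ℝ, (∀ n, Tendsto (fun N => frequency (E n) N ω) atTop (𝓝 (L n))) ∧
      Tendsto L atTop (𝓝 d) := by
  filter_upwards [ae_all_iff.2 fun n => ae_tendsto_frequency (hE n) (hind n) (hp n)] with ω hω
  exact ⟨p, hω, hpd⟩

/-- Uniform convergence of the frequencies over sample sizes that grow faster than `log n`. -/
theorem ae_eventually_forall_frequency (hE : ∀ n j, MeasurableSet (E n j))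
    (hind : ∀ n, iIndepFun (fun j => (E n j).indicator fun _ => (1 : ℝ)) μ)
    (hp : ∀ n j, μ.real (E n j) = p n) (hpd : Tendsto p atTop (𝓝 d)) {N₀ : ℕ → ℕ}
    (hN₀ : Tendsto (fun n : ℕ => (N₀ n : ℝ) / Real.log n) atTop atTop) :
    ∀ᵐ ω ∂μ, ∀ ε : ℝ, 0 < ε → ∀ᶠ n in atTop, ∀ N, N₀ n ≤ N → |frequency (E n) N ω - d| < ε := by
  have hmain : ∀ ε : ℝ, 0 < ε →
      ∀ᵐ ω ∂μ, ∀ᶠ n in atTop, ∀ N, N₀ n ≤ N → |frequency (E n) N ω - p n| < ε := by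
    intro ε hε
    set ρ := Real.exp (-(2 * ε ^ 2)) with hρ
    have hρ0 : 0 < ρ := Real.exp_pos _
    have hρ1 : ρ < 1 := Real.exp_lt_one_iff.2 (neg_lt_zero.2 (by positivity))
    -- A deviation at some sample size from `N₀ n` on. Hoeffding's bounds sum to a multiple of `ρ ^
    -- N₀ n`, and Borel–Cantelli is applied in `n`.
    set B : ℕ → Set Ω := fun n => ⋃ k : ℕ, {ω | ε ≤ |frequency (E n) (N₀ n + k) ω - p n|} with hB
    have hBle : ∀ n, μ (B n) ≤ ENNReal.ofReal (2 * (1 - ρ)⁻¹ * ρ ^ (N₀ n)) := by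
      intro n
      have hgeo : Summable fun k : ℕ => 2 * ρ ^ (N₀ n) * ρ ^ k :=
        (summable_geometric_of_lt_one hρ0.le hρ1).mul_left _
      calc μ (B n) ≤ ∑' k : ℕ, μ {ω | ε ≤ |frequency (E n) (N₀ n + k) ω - p n|} :=
            measure_iUnion_le _
        _ ≤ ∑' k : ℕ, ENNReal.ofReal (2 * ρ ^ (N₀ n) * ρ ^ k) := by
            refine ENNReal.tsum_le_tsum fun k => ?_
            rw [← ofReal_measureReal]
            refine ENNReal.ofReal_le_ofReal ?_
            refine (measureReal_le_abs_frequency_sub (hE n) (hind n) (hp n) hε _).trans_eq ?_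
            rw [pow_add]; ring
        _ = ENNReal.ofReal (2 * (1 - ρ)⁻¹ * ρ ^ (N₀ n)) := by
            rw [← ENNReal.ofReal_tsum_of_nonneg (fun k => by positivity) hgeo, tsum_mul_left,
              tsum_geometric_of_lt_one hρ0.le hρ1]
            congr 1; ring
    have hsum : ∑' n, μ (B n) ≠ ∞ := by
      have hs : Summable fun n : ℕ => 2 * (1 - ρ)⁻¹ * ρ ^ (N₀ n) := by
        refine Summable.mul_left _ ?_
        refine summable_of_isBigO_nat (Real.summable_one_div_nat_pow.2 one_lt_two) ?_
        refine Asymptotics.IsBigO.of_bound 1 ?_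
        -- `ε² N₀ n ≥ log n` gives `ρ ^ N₀ n ≤ exp (-2 log n) = n⁻²`.
        filter_upwards [hN₀.eventually_ge_atTop (1 / ε ^ 2), eventually_gt_atTop 1] with n hn hn1
        have hn0 : (1 : ℝ) < n := by exact_mod_cast hn1
        have hlog : 0 < Real.log n := Real.log_pos hn0
        rw [le_div_iff₀ hlog] at hn
        rw [Real.norm_eq_abs, abs_of_nonneg (by positivity), Real.norm_eq_abs,
          abs_of_nonneg (by positivity), one_mul, hρ, ← Real.exp_nat_mul]
        have h1 : (1 : ℝ) / (n : ℝ) ^ 2 = Real.exp (-(2 * Real.log n)) := by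
          rw [Real.exp_neg, show (2 : ℝ) * Real.log n = ((2 : ℕ) : ℝ) * Real.log n by norm_num,
            Real.exp_nat_mul, Real.exp_log (by linarith), one_div]
        rw [h1]
        refine Real.exp_le_exp.2 ?_
        have h2 : Real.log n ≤ ε ^ 2 * N₀ n := by
          have := mul_le_mul_of_nonneg_left hn (sq_nonneg ε)
          rwa [← mul_assoc, mul_one_div_cancel (by positivity), one_mul] at this
        linarith
      refine ne_top_of_le_ne_top ?_ (ENNReal.tsum_le_tsum hBle)
      rw [← ENNReal.ofReal_tsum_of_nonneg
        (fun n => mul_nonneg (mul_nonneg two_pos.le (inv_nonneg.2 (by linarith))) (by positivity)) hs]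
      exact ENNReal.ofReal_ne_top
    filter_upwards [ae_eventually_notMem hsum] with ω hω
    filter_upwards [hω] with n hn N hN
    by_contra h
    refine hn (Set.mem_iUnion.2 ⟨N - N₀ n, ?_⟩)
    rw [Set.mem_ofPred_eq, Nat.add_sub_cancel' hN]
    exact not_lt.1 h
  filter_upwards [ae_all_iff.2 fun k : ℕ => hmain (1 / ((k : ℝ) + 1)) (by positivity)] with ω hω ε hε
  obtain ⟨k, hk⟩ := exists_nat_one_div_lt (half_pos hε)
  filter_upwards [hω k, Metric.tendsto_nhds.1 hpd (ε / 2) (half_pos hε)] with n h1 h2 N hN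
  have h3 := h1 N hN
  rw [Real.dist_eq] at h2
  calc |frequency (E n) N ω - d| = |(frequency (E n) N ω - p n) + (p n - d)| := by congr 1; ring
    _ ≤ |frequency (E n) N ω - p n| + |p n - d| := abs_add_le _ _
    _ < ε := by linarith

/-- Hoeffding's bound is the same for all `n`: `N` alone makes it small, and `n` only has to bring
`p n` within `ε / 2` of `d`. -/
theorem tendstoInMeasure_frequency (hE : ∀ n j, MeasurableSet (E n j))
    (hind : ∀ n, iIndepFun (fun j => (E n j).indicator fun _ => (1 : ℝ)) μ)
    (hp : ∀ n j, μ.real (E n j) = p n) (hpd : Tendsto p atTop (𝓝 d)) :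
    TendstoInMeasure μ (fun (q : ℕ × ℕ) ω => frequency (E q.1) q.2 ω) (atTop ×ˢ atTop)
      (fun _ => d) := by
  rw [tendstoInMeasure_iff_norm]
  intro ε hε
  have hρ1 : Real.exp (-(2 * (ε / 2) ^ 2)) < 1 := Real.exp_lt_one_iff.2 (neg_lt_zero.2 (by positivity))
  have hlim : Tendsto (fun q : ℕ × ℕ => ENNReal.ofReal (2 * Real.exp (-(2 * (ε / 2) ^ 2)) ^ q.2))
      (atTop ×ˢ atTop) (𝓝 0) := by
    have h1 : Tendsto (fun N : ℕ => ENNReal.ofReal (2 * Real.exp (-(2 * (ε / 2) ^ 2)) ^ N))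
        atTop (𝓝 0) := by
      have := ((tendsto_pow_atTop_nhds_zero_of_lt_one (Real.exp_pos _).le hρ1).const_mul 2)
      rw [mul_zero] at this
      have h2 := (ENNReal.continuous_ofReal.tendsto 0).comp this
      rwa [ENNReal.ofReal_zero] at h2
    exact h1.comp tendsto_snd
  refine tendsto_of_tendsto_of_tendsto_of_le_of_le' tendsto_const_nhds hlim
    (Eventually.of_forall fun _ => bot_le) ?_
  have hev := (tendsto_fst (f := (atTop : Filter ℕ)) (g := (atTop : Filter ℕ))).eventually
    (Metric.tendsto_nhds.1 hpd (ε / 2) (half_pos hε))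
  filter_upwards [hev] with q hq
  rw [Real.dist_eq] at hq
  calc μ {ω | ε ≤ ‖frequency (E q.1) q.2 ω - d‖}
      ≤ μ {ω | ε / 2 ≤ |frequency (E q.1) q.2 ω - p q.1|} := by
        refine measure_mono fun ω hω => ?_
        have h1 : ε ≤ |frequency (E q.1) q.2 ω - d| := hω
        have h2 : |frequency (E q.1) q.2 ω - d|
            ≤ |frequency (E q.1) q.2 ω - p q.1| + |p q.1 - d| := by
          rw [show frequency (E q.1) q.2 ω - d
            = (frequency (E q.1) q.2 ω - p q.1) + (p q.1 - d) by ring]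
          exact abs_add_le _ _
        simp only [Set.mem_ofPred_eq]
        linarith
    _ ≤ _ := by
        rw [← ofReal_measureReal]
        exact ENNReal.ofReal_le_ofReal
          (measureReal_le_abs_frequency_sub (hE _) (hind _) (hp _) (half_pos hε) _)

/-- Limits of increasing sequences of independent events are independent. -/
theorem ae_tendsto_frequency_iUnion {F : ℕ → ℕ → Set Ω} (hF : ∀ m j, MeasurableSet (F m j))
    (hind : ∀ m, Pairwise fun i j => IndepSet (F m i) (F m j) μ)
    (hmono : ∀ j, ∀ᵐ ω ∂μ, ∀ m n, m ≤ n → ω ∈ F m j → ω ∈ F n j) {p : ℕ → ℝ≥0∞}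
    (hp : ∀ m j, μ (F m j) = p m) {q : ℝ≥0∞} (hpq : Tendsto p atTop (𝓝 q)) :
    ∀ᵐ ω ∂μ, Tendsto (fun N => frequency (fun j => ⋃ m, F m j) N ω) atTop (𝓝 q.toReal) := by
  have hU : ∀ j, MeasurableSet (⋃ m, F m j) := fun j => MeasurableSet.iUnion fun m => hF m j
  have hev : ∀ j, ∀ᵐ ω ∂μ, ∀ᶠ m in atTop, ω ∈ F m j ↔ ω ∈ ⋃ m, F m j := by
    intro j
    filter_upwards [hmono j] with ω hω
    by_cases h : ω ∈ ⋃ m, F m j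
    · obtain ⟨k, hk⟩ := Set.mem_iUnion.1 h
      filter_upwards [eventually_ge_atTop k] with m hm
      exact iff_of_true (hω k m hm hk) h
    · exact Eventually.of_forall fun m => iff_of_false (fun h' => h (Set.mem_iUnion.2 ⟨m, h'⟩)) h
  have hlim : ∀ j, Tendsto (fun m => μ (F m j)) atTop (𝓝 (μ (⋃ m, F m j))) := fun j =>
    tendsto_measure_of_ae_tendsto_indicator_of_isFiniteMeasure atTop (hU j) (fun m => hF m j) (hev j)
  have hq : ∀ j, μ (⋃ m, F m j) = q := fun j =>
    tendsto_nhds_unique (hlim j) (by simpa only [hp] using hpq)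
  refine ae_tendsto_frequency hU (fun i j hij => ?_) (fun j => by rw [measureReal_def, hq])
  refine (indepSet_iff_measure_inter_eq_mul (hU i) (hU j) μ).2 ?_
  have h1 : Tendsto (fun m => μ (F m i ∩ F m j)) atTop
      (𝓝 (μ ((⋃ m, F m i) ∩ ⋃ m, F m j))) := by
    refine tendsto_measure_of_ae_tendsto_indicator_of_isFiniteMeasure atTop ((hU i).inter (hU j))
      (fun m => (hF m i).inter (hF m j)) ?_
    filter_upwards [hev i, hev j] with ω h1 h2
    filter_upwards [h1, h2] with m h3 h4
    exact and_congr h3 h4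
  refine tendsto_nhds_unique h1 ?_
  have h2 := ENNReal.Tendsto.mul (hlim i) (Or.inr (measure_ne_top _ _)) (hlim j)
    (Or.inr (measure_ne_top _ _))
  refine h2.congr fun m => ?_
  exact ((indepSet_iff_measure_inter_eq_mul (hF m i) (hF m j) μ).1 (hind m hij)).symm

end Frequencies

/-! ### Limits of tail probabilities and events of scores. -/

namespace ModelDepth

section ChiLimits

variable {a : ℕ → ℝ}

theorem tendsto_measure_lt_chiSeries (ha : Summable fun p => a p ^ 2) (ha0 : ∃ p, a p ≠ 0)
    {x : ℕ → ℝ} {r : ℝ} (hx : Tendsto x atTop (𝓝 r)) :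
    Tendsto (fun n => gaussSeq {z | x n < chiSeries a z}) atTop
      (𝓝 (gaussSeq {z | r < chiSeries a z})) := by
  refine tendsto_measure_of_ae_tendsto_indicator_of_isFiniteMeasure atTop
    (measurableSet_lt measurable_const (measurable_chiSeries a))
    (fun n => measurableSet_lt measurable_const (measurable_chiSeries a)) ?_
  have hne : ∀ᵐ z ∂gaussSeq, chiSeries a z ≠ r := by
    rw [ae_iff]; simpa using gaussSeq_chiSeries_eq ha ha0 r
  filter_upwards [hne] with z hzr
  rcases lt_or_gt_of_ne hzr with h | h
  · filter_upwards [hx.eventually_const_lt h] with n hn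
    exact ⟨fun h1 => absurd hn (not_lt.2 (le_of_lt h1)), fun h1 => absurd h1 (not_lt.2 h.le)⟩
  · filter_upwards [hx.eventually_lt_const h] with n hn
    exact ⟨fun _ => h, fun _ => hn⟩

theorem tendsto_measure_lt_chiPart (ha : Summable fun p => a p ^ 2) (ha0 : ∃ p, a p ≠ 0)
    {x : ℕ → ℝ} {r : ℝ} (hx : Tendsto x atTop (𝓝 r)) :
    Tendsto (fun n => gaussSeq {z | x n < chiPart a n z}) atTop
      (𝓝 (gaussSeq {z | r < chiSeries a z})) := by
  refine tendsto_measure_of_ae_tendsto_indicator_of_isFiniteMeasure atTop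
    (measurableSet_lt measurable_const (measurable_chiSeries a))
    (fun n => measurableSet_lt measurable_const (measurable_chiPart a n)) ?_
  have hne : ∀ᵐ z ∂gaussSeq, chiSeries a z ≠ r := by
    rw [ae_iff]; simpa using gaussSeq_chiSeries_eq ha ha0 r
  filter_upwards [ae_summable_chi ha, hne] with z hz hzr
  have ht := tendsto_chiPart hz
  rcases lt_or_gt_of_ne hzr with h | h
  · filter_upwards [ht.eventually_lt hx h] with n hn
    exact ⟨fun h1 => absurd hn (not_lt.2 (le_of_lt h1)), fun h1 => absurd h1 (not_lt.2 h.le)⟩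
  · filter_upwards [hx.eventually_lt ht h] with n hn
    exact ⟨fun _ => h, fun _ => hn⟩

/-- The partial sums increase to the series, so with a constant bound and strict inequality atoms
would do no harm. -/
theorem tendsto_measure_const_lt_chiPart (ha : Summable fun p => a p ^ 2) (y : ℝ) :
    Tendsto (fun n => gaussSeq {z | y < chiPart a n z}) atTop
      (𝓝 (gaussSeq {z | y < chiSeries a z})) := by
  refine tendsto_measure_of_ae_tendsto_indicator_of_isFiniteMeasure atTop
    (measurableSet_lt measurable_const (measurable_chiSeries a))
    (fun n => measurableSet_lt measurable_const (measurable_chiPart a n)) ?_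
  filter_upwards [ae_summable_chi ha] with z hz
  rcases le_or_gt (chiSeries a z) y with h | h
  · exact Eventually.of_forall fun n =>
      ⟨fun h1 => absurd (lt_of_lt_of_le h1 (chiPart_le_chiSeries hz n)) (not_lt.2 h),
        fun h1 => absurd h1 (not_lt.2 h)⟩
  · filter_upwards [(tendsto_chiPart hz).eventually_const_lt h] with n hn
    exact ⟨fun _ => h, fun _ => hn⟩

theorem tendsto_measure_natCast_lt_chiSeries :
    Tendsto (fun n : ℕ => gaussSeq {z | (n : ℝ) < chiSeries a z}) atTop (𝓝 0) := by
  rw [← measure_empty (μ := gaussSeq)]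
  refine tendsto_measure_of_ae_tendsto_indicator_of_isFiniteMeasure atTop MeasurableSet.empty
    (fun n => measurableSet_lt measurable_const (measurable_chiSeries a)) (ae_of_all _ fun z => ?_)
  filter_upwards [tendsto_natCast_atTop_atTop.eventually_ge_atTop (chiSeries a z)] with n hn
  exact iff_of_false (fun h => not_lt.2 hn h) (Set.notMem_empty z)

end ChiLimits

section ScoreEvents

variable {Ω : Type*} [MeasurableSpace Ω] {μ : Measure Ω} [IsProbabilityMeasure μ]
  {K : I → I → ℝ} {lam : ℕ → ℝ} {phi : ℕ → L2I}

theorem map_sqrt_gaussSeq (hlam : ∀ p, 0 ≤ lam p) :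
    gaussSeq.map (fun z p => √(lam p) * z p)
      = Measure.infinitePi fun p => gaussianReal 0 (lam p).toNNReal := by
  rw [gaussSeq, Measure.infinitePi_map_pi _ (f := fun p x => √(lam p) * x) fun p => by fun_prop]
  congr 1
  ext1 p
  rw [gaussianReal_map_const_mul, mul_zero, mul_one]
  congr 1
  ext
  simp [Real.sq_sqrt (hlam p), Real.coe_toNNReal _ (hlam p)]

theorem measure_scores_mem {X : I → Ω → ℝ} (hX : IsZeroMeanGP X K μ)
    (hK : Integrable (fun t => K t t) volume) (hphi : IsEigenSystem K lam phi)
    {S : Set (ℕ → ℝ)} (hS : MeasurableSet S) :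
    μ {ω | (fun p => coeff (fun t => X t ω) (phi p)) ∈ S}
      = gaussSeq {z | (fun p => √(lam p) * z p) ∈ S} := by
  have h1 := (hX.hasLaw_scores hK hphi).map_eq
  rw [← map_sqrt_gaussSeq hphi.nonneg] at h1
  have hm1 : Measurable fun ω p => coeff (fun t => X t ω) (phi p) :=
    measurable_pi_iff.2 fun p => hX.measurable_coeff (phi p)
  have hm2 : Measurable fun (z : ℕ → ℝ) p => √(lam p) * z p := by fun_prop
  refine (Measure.map_apply hm1 hS).symm.trans ?_
  rw [h1, Measure.map_apply hm2 hS]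
  rfl

variable {g : ℕ → I → Ω → ℝ}

theorem measurableSet_scores {X : I → Ω → ℝ} (hX : IsZeroMeanGP X K μ) (phi : ℕ → L2I)
    {S : Set (ℕ → ℝ)} (hS : MeasurableSet S) :
    MeasurableSet {ω | (fun p => coeff (fun t => X t ω) (phi p)) ∈ S} :=
  (measurable_pi_iff.2 fun p => hX.measurable_coeff (phi p)) hS

theorem pairwise_indepSet_scores (hg : ∀ j, IsZeroMeanGP (g j) K μ)
    (hi : iIndepFun (fun j ω t => g j t ω) μ) (hK : Integrable (fun t => K t t) volume)
    (phi : ℕ → L2I) {S : Set (ℕ → ℝ)} (hS : MeasurableSet S) :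
    Pairwise fun i j => IndepSet {ω | (fun p => coeff (fun t => g i t ω) (phi p)) ∈ S}
      {ω | (fun p => coeff (fun t => g j t ω) (phi p)) ∈ S} μ := by
  intro i j hij
  refine (indepSet_iff_measure_inter_eq_mul (measurableSet_scores (hg i) phi hS)
    (measurableSet_scores (hg j) phi hS) μ).2 ?_
  exact ((iIndepFun_scores hg hi hK phi).indepFun hij).measure_inter_preimage_eq_mul S S hS hS

theorem iIndepFun_indicator_scores (hg : ∀ j, IsZeroMeanGP (g j) K μ)
    (hi : iIndepFun (fun j ω t => g j t ω) μ) (hK : Integrable (fun t => K t t) volume)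
    (phi : ℕ → L2I) {S : Set (ℕ → ℝ)} (hS : MeasurableSet S) :
    iIndepFun (fun j => Set.indicator
      {ω | (fun p => coeff (fun t => g j t ω) (phi p)) ∈ S} fun _ => (1 : ℝ)) μ :=
  (iIndepFun_scores hg hi hK phi).comp (fun _ => S.indicator fun _ => (1 : ℝ))
    fun _ => measurable_const.indicator hS

end ScoreEvents

/-- The truncated squared norm as a function of the scores. -/
noncomputable def scoreNorm (lam a : ℕ → ℝ) (m : ℕ) (c : ℕ → ℝ) : ℝ :=
  ∑ p ∈ Finset.range m, c p ^ 2 / lam p * a p ^ 2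

theorem measurable_scoreNorm (lam a : ℕ → ℝ) (m : ℕ) : Measurable (scoreNorm lam a m) := by
  unfold scoreNorm; fun_prop

/-- The cancellation on which the theorem rests: in standardized scores the eigenvalues disappear
and only the number of terms is left. -/
theorem scoreNorm_eq_chiPart {lam a : ℕ → ℝ} {m : ℕ} {c z : ℕ → ℝ} (hlam : ∀ p < m, 0 < lam p)
    (hc : ∀ p < m, c p = √(lam p) * z p) : scoreNorm lam a m c = chiPart a m z := by
  refine Finset.sum_congr rfl fun p hp => ?_
  have h := hlam p (Finset.mem_range.1 hp)
  rw [hc p (Finset.mem_range.1 hp), mul_pow, Real.sq_sqrt h.le, mul_div_cancel_left₀ _ h.ne']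

/-- The Monte Carlo part of the problem, for fixed data: independent Gaussian samples with known
spectral systems, truncation levels `C n → ∞`, and observed values `x n`. -/
structure MonteCarloSetting {Ω : Type*} [MeasurableSpace Ω] (μ : Measure Ω)
    (Kn : ℕ → I → I → ℝ) (lamn : ℕ → ℕ → ℝ) (phin : ℕ → ℕ → L2I) (g : ℕ → ℕ → I → Ω → ℝ)
    (a : ℕ → ℝ) (C : ℕ → ℕ) (x : ℕ → ℝ) (d : ℝ) : Prop where
  integrable : ∀ n, Integrable (fun t => Kn n t t) volume
  eigen : ∀ n, IsEigenSystem (Kn n) (lamn n) (phin n)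
  gaussian : ∀ n j, IsZeroMeanGP (g n j) (Kn n) μ
  indep : ∀ n, iIndepFun (fun j ω t => g n j t ω) μ
  summable : Summable fun p => a p ^ 2
  ne_zero : ∃ p, a p ≠ 0
  level : Tendsto C atTop atTop
  pos : ∀ᶠ n in atTop, ∀ p < C n, 0 < lamn n p
  limit : (∃ r, Tendsto x atTop (𝓝 r) ∧ d = gaussSeq.real {z | r < chiSeries a z}) ∨
    (Tendsto x atTop atTop ∧ d = 0)

namespace MonteCarloSetting

variable {Ω : Type*} [MeasurableSpace Ω] {μ : Measure Ω} [IsProbabilityMeasure μ]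
  {Kn : ℕ → I → I → ℝ} {lamn : ℕ → ℕ → ℝ} {phin : ℕ → ℕ → L2I} {g : ℕ → ℕ → I → Ω → ℝ}
  {a : ℕ → ℝ} {C : ℕ → ℕ} {x : ℕ → ℝ} {d : ℝ}

/-- The event that the `j`-th Monte Carlo function is at least as far out as the observation. -/
def event (lamn : ℕ → ℕ → ℝ) (phin : ℕ → ℕ → L2I) (g : ℕ → ℕ → I → Ω → ℝ) (a : ℕ → ℝ) (C : ℕ → ℕ)
    (x : ℕ → ℝ) (n j : ℕ) : Set Ω :=
  {ω | (fun p => coeff (fun t => g n j t ω) (phin n p)) ∈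
    {c | x n ≤ scoreNorm (lamn n) a (C n) c}}

variable (S : MonteCarloSetting μ Kn lamn phin g a C x d)
include S

theorem measurableSet_event (n j : ℕ) : MeasurableSet (event lamn phin g a C x n j) :=
  measurableSet_scores (S.gaussian n j) _
    (measurableSet_le measurable_const (measurable_scoreNorm _ _ _))

theorem iIndepFun_event (n : ℕ) :
    iIndepFun (fun j => (event lamn phin g a C x n j).indicator fun _ => (1 : ℝ)) μ :=
  iIndepFun_indicator_scores (S.gaussian n) (S.indep n) (S.integrable n) _
    (measurableSet_le measurable_const (measurable_scoreNorm _ _ _))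

theorem pairwise_indepSet_event (n : ℕ) : Pairwise fun i j =>
    IndepSet (event lamn phin g a C x n i) (event lamn phin g a C x n j) μ :=
  pairwise_indepSet_scores (S.gaussian n) (S.indep n) (S.integrable n) _
    (measurableSet_le measurable_const (measurable_scoreNorm _ _ _))

theorem measureReal_event (n j : ℕ) : μ.real (event lamn phin g a C x n j)
    = gaussSeq.real {z | x n ≤ scoreNorm (lamn n) a (C n) fun p => √(lamn n p) * z p} :=
  congrArg ENNReal.toReal (measure_scores_mem (S.gaussian n j) (S.integrable n) (S.eigen n)
    (measurableSet_le measurable_const (measurable_scoreNorm _ _ _)))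

theorem tendsto_measureReal_event : Tendsto (fun n =>
    gaussSeq.real {z | x n ≤ scoreNorm (lamn n) a (C n) fun p => √(lamn n p) * z p})
      atTop (𝓝 d) := by
  have hcongr : ∀ᶠ n in atTop, gaussSeq.real {z | x n ≤ chiPart a (C n) z} =
      gaussSeq.real {z | x n ≤ scoreNorm (lamn n) a (C n) fun p => √(lamn n p) * z p} := by
    filter_upwards [S.pos] with n hn
    congr 1
    ext z
    rw [Set.mem_ofPred_eq, Set.mem_ofPred_eq, scoreNorm_eq_chiPart hn fun p _ => rfl]
  refine Tendsto.congr' hcongr ?_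
  rcases S.limit with ⟨r, hr, rfl⟩ | ⟨hx, rfl⟩
  · exact (ENNReal.tendsto_toReal (measure_ne_top _ _)).comp
      (tendsto_measure_chiPart_ge S.summable S.ne_zero S.level hr)
  · exact (ENNReal.tendsto_toReal ENNReal.zero_ne_top).comp
      (tendsto_measure_chiPart_ge_atTop S.summable C hx)

/-- Joint convergence of the frequencies for common random numbers. -/
theorem ae_tendsto_of_common {Z : ℕ → ℕ → Ω → ℝ} (hZ : ∀ n j, ∀ᵐ ω ∂μ, ∀ p < C n,
      coeff (fun t => g n j t ω) (phin n p) = √(lamn n p) * Z j p ω) :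
    ∀ᵐ ω ∂μ, Tendsto (fun q : ℕ × ℕ => frequency (event lamn phin g a C x q.1) q.2 ω)
      (atTop ×ˢ atTop) (𝓝 d) := by
  -- Neither measurability nor independence of `Z` is assumed. For each `m` a fixed index `ν m` with
  -- `C (ν m) ≥ m` is chosen, and `F y m j` is written with the scores at that index; almost surely
  -- it is the event `y < chiPart a m (Z j)`.
  have hex : ∀ m, ∃ n, m ≤ C n ∧ ∀ p < C n, 0 < lamn n p := fun m =>
    ((S.level.eventually_ge_atTop m).and S.pos).exists
  choose ν hνC hνpos using hex
  set F : ℝ → ℕ → ℕ → Set Ω := fun y m j =>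
    {ω | (fun p => coeff (fun t => g (ν m) j t ω) (phin (ν m) p)) ∈
      {c | y < scoreNorm (lamn (ν m)) a m c}} with hFdef
  have hmS : ∀ y m, MeasurableSet {c : ℕ → ℝ | y < scoreNorm (lamn (ν m)) a m c} := fun y m =>
    measurableSet_lt measurable_const (measurable_scoreNorm _ _ _)
  have hF : ∀ y m j, MeasurableSet (F y m j) := fun y m j =>
    measurableSet_scores (S.gaussian _ _) _ (hmS y m)
  have hind : ∀ y m, Pairwise fun i j => IndepSet (F y m i) (F y m j) μ := fun y m =>
    pairwise_indepSet_scores (S.gaussian _) (S.indep _) (S.integrable _) _ (hmS y m)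
  have hprob : ∀ y m j, μ (F y m j) = gaussSeq {z | y < chiPart a m z} := by
    intro y m j
    rw [hFdef, measure_scores_mem (S.gaussian _ _) (S.integrable _) (S.eigen _) (hmS y m)]
    congr 1
    ext z
    rw [Set.mem_ofPred_eq, Set.mem_ofPred_eq, Set.mem_ofPred_eq,
      scoreNorm_eq_chiPart (fun p hp => hνpos m p (hp.trans_le (hνC m))) fun p _ => rfl]
  have hrel : ∀ᵐ ω ∂μ, ∀ n j, ∀ p < C n,
      coeff (fun t => g n j t ω) (phin n p) = √(lamn n p) * Z j p ω :=
    ae_all_iff.2 fun n => ae_all_iff.2 fun j => hZ n j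
  have hmem : ∀ ω, (∀ n j, ∀ p < C n,
      coeff (fun t => g n j t ω) (phin n p) = √(lamn n p) * Z j p ω) →
      ∀ y m j, ω ∈ F y m j ↔ y < chiPart a m fun p => Z j p ω := by
    intro ω hω y m j
    rw [hFdef, Set.mem_ofPred_eq, Set.mem_ofPred_eq,
      scoreNorm_eq_chiPart (z := fun p => Z j p ω)
        (fun p hp => hνpos m p (hp.trans_le (hνC m)))
        fun p hp => hω _ j p (hp.trans_le (hνC m))]
  have hmono : ∀ y j, ∀ᵐ ω ∂μ, ∀ m n, m ≤ n → ω ∈ F y m j → ω ∈ F y n j := by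
    intro y j
    filter_upwards [hrel] with ω hω m n hmn h
    rw [hmem ω hω] at h ⊢
    exact h.trans_le (chiPart_mono _ hmn)
  have hpart : ∀ y m, ∀ᵐ ω ∂μ, Tendsto (fun N => frequency (F y m) N ω) atTop
      (𝓝 (gaussSeq {z | y < chiPart a m z}).toReal) := fun y m =>
    ae_tendsto_frequency (hF y m) (hind y m) fun j => by rw [measureReal_def, hprob]
  have hunion : ∀ y, ∀ᵐ ω ∂μ, Tendsto (fun N => frequency (fun j => ⋃ m, F y m j) N ω) atTop
      (𝓝 (gaussSeq {z | y < chiSeries a z}).toReal) := fun y =>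
    ae_tendsto_frequency_iUnion (hF y) (hind y) (hmono y) (hprob y)
      (tendsto_measure_const_lt_chiPart S.summable y)
  -- The squeeze: `event n j` lies in `⋃ m, F y m j` if `y < x n`, and contains `F y m j` if `x n <
  -- y` and `m ≤ C n`. The outer events do not depend on `n`, so their frequencies converge in `N`
  -- alone.
  have hupper : ∀ ω, (∀ n j, ∀ p < C n,
      coeff (fun t => g n j t ω) (phin n p) = √(lamn n p) * Z j p ω) →
      ∀ y n, (∀ p < C n, 0 < lamn n p) → y < x n → ∀ N,
      frequency (event lamn phin g a C x n) N ω ≤ frequency (fun j => ⋃ m, F y m j) N ω := by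
    intro ω hω y n hpos hy N
    refine frequency_mono (fun j hj => Set.mem_iUnion.2 ⟨C n, (hmem ω hω y _ j).2 ?_⟩) N
    rw [event, Set.mem_ofPred_eq, Set.mem_ofPred_eq,
      scoreNorm_eq_chiPart (z := fun p => Z j p ω) hpos fun p hp => hω n j p hp] at hj
    exact hy.trans_le hj
  have hlower : ∀ ω, (∀ n j, ∀ p < C n,
      coeff (fun t => g n j t ω) (phin n p) = √(lamn n p) * Z j p ω) →
      ∀ y n m, (∀ p < C n, 0 < lamn n p) → x n < y → m ≤ C n → ∀ N,
      frequency (F y m) N ω ≤ frequency (event lamn phin g a C x n) N ω := by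
    intro ω hω y n m hpos hy hm N
    refine frequency_mono (fun j hj => ?_) N
    rw [event, Set.mem_ofPred_eq, Set.mem_ofPred_eq,
      scoreNorm_eq_chiPart (z := fun p => Z j p ω) hpos fun p hp => hω n j p hp]
    exact hy.le.trans (((hmem ω hω y m j).1 hj).le.trans (chiPart_mono _ hm))
  rcases S.limit with ⟨r, hr, rfl⟩ | ⟨hx, rfl⟩
  · have hk : Tendsto (fun k : ℕ => 1 / ((k : ℝ) + 1)) atTop (𝓝 0) :=
      tendsto_one_div_add_atTop_nhds_zero_nat
    have hu : Tendsto (fun k : ℕ => r - 1 / ((k : ℝ) + 1)) atTop (𝓝 r) := by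
      simpa using hk.const_sub r
    have hv : Tendsto (fun k : ℕ => r + 1 / ((k : ℝ) + 1)) atTop (𝓝 r) := by
      simpa using hk.const_add r
    have hGu := (ENNReal.tendsto_toReal (measure_ne_top _ _)).comp
      (tendsto_measure_lt_chiSeries S.summable S.ne_zero hu)
    have hGv := (ENNReal.tendsto_toReal (measure_ne_top _ _)).comp
      (tendsto_measure_lt_chiPart S.summable S.ne_zero hv)
    -- Countably many levels `r ± 1/(k+1)` keep the exceptional set null; below, `k` also serves as
    -- the number of terms.
    filter_upwards [hrel, ae_all_iff.2 fun k : ℕ => hunion (r - 1 / ((k : ℝ) + 1)),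
      ae_all_iff.2 fun k : ℕ => hpart (r + 1 / ((k : ℝ) + 1)) k] with ω hω h1 h2
    refine tendsto_order.2 ⟨fun b hb => ?_, fun b hb => ?_⟩
    · obtain ⟨k, hkb⟩ := (hGv.eventually_const_lt hb).exists
      have hpos : (0 : ℝ) < 1 / ((k : ℝ) + 1) := by positivity
      have hn : ∀ᶠ n in atTop, (∀ p < C n, 0 < lamn n p) ∧ x n < r + 1 / ((k : ℝ) + 1) ∧ k ≤ C n :=
        S.pos.and ((hr.eventually_lt_const (by linarith)).and (S.level.eventually_ge_atTop k))
      filter_upwards [hn.prod_mk ((h2 k).eventually_const_lt hkb)] with q hq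
      exact hq.2.trans_le (hlower ω hω _ q.1 k hq.1.1 hq.1.2.1 hq.1.2.2 q.2)
    · obtain ⟨k, hkb⟩ := (hGu.eventually_lt_const hb).exists
      have hpos : (0 : ℝ) < 1 / ((k : ℝ) + 1) := by positivity
      have hn : ∀ᶠ n in atTop, (∀ p < C n, 0 < lamn n p) ∧ r - 1 / ((k : ℝ) + 1) < x n :=
        S.pos.and (hr.eventually_const_lt (by linarith))
      filter_upwards [hn.prod_mk ((h1 k).eventually_lt_const hkb)] with q hq
      exact (hupper ω hω _ q.1 hq.1.1 hq.1.2 q.2).trans_lt hq.2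
  · have hG := (ENNReal.tendsto_toReal ENNReal.zero_ne_top).comp
      (tendsto_measure_natCast_lt_chiSeries (a := a))
    rw [ENNReal.toReal_zero] at hG
    filter_upwards [hrel, ae_all_iff.2 fun k : ℕ => hunion k] with ω hω h1
    refine tendsto_order.2 ⟨fun b hb => ?_, fun b hb => ?_⟩
    · exact Eventually.of_forall fun q => hb.trans_le (frequency_nonneg _ _ _)
    · obtain ⟨k, hkb⟩ := (hG.eventually_lt_const hb).exists
      have hn := S.pos.and (hx.eventually_gt_atTop (k : ℝ))
      filter_upwards [hn.prod_mk ((h1 k).eventually_lt_const hkb)] with q hq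
      exact (hupper ω hω _ q.1 hq.1.1 hq.1.2 q.2).trans_lt hq.2

end MonteCarloSetting

end ModelDepth

/-! ### The model norm, and the depth estimate as a frequency. -/

namespace ModelDepth

section ModelNorm

theorem integrable_diagonal {K : I → I → ℝ} (hK : Continuous (fun z : I × I => K z.1 z.2)) :
    Integrable (fun t => K t t) (volume : Measure I) :=
  (hK.comp (continuous_id.prodMk continuous_id)).integrable_of_hasCompactSupport
    (HasCompactSupport.of_compactSpace _)

theorem memLp_kernel {K : I → I → ℝ} (hK : Continuous (fun z : I × I => K z.1 z.2)) :
    MemLp (fun z : I × I => K z.1 z.2) 2 (volume : Measure (I × I)) := by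
  obtain ⟨B, hB⟩ := isCompact_univ.exists_bound_of_continuousOn hK.continuousOn
  exact MemLp.of_bound hK.aestronglyMeasurable B (ae_of_all _ fun z => hB z trivial)

variable {Ω : Type*} [MeasurableSpace Ω] {P : Measure Ω} [IsProbabilityMeasure P]
  {X : I → Ω → ℝ} {K : I → I → ℝ} {lam : ℕ → ℝ} {phi : ℕ → L2I} {a : ℕ → ℝ}

theorem tsum_ofReal_scores {z : ℕ → ℝ} (hlam : ∀ p, 0 < lam p)
    (hz : Summable fun p => z p ^ 2 * a p ^ 2) :
    ∑' p, ENNReal.ofReal ((√(lam p) * z p) ^ 2 / lam p * a p ^ 2)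
      = ENNReal.ofReal (chiSeries a z) := by
  rw [chiSeries, ENNReal.ofReal_tsum_of_nonneg (fun p => by positivity) hz]
  refine tsum_congr fun p => ?_
  rw [mul_pow, Real.sq_sqrt (hlam p).le, mul_div_cancel_left₀ _ (hlam p).ne']

/-- The tail of the law of `‖X‖²_mod` is that of the weighted chi-square series. -/
theorem one_sub_modCDF_ofReal (hX : IsZeroMeanGP X K P)
    (hK : Integrable (fun t => K t t) volume) (hphi : IsEigenSystem K lam phi)
    (hlam : ∀ p, 0 < lam p) (ha : Summable fun p => a p ^ 2) {r : ℝ} (hr : 0 ≤ r) :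
    1 - modCDF P X lam phi a (ENNReal.ofReal r) = gaussSeq.real {z | r < chiSeries a z} := by
  have hS : MeasurableSet {c : ℕ → ℝ |
      ∑' p, ENNReal.ofReal (c p ^ 2 / lam p * a p ^ 2) ≤ ENNReal.ofReal r} :=
    measurableSet_le (Measurable.tsum fun p => by fun_prop) measurable_const
  have h1 : modCDF P X lam phi a (ENNReal.ofReal r)
      = gaussSeq.real {z | chiSeries a z ≤ r} := by
    have h2 := measure_scores_mem hX hK hphi hS
    refine congrArg ENNReal.toReal (h2.trans (measure_congr ?_))
    filter_upwards [ae_summable_chi ha] with z hz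
    refine propext ?_
    have h3 : (∑' p, ENNReal.ofReal ((√(lam p) * z p) ^ 2 / lam p * a p ^ 2)
        ≤ ENNReal.ofReal r) ↔ chiSeries a z ≤ r := by
      rw [tsum_ofReal_scores hlam hz, ENNReal.ofReal_le_ofReal_iff hr]
    exact h3
  have h4 : {z | r < chiSeries a z} = {z | chiSeries a z ≤ r}ᶜ := by
    ext z; simp only [Set.mem_compl_iff, Set.mem_ofPred_eq, not_le]
  rw [h1, h4, probReal_compl_eq_one_sub
    (measurableSet_le (measurable_chiSeries a) measurable_const)]

theorem one_sub_modCDF_top : 1 - modCDF P X lam phi a ∞ = 0 := by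
  simp [modCDF]

theorem modSq_of_summable {h : I → ℝ} (hlam : ∀ p, 0 < lam p)
    (hs : Summable fun p => coeff h (phi p) ^ 2 / lam p * a p ^ 2) :
    modSq lam phi a h = ENNReal.ofReal (∑' p, coeff h (phi p) ^ 2 / lam p * a p ^ 2) :=
  (ENNReal.ofReal_tsum_of_nonneg (fun p => by have := hlam p; positivity) hs).symm

theorem modSq_of_not_summable {h : I → ℝ} (hlam : ∀ p, 0 < lam p)
    (hs : ¬ Summable fun p => coeff h (phi p) ^ 2 / lam p * a p ^ 2) :
    modSq lam phi a h = ∞ := by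
  by_contra hne
  refine hs ((ENNReal.summable_toReal hne).congr fun p => ?_)
  have := hlam p
  rw [ENNReal.toReal_ofReal (by positivity)]

theorem modHat_le_iff {lamHat : ℕ → ℝ} {phiHat : ℕ → L2I} (hnn : ∀ p, 0 ≤ lamHat p) (m : ℕ)
    (h h' : I → ℝ) : modHat lamHat phiHat a m h ≤ modHat lamHat phiHat a m h' ↔
      scoreNorm lamHat a m (fun p => coeff h (phiHat p))
        ≤ scoreNorm lamHat a m (fun p => coeff h' (phiHat p)) :=
  Real.sqrt_le_sqrt_iff (Finset.sum_nonneg fun p _ => by have := hnn p; positivity)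

theorem mcDepth_eq_frequency (nrm : (I → ℝ) → ℝ) (fobs : I → ℝ) (g : ℕ → I → Ω → ℝ) (N : ℕ)
    (ω : Ω) {E : ℕ → Set Ω} (hE : ∀ j, ω ∈ E j ↔ nrm fobs ≤ nrm fun t => g j t ω) :
    mcDepth nrm fobs (fun j t => g j t ω) N = frequency E N ω := by
  classical
  rw [mcDepth, frequency]
  congr 1
  refine Finset.sum_congr rfl fun j _ => ?_
  rw [Set.indicator_apply]
  simp only [hE]

end ModelNorm

section EmpiricalKernel

variable {f : ℕ → I → ℝ}

theorem memLp_centred (hf : ∀ i, MemLp (f i) 2 volume) (n i : ℕ) :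
    MemLp (fun t => f i t - sampleMean f n t) 2 volume := by
  refine (hf i).sub ?_
  unfold sampleMean
  exact (memLp_finsetSum _ fun i _ => hf i).const_mul _

theorem memLp_empCov (hf : ∀ i, MemLp (f i) 2 volume) (n : ℕ) :
    MemLp (fun z : I × I => empCov f n z.1 z.2) 2 (volume : Measure (I × I)) := by
  unfold empCov
  exact (memLp_finsetSum _ fun i _ =>
    memLp_mul_fst_snd (memLp_centred hf n i) (memLp_centred hf n i)).const_mul _

theorem integrable_empCov_diagonal (hf : ∀ i, MemLp (f i) 2 volume) (n : ℕ) :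
    Integrable (fun t => empCov f n t t) volume := by
  unfold empCov
  refine (integrable_finsetSum _ fun i _ => ?_).const_mul _
  exact (memLp_centred hf n i).integrable_mul (memLp_centred hf n i)

end EmpiricalKernel

theorem tendsto_rate_kernelOp {k : ℕ → I → I → ℝ} {K : I → I → ℝ}
    (hk : ∀ n, MemLp (fun z : I × I => k n z.1 z.2) 2 (volume : Measure (I × I)))
    (hK : MemLp (fun z : I × I => K z.1 z.2) 2 (volume : Measure (I × I))) {θ : ℝ}
    (h : Tendsto (fun n : ℕ => ENNReal.ofReal ((n : ℝ) ^ θ) *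
      ∫⁻ z : I × I, ENNReal.ofReal ((k n z.1 z.2 - K z.1 z.2) ^ 2)) atTop (𝓝 0)) :
    Tendsto (fun n : ℕ => (n : ℝ) ^ θ * ‖kernelOp ((hk n).toLp _) - kernelOp (hK.toLp _)‖ ^ 2)
      atTop (𝓝 0) := by
  have h1 := (ENNReal.tendsto_toReal ENNReal.zero_ne_top).comp h
  rw [ENNReal.toReal_zero] at h1
  refine squeeze_zero (fun n => by positivity) (fun n => ?_) h1
  have h2 : ∫⁻ z : I × I, ENNReal.ofReal ((k n z.1 z.2 - K z.1 z.2) ^ 2)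
      = ENNReal.ofReal (‖(hk n).toLp _ - hK.toLp _‖ ^ 2) := by
    rw [← MemLp.toLp_sub, norm_toLp_sq, ofReal_integral_eq_lintegral_ofReal
      ((hk n).sub hK).integrable_sq (ae_of_all _ fun z => sq_nonneg _)]
    rfl
  rw [Function.comp_apply, h2, ← ENNReal.ofReal_mul (by positivity),
    ENNReal.toReal_ofReal (by positivity)]
  gcongr
  exact norm_kernelOp_sub_le _ _

end ModelDepth

/-! ### The theorem. -/

open ModelDepth in
theorem theorem3
    -- the true model: a zero-mean Gaussian process with covariance function `K`
    {Ω₀ : Type*} [MeasurableSpace Ω₀] (P₀ : Measure Ω₀) [IsProbabilityMeasure P₀]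
    (X : I → Ω₀ → ℝ) (K : I → I → ℝ) (hK : Continuous (fun z : I × I => K z.1 z.2))
    (hX : IsZeroMeanGP X K P₀)
    (lam : ℕ → ℝ) (phi : ℕ → L2I) (hphi : IsEigenSystem K lam phi)
    (β : ℝ) (hlam : EigenDecay lam β)
    -- the weights
    (a : ℕ → ℝ) (ha : Summable (fun p => a p ^ 2)) (ha0 : ∃ p, a p ≠ 0) (hab : WeightDecay a)
    -- the data: an i.i.d. sample from the true model
    {Ω : Type*} [MeasurableSpace Ω] (P : Measure Ω) [IsProbabilityMeasure P]
    (f : ℕ → I → Ω → ℝ) (hf : ∀ i, IsZeroMeanGP (f i) K P)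
    (hfi : iIndepFun (fun i ω t => f i t ω) P)
    -- the empirical spectral system and the truncation level
    (lamHat : ℕ → Ω → ℕ → ℝ) (phiHat : ℕ → Ω → ℕ → L2I)
    (hhat : ∀ᵐ ω ∂P, ∀ n,
      IsEigenSystem (empCov (fun i t => f i t ω) n) (lamHat n ω) (phiHat n ω))
    (δ : ℕ → ℝ) (hδ : AdmissibleThreshold δ β)
    (M C : ℕ → Ω → ℕ)
    (hM : (∀ n ω, M n ω = truncLevel (lamHat n ω) (δ n)) ∨
      (∀ n ω, M n ω = truncLevel lam (δ n)))
    (hC : ∀ n ω, C n ω = min (M n ω) n)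
    -- the Monte Carlo samples: given the data `ω`, for every `n` an i.i.d. sample
    -- `g n 0, g n 1, …` from the Gaussian process with the estimated covariance function
    {Ω' : Type*} [MeasurableSpace Ω'] (Q : Kernel Ω Ω') [IsMarkovKernel Q]
    (g : ℕ → ℕ → I → Ω → Ω' → ℝ)
    (hg : ∀ᵐ ω ∂P, ∀ n,
      (∀ j, IsZeroMeanGP (fun t => g n j t ω) (empCov (fun i t => f i t ω) n) (Q ω)) ∧
      iIndepFun (fun j ω' t => g n j t ω ω') (Q ω))
    -- the observation
    (fobs : I → ℝ) (hfobs : MemLp fobs 2 volume)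
    -- the Monte Carlo depth estimate and its target
    (D : ℕ → ℕ → Ω → Ω' → ℝ)
    (hD : ∀ n N ω ω', D n N ω ω' =
      mcDepth (modHat (lamHat n ω) (phiHat n ω) a (C n ω)) fobs (fun j t => g n j t ω ω') N)
    (d : ℝ) (hd : d = 1 - modCDF P₀ X lam phi a (modSq lam phi a fobs)) :
    ∀ᵐ ω ∂P,
      -- almost surely, first `N → ∞` and then `n → ∞`
      (∀ᵐ ω' ∂(Q ω), ∃ L : ℕ → ℝ,
        (∀ n, Tendsto (fun N => D n N ω ω') atTop (𝓝 (L n))) ∧ Tendsto L atTop (𝓝 d)) ∧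
      -- almost surely, jointly, for `N ≥ N₀ n` where `N₀` grows faster than the logarithm
      (∀ N₀ : ℕ → ℕ, Tendsto (fun n : ℕ => (N₀ n : ℝ) / Real.log n) atTop atTop →
        ∀ᵐ ω' ∂(Q ω), ∀ ε : ℝ, 0 < ε →
          ∀ᶠ n in atTop, ∀ N, N₀ n ≤ N → |D n N ω ω' - d| < ε) ∧
      -- almost surely, jointly and without restriction, if the standardized scores of the
      -- `j`-th Monte Carlo function are the same for all `n`
      ((∃ Z : ℕ → ℕ → Ω' → ℝ, ∀ n j, ∀ᵐ ω' ∂(Q ω), ∀ p < C n ω,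
          coeff (fun t => g n j t ω ω') (phiHat n ω p) = √(lamHat n ω p) * Z j p ω') →
        ∀ᵐ ω' ∂(Q ω), Tendsto (fun q : ℕ × ℕ => D q.1 q.2 ω ω') (atTop ×ˢ atTop) (𝓝 d)) ∧
      -- in probability, jointly and without restriction
      TendstoInMeasure (Q ω) (fun (q : ℕ × ℕ) ω' => D q.1 q.2 ω ω') (atTop ×ˢ atTop)
        (fun _ => d) := by
  have hβ : 1 < β := hlam.1
  have hKd := integrable_diagonal hK
  -- The exponent required by `PerturbationSetting.rate`; it is below `1` because `β > 0`.
  have hrate := ae_tendsto_empCov hK hf hfi (θ := (3 * β + 2) / (4 * β + 2)) (by positivity)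
    (by rw [div_lt_one (by linarith)]; linarith)
  filter_upwards [hhat, hg, hrate, ae_all_iff.2 fun i => (hf i).ae_memLp_path hKd]
    with ω hhat hg hrate hpath
  have hKL := memLp_kernel hK
  have hkL := memLp_empCov hpath
  have hP : PerturbationSetting (kernelOp (hKL.toLp _)) (fun n => kernelOp ((hkL n).toLp _)) lam
      (fun n => lamHat n ω) phi (fun n => phiHat n ω) β δ (fun n => C n ω) :=
    { spectral := hphi.spectralSystem hKL
      spectraln := fun n => (hhat n).spectralSystem (hkL n)
      decay := hlam
      threshold := hδ
      rate := tendsto_rate_kernelOp hkL hKL hrate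
      level := by
        rcases hM with h | h
        · left; intro n; rw [hC, h]
        · right; intro n; rw [hC, h] }
  set x : ℕ → ℝ := fun n => scoreNorm (lamHat n ω) a (C n ω) fun p => coeff fobs (phiHat n ω p)
    with hx
  -- The two cases are finite and infinite model norm of `fobs`; in the second `F(∞) = 1` makes the
  -- depth zero.
  have hlim : (∃ r, Tendsto x atTop (𝓝 r) ∧ d = gaussSeq.real {z | r < chiSeries a z}) ∨
      (Tendsto x atTop atTop ∧ d = 0) := by
    by_cases hs : Summable fun p => coeff fobs (phi p) ^ 2 / lam p * a p ^ 2
    · left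
      refine ⟨∑' p, coeff fobs (phi p) ^ 2 / lam p * a p ^ 2, ?_, ?_⟩
      · simp only [coeff_eq_inner hfobs] at hs ⊢
        simpa only [hx, scoreNorm, coeff_eq_inner hfobs] using
          hP.tendsto_sum_of_summable (hfobs.toLp fobs) ha hs
      · rw [hd, modSq_of_summable hP.pos hs, one_sub_modCDF_ofReal hX hKd hphi hP.pos ha
          (tsum_nonneg fun p => by have := hP.pos p; positivity)]
    · right
      refine ⟨?_, by rw [hd, modSq_of_not_summable hP.pos hs, one_sub_modCDF_top]⟩
      simp only [coeff_eq_inner hfobs] at hs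
      simpa only [hx, scoreNorm, coeff_eq_inner hfobs] using
        hP.tendsto_sum_of_not_summable (hfobs.toLp fobs) hs
  have hS : MonteCarloSetting (Q ω) (fun n => empCov (fun i t => f i t ω) n)
      (fun n => lamHat n ω) (fun n => phiHat n ω) (fun n j t => g n j t ω) a (fun n => C n ω) x d :=
    { integrable := integrable_empCov_diagonal hpath
      eigen := hhat
      gaussian := fun n => (hg n).1
      indep := fun n => (hg n).2
      summable := ha
      ne_zero := ha0
      level := hP.tendsto_level
      pos := hP.eventually_bounds.mono fun n h p hp => (h p hp).1
      limit := hlim }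
  have hDf : ∀ n N ω', D n N ω ω' = frequency (MonteCarloSetting.event (fun n => lamHat n ω)
      (fun n => phiHat n ω) (fun n j t => g n j t ω) a (fun n => C n ω) x n) N ω' := by
    intro n N ω'
    rw [hD]
    exact mcDepth_eq_frequency _ fobs (fun j t => g n j t ω) N ω' fun j =>
      (modHat_le_iff (hhat n).nonneg _ _ _).symm
  simp only [hDf]
  refine ⟨ae_exists_tendsto_frequency hS.measurableSet_event hS.pairwise_indepSet_event
    hS.measureReal_event hS.tendsto_measureReal_event, fun N₀ hN₀ =>
    ae_eventually_forall_frequency hS.measurableSet_event hS.iIndepFun_event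
      hS.measureReal_event hS.tendsto_measureReal_event hN₀, ?_,
    tendstoInMeasure_frequency hS.measurableSet_event hS.iIndepFun_event
      hS.measureReal_event hS.tendsto_measureReal_event⟩
  rintro ⟨Z, hZ⟩
  exact hS.ae_tendsto_of_common hZ
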